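/- Let $(\Omega,\mathcal F,\mathbb P)$ be a probability space, let $1\le d\le n$ be integers, let $X_1,\dots,X_n$ be i.i.d. random elements of a measurable space $(E,\mathcal E)$, and let $W=f(X_1,\dots,X_n)\in L^4(\mathbb P)$, where $f:E^n\to\mathbb R$ is measurable, $\mathbb E[W]=0$ and $\mathbb E[W^2]=1$. For $J\subseteq[n]=\{1,\dots,n\}$ put $\mathcal F_J=\sigma(X_j : j\in J)$, and let $W=\sum_{J\subseteq[n]}W_J$ be the Hoeffding decomposition of $W$, i.e. the a.s. unique decomposition into integrable $\mathcal F_J$-measurable random variables $W_J$ such that $\mathbb E[W_J\mid\mathcal F_K]=0$ a.s. whenever $J\not\subseteq K$. Suppose that $W$ is a degenerate $U$-statistic of order $d$, that is, $W_J=0$ a.s. for all $J$ with $|J|\ne d$, and that it is symmetric, that is, there is one measurable function $g:E^d\to\mathbb R$ with $W_J=g(X_{j_1},\dots,X_{j_d})$ a.s. for all $J=\{j_1<\dots<j_d\}\subseteq[n]$. Let $$\rho_n^2=\max_{1\le i\le n}\ \sum_{K\subseteq[n],\,|K|=d,\,i\in K}\operatorname{Var}(W_K),\qquad d_{\rm Wass}(X,Y)=\sup_{h\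 1\text{-Lipschitz}}\bigl|\mathbb E[h(X)]-\mathbb E[h(Y)]\bigr| ,$$ and let $Z\sim N(0,1)$. Then $\rho_n^2=d/n$, and $$d_{\rm Wass}(W,Z)\le\Bigl(\sqrt{\tfrac2\pi}+\tfrac43\Bigr)\sqrt{\bigl|\mathbb E[W^4]-3\bigr|}+\frac{\sqrt{d\,\kappa_d}}{\sqrt n}\Bigl(\sqrt{\tfrac2\pi}+\tfrac{2\sqrt2}{\sqrt3}\Bigr),$$ where $\kappa_d\in[0,\infty)$ is a constant that depends only on $d$. In particular, fix $d\ge1$, let $n_m\to\infty$, and for each $m\ge1$ let $W_m\in L^4$ be a symmetric degenerate $U$-statistic of order $d$ of $n_m$ i.i.d. random elements $X^{(m)}_1,\dots,X^{(m)}_{n_m}$ with $\mathbb E[W_m]=0$ and $\mathbb E[W_m^2]=1$ (the probability space, the measurable space and the kernel may depend on $m$). If $\mathbb E[W_m^4]\to3$, then $W_m$ converges in distribution to $Z\sim N(0,1)$. -/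

import Mathlib

open MeasureTheory ProbabilityTheory Filter
open scoped NNReal ENNReal

namespace DegenerateUStat

/-- The σ-algebra `F_J = σ(X_j : j ∈ J)`. -/
@[reducible] def sigmaAlg {n : ℕ} {Ω : Type*} {E : Fin n → Type*} [∀ i, MeasurableSpace (E i)]
    (X : ∀ i, Ω → E i) (J : Finset (Fin n)) : MeasurableSpace Ω :=
  ⨆ j ∈ J, MeasurableSpace.comap (X j) inferInstance

/-- `W = ∑_{J ⊆ [n]} W_J` is the Hoeffding decomposition of `W` with respect to `X_1, …, X_n`:
each (integrable) `W_J` is `F_J`-measurable, and `E[W_J | F_K] = 0` a.s. whenever `J ⊄ K`. -/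
structure IsHoeffdingDecomposition {n : ℕ} {Ω : Type*} [MeasurableSpace Ω] (P : Measure Ω)
    {E : Fin n → Type*} [∀ i, MeasurableSpace (E i)] (X : ∀ i, Ω → E i) (W : Ω → ℝ)
    (WJ : Finset (Fin n) → Ω → ℝ) : Prop where
  measurable : ∀ J, Measurable[sigmaAlg X J] (WJ J)
  integrable : ∀ J, Integrable (WJ J) P
  condExp_eq_zero : ∀ J K, ¬ J ⊆ K → P[WJ J | sigmaAlg X K] =ᵐ[P] 0
  sum_eq : W =ᵐ[P] fun ω ↦ ∑ J, WJ J ω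

/-- `W = f(X_1, …, X_n)`, with `X_1, …, X_n` independent, is a degenerate `U`-statistic of order
`d ∈ {1, …, n}`, with Hoeffding components `W_J`: only those with `|J| = d` do not vanish. -/
structure IsDegenerateUStatistic {n : ℕ} {Ω : Type*} [MeasurableSpace Ω] (P : Measure Ω)
    {E : Fin n → Type*} [∀ i, MeasurableSpace (E i)] (d : ℕ) (X : ∀ i, Ω → E i) (W : Ω → ℝ)
    (WJ : Finset (Fin n) → Ω → ℝ) : Prop where
  one_le : 1 ≤ d
  le : d ≤ n
  measurable_data : ∀ i, Measurable (X i)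
  indep : iIndepFun X P
  exists_kernel : ∃ f : (∀ i, E i) → ℝ, Measurable f ∧ W = fun ω ↦ f fun i ↦ X i ω
  hoeffding : IsHoeffdingDecomposition P X W WJ
  eq_zero : ∀ J, J.card ≠ d → WJ J =ᵐ[P] 0

/-- A degenerate `U`-statistic of order `d` is symmetric if the data are i.i.d. with values in one
measurable space `E`, and if one measurable kernel `g : E^d → ℝ` gives all components:
`W_J = g(X_{j_1}, …, X_{j_d})` a.s. for every `J = {j_1 < ⋯ < j_d}`. -/
structure IsSymmetricDegenerateUStatistic {n : ℕ} {Ω : Type*} [MeasurableSpace Ω]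
    (P : Measure Ω) {E : Type*} [MeasurableSpace E] (d : ℕ) (X : Fin n → Ω → E) (W : Ω → ℝ)
    (WJ : Finset (Fin n) → Ω → ℝ) : Prop
    extends IsDegenerateUStatistic P d X W WJ where
  identDistrib : ∀ i j, IdentDistrib (X i) (X j) P P
  exists_common_kernel : ∃ g : (Fin d → E) → ℝ, Measurable g ∧
    ∀ (J : Finset (Fin n)) (hJ : J.card = d),
      WJ J =ᵐ[P] fun ω ↦ g fun k ↦ X (J.orderEmbOfFin hJ k) ω

/-- `W` is in `L⁴`, centered, and of unit variance. -/
structure IsNormalizedL4 {Ω : Type*} [MeasurableSpace Ω] (P : Measure Ω) (W : Ω → ℝ) : Prop where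
  memLp : MemLp W 4 P
  mean_eq_zero : ∫ ω, W ω ∂P = 0
  second_moment_eq_one : ∫ ω, W ω ^ 2 ∂P = 1

/-- The quantity `ρ_n² = max_{1 ≤ i ≤ n} ∑_{|K| = d, i ∈ K} σ_K²`, where `σ_K² = Var(W_K)`. -/
noncomputable def rhoSq {n : ℕ} {Ω : Type*} [MeasurableSpace Ω] (P : Measure Ω) (d : ℕ)
    (WJ : Finset (Fin n) → Ω → ℝ) : ℝ :=
  ⨆ i : Fin n, ∑ K : Finset (Fin n) with K.card = d ∧ i ∈ K, Var[WJ K; P]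

/-- The Wasserstein distance between the distributions of two integrable random variables:
the supremum of `|E h(X) - E h(Y)|` over all `1`-Lipschitz functions `h`. -/
noncomputable def dWass {Ω Ω' : Type*} [MeasurableSpace Ω] [MeasurableSpace Ω']
    (P : Measure Ω) (P' : Measure Ω') (X : Ω → ℝ) (Y : Ω' → ℝ) : ℝ≥0∞ :=
  ⨆ (h : ℝ → ℝ) (_ : LipschitzWith 1 h),
    ENNReal.ofReal |(∫ ω, h (X ω) ∂P) - ∫ ω, h (Y ω) ∂P'|

end DegenerateUStat

/-!
The fourth moment theorem for symmetric degenerate `U`-statistics, proved by Stein's method for the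
resampling pairs of the data, together with the spectral theory of the Efron-Stein operator.

All estimates are made on the product space, for `W = ∑_{|J| = d} w_J` with a canonical family
`w_J` (`IsCanonicalFamily`). Let `W^{(i)}` be `W` with the `i`-th coordinate resampled
independently. For a solution `f` of the Stein equation `f' - x f = h - E h(Z)`, expand an
antiderivative of `f` in `E[F(W^{(i)}) - F(W)] = 0` to second order and sum over `i`. Since
`∑ (1 - R_i) W = d W`, where `R_i` averages out the coordinate `i`, this yields
`|E[W f(W)] - E[f'(W) S]| ≤ (3 d)⁻¹ ∑ E|W^{(i)} - W|³` (`abs_stein_remainder_le`), where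
`S = W² - N(W²) / (2 d)` is the carré-du-champ of `W` and `N = ∑ (1 - R_i)` (`numOp`). With
`|f'| ≤ √(2/π)` and `f'` being `2`-Lipschitz (`exists_stein_solution`), the distance of `W` from the
normal law is controlled by `E(1 - S)²` and by `∑ E|W^{(i)} - W|³`; by Cauchy-Schwarz and
`∑ E(W^{(i)} - W)⁴ = d (12 E[W² S] - 4 E[W⁴])` (`sum_integral_increment_pow_four`), the latter is
controlled by `E[W² S]` and `E[W⁴]`.

It remains to bound these two quantities by the fourth cumulant and the influence `ρ` of a
single coordinate (`carre_bounds`). Split `W² = T + Q`, where `T` is the sum of `w_J w_K` over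
disjoint `J, K` (`topPart`), which is the part of `W²` of exact order `2 d`, on which `N / (2 d)` is
the identity. Then `S - 1` depends only on `Q - 1`, and as the spectrum of `N / (2 d)` on `Q` lies
in `[0, 1]` (`HasOrderLE.spectral_bounds`), `E(S - 1)²` and `E[W² S] - 1` are at most
`E(Q - 1)² = E[W⁴] - E[T²] - 1`. Finally `E[T²] ≥ 2 - (4^d + 1) d ρ` (`le_integral_topPart_sq`): in
the expansion of `E[T²]`, the sum without the disjointness constraints is a sum of
squares (`le_sum_diffs`), two parts of which are `(∑ σ_J²)² = 1` and the sum of `σ_J² σ_K²` over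
disjoint `J, K`, which is at least `1 - d ρ`; and the terms violating the constraints involve
intersecting index sets, hence have a total of at most `4^d d ρ` (`abs_sum_meeting_le`).

For symmetric `W` all `σ_J²` equal `1 / n.choose d`, so that `ρ = d / n`
(`IsSymmetricDegenerateUStatistic.rhoSq_eq`).
-/

namespace DegenerateUStat

/-! ### The Stein equation of the standard normal law -/

lemma hasDerivAt_gaussianPDFReal (x : ℝ) :
    HasDerivAt (gaussianPDFReal 0 1) (-(x * gaussianPDFReal 0 1 x)) x := by
  have h : HasDerivAt (fun y : ℝ ↦ -y ^ 2 / 2) (-x) x := by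
    refine (((hasDerivAt_id x).pow 2).neg.div_const 2).congr_deriv ?_
    simp only [id, Nat.cast_ofNat]
    ring
  have h2 := (h.exp).const_mul (√(2 * Real.pi))⁻¹
  have e : gaussianPDFReal 0 1 = fun y ↦ (√(2 * Real.pi))⁻¹ * Real.exp (-y ^ 2 / 2) := by
    ext y; simp [gaussianPDFReal]
  rw [e]
  refine h2.congr_deriv ?_
  ring

lemma integral_gaussianReal_eq (g : ℝ → ℝ) :
    ∫ x, g x ∂(gaussianReal 0 1) = ∫ x, g x * gaussianPDFReal 0 1 x := by
  rw [integral_gaussianReal_eq_integral_smul one_ne_zero]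
  simp [mul_comm]

lemma integrable_mul_gaussianPDFReal : Integrable fun x ↦ x * gaussianPDFReal 0 1 x := by
  have := (integrable_mul_exp_neg_mul_sq (b := 1 / 2) (by norm_num)).const_mul (√(2 * Real.pi))⁻¹
  refine this.congr (Eventually.of_forall fun x ↦ ?_)
  simp only [gaussianPDFReal]
  have : -(1 / 2) * x ^ 2 = -(x - 0) ^ 2 / (2 * ((1 : ℝ≥0) : ℝ)) := by
    simp; ring
  rw [this]
  simp
  ring

lemma integrable_id_gaussianReal : Integrable (fun z : ℝ ↦ z) (gaussianReal 0 1) :=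
  (memLp_id_gaussianReal (μ := 0) (v := 1) 1).integrable (by simp)

/-- Gaussian integration by parts, `E[g'(Z)] = E[Z g(Z)]`. -/
lemma integral_deriv_gaussianReal {g g' : ℝ → ℝ} {C C' : ℝ}
    (hg : ∀ x, HasDerivAt g (g' x) x) (hc : Continuous g') (hb : ∀ x, |g x| ≤ C)
    (hb' : ∀ x, |g' x| ≤ C') :
    ∫ x, g' x ∂(gaussianReal 0 1) = ∫ x, x * g x ∂(gaussianReal 0 1) := by
  have hgc : Continuous g := continuous_iff_continuousAt.2 fun x ↦ (hg x).continuousAt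
  have hi := integrable_gaussianPDFReal 0 1
  have i1 : Integrable (gaussianPDFReal 0 1 * g') := by
    refine Integrable.mul_bdd (c := C') hi hc.aestronglyMeasurable
      (Eventually.of_forall hb')
  have i2 : Integrable ((fun x ↦ -(x * gaussianPDFReal 0 1 x)) * g) := by
    refine Integrable.mul_bdd (c := C) integrable_mul_gaussianPDFReal.neg hgc.aestronglyMeasurable
      (Eventually.of_forall hb)
  have i3 : Integrable (gaussianPDFReal 0 1 * g) := by
    refine Integrable.mul_bdd (c := C) hi hgc.aestronglyMeasurable
      (Eventually.of_forall hb)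
  have key := integral_mul_deriv_eq_deriv_mul_of_integrable
    (fun x _ ↦ hasDerivAt_gaussianPDFReal x) (fun x _ ↦ hg x) i1 i2 i3
  rw [integral_gaussianReal_eq, integral_gaussianReal_eq]
  calc ∫ x, g' x * gaussianPDFReal 0 1 x = ∫ x, gaussianPDFReal 0 1 x * g' x := by
        simp_rw [mul_comm]
    _ = _ := by
        rw [key, ← integral_neg]
        congr 1; ext x; ring

lemma integral_abs_gaussianReal : ∫ x, |x| ∂(gaussianReal 0 1) = √(2 / Real.pi) := by
  rw [integral_gaussianReal_eq]
  have h1 : ∫ x, |x| * gaussianPDFReal 0 1 x = ∫ x : ℝ, (fun y ↦ y * gaussianPDFReal 0 1 y) |x| := by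
    congr 1; ext x; simp [gaussianPDFReal]
  rw [h1, integral_comp_abs (f := fun y ↦ y * gaussianPDFReal 0 1 y)]
  have ht : Tendsto (fun x ↦ -gaussianPDFReal 0 1 x) atTop (nhds (-0)) := by
    refine Tendsto.neg ?_
    have : Tendsto (fun x : ℝ ↦ -x ^ 2 / 2) atTop atBot := by
      have h := (tendsto_pow_atTop (α := ℝ) (n := 2) two_ne_zero).atTop_div_const (r := 2)
        (by norm_num)
      refine (tendsto_neg_atTop_atBot.comp h).congr fun x ↦ ?_
      simp; ring
    have h2 := (Real.tendsto_exp_atBot.comp this).const_mul (√(2 * Real.pi))⁻¹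
    rw [mul_zero] at h2
    refine h2.congr fun x ↦ ?_
    simp [gaussianPDFReal]
  have h2 : ∫ x in Set.Ioi (0 : ℝ), x * gaussianPDFReal 0 1 x
      = -0 - (-gaussianPDFReal 0 1 0) := by
    refine integral_Ioi_of_hasDerivAt_of_tendsto' (f := fun x ↦ -gaussianPDFReal 0 1 x)
      (fun x _ ↦ ?_) integrable_mul_gaussianPDFReal.integrableOn ht
    exact (hasDerivAt_gaussianPDFReal x).neg.congr_deriv (by ring)
  rw [h2]
  simp only [gaussianPDFReal]
  simp
  have hp := Real.pi_pos
  have : √2 * √2 = 2 := Real.mul_self_sqrt (by norm_num)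
  field_simp
  nlinarith

lemma tendsto_mul_exp_neg_sq {f : ℝ → ℝ} {C : ℝ} (hb : ∀ x, |f x| ≤ C) {l : Filter ℝ}
    (hl : Tendsto (fun x : ℝ ↦ x ^ 2) l atTop) :
    Tendsto (fun x ↦ f x * Real.exp (-x ^ 2 / 2)) l (nhds 0) := by
  have h1 : Tendsto (fun x : ℝ ↦ Real.exp (-x ^ 2 / 2)) l (nhds 0) := by
    refine Real.tendsto_exp_atBot.comp ?_
    refine (tendsto_neg_atTop_atBot.comp (hl.atTop_div_const (r := 2) (by norm_num))).congr
      fun x ↦ ?_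
    simp; ring
  have h2 := h1.const_mul C
  rw [mul_zero] at h2
  refine squeeze_zero_norm (fun x ↦ ?_) h2
  rw [norm_mul, Real.norm_eq_abs, Real.norm_eq_abs, abs_of_pos (Real.exp_pos _)]
  exact mul_le_mul_of_nonneg_right (hb x) (Real.exp_pos _).le

lemma hasDerivAt_exp_neg_sq (x : ℝ) :
    HasDerivAt (fun y : ℝ ↦ Real.exp (-y ^ 2 / 2)) (-x * Real.exp (-x ^ 2 / 2)) x := by
  have h : HasDerivAt (fun y : ℝ ↦ -y ^ 2 / 2) (-x) x := by
    refine (((hasDerivAt_id x).pow 2).neg.div_const 2).congr_deriv ?_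
    simp only [id, Nat.cast_ofNat]
    ring
  refine h.exp.congr_deriv ?_
  ring

/-- The half-line case of `stein_monotone`. The bound is obtained by comparing
`f(x) exp(-x²/2)` with `x exp(-x²/2) / (1 + x²)`, the classical minorant of the Gaussian tail. -/
lemma stein_monotone_of_nonneg {f f' H : ℝ → ℝ} {C : ℝ} (hf : ∀ x, HasDerivAt f (f' x) x)
    (hs : ∀ x, f' x - x * f x = H x) (hH : Monotone H) (hb : ∀ x, |f x| ≤ C) {w : ℝ}
    (hw : 0 ≤ w) : (1 + w ^ 2) * f w + w * H w ≤ 0 := by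
  have hd : ∀ x, HasDerivAt (fun y ↦ f y * Real.exp (-y ^ 2 / 2))
      (H x * Real.exp (-x ^ 2 / 2)) x := fun x ↦ by
    refine ((hf x).mul (hasDerivAt_exp_neg_sq x)).congr_deriv ?_
    rw [← hs x]; ring
  rcases le_or_gt 0 (H w) with h0 | h0
  · have hψ : ∀ x : ℝ, HasDerivAt (fun y : ℝ ↦ y / (1 + y ^ 2) * Real.exp (-y ^ 2 / 2))
        ((2 / (1 + x ^ 2) ^ 2 - 1) * Real.exp (-x ^ 2 / 2)) x := fun x ↦ by
      have hne : (1 + x ^ 2) ≠ 0 := by positivity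
      have h1 : HasDerivAt (fun y : ℝ ↦ 1 + y ^ 2) (2 * x) x := by
        have := ((hasDerivAt_id x).pow 2).const_add 1
        simpa using this
      have h2 := ((hasDerivAt_id x).div h1 hne).mul (hasDerivAt_exp_neg_sq x)
      refine h2.congr_deriv ?_
      simp only [id, Pi.div_apply]
      field_simp
      ring
    have hd2 : ∀ x, HasDerivAt (fun y ↦ f y * Real.exp (-y ^ 2 / 2)
        + H w * (y / (1 + y ^ 2) * Real.exp (-y ^ 2 / 2)))
        (H x * Real.exp (-x ^ 2 / 2) + H w * ((2 / (1 + x ^ 2) ^ 2 - 1) * Real.exp (-x ^ 2 / 2)))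
        x := fun x ↦ (hd x).add ((hψ x).const_mul _)
    have hmono : MonotoneOn (fun y ↦ f y * Real.exp (-y ^ 2 / 2)
        + H w * (y / (1 + y ^ 2) * Real.exp (-y ^ 2 / 2))) (Set.Ici w) := by
      refine monotoneOn_of_hasDerivWithinAt_nonneg (convex_Ici w)
        (fun x _ ↦ (hd2 x).continuousAt.continuousWithinAt)
        (fun x _ ↦ (hd2 x).hasDerivWithinAt) fun x hx ↦ ?_
      rw [interior_Ici] at hx
      have h3 : H w ≤ H x := hH (le_of_lt hx)
      have h4 : 0 ≤ 2 / (1 + x ^ 2) ^ 2 := by positivity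
      have h5 := Real.exp_pos (-x ^ 2 / 2)
      have : 0 ≤ (H x - H w + H w * (2 / (1 + x ^ 2) ^ 2)) * Real.exp (-x ^ 2 / 2) := by
        have : 0 ≤ H w * (2 / (1 + x ^ 2) ^ 2) := mul_nonneg h0 h4
        exact mul_nonneg (by linarith) h5.le
      linarith
    have hlim : Tendsto (fun y ↦ f y * Real.exp (-y ^ 2 / 2)
        + H w * (y / (1 + y ^ 2) * Real.exp (-y ^ 2 / 2))) atTop (nhds (0 + H w * 0)) := by
      have hl := tendsto_pow_atTop (α := ℝ) (n := 2) two_ne_zero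
      refine (tendsto_mul_exp_neg_sq hb hl).add
        ((tendsto_mul_exp_neg_sq (C := 1) (fun x ↦ ?_) hl).const_mul _)
      rw [abs_div, abs_of_pos (by positivity : 0 < 1 + x ^ 2), div_le_one (by positivity)]
      rcases abs_cases x with h | h <;> nlinarith [sq_nonneg (x - 1), sq_nonneg (x + 1)]
    have hle := ge_of_tendsto hlim (b := f w * Real.exp (-w ^ 2 / 2)
        + H w * (w / (1 + w ^ 2) * Real.exp (-w ^ 2 / 2))) (by
      filter_upwards [eventually_ge_atTop w] with y hy
      exact hmono Set.self_mem_Ici hy hy)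
    rw [mul_zero, add_zero] at hle
    have h6 : (f w + H w * (w / (1 + w ^ 2))) * Real.exp (-w ^ 2 / 2) ≤ 0 := by linarith
    have h7 : f w + H w * (w / (1 + w ^ 2)) ≤ 0 :=
      nonpos_of_mul_nonpos_left h6 (Real.exp_pos _)
    have h8 : (1 + w ^ 2) * f w + w * H w = (1 + w ^ 2) * (f w + H w * (w / (1 + w ^ 2))) := by
      field_simp
    rw [h8]
    exact mul_nonpos_of_nonneg_of_nonpos (by positivity) h7
  · -- here `f(x) exp(-x²/2)` is nonincreasing on `(-∞, w]` and tends to `0` at `-∞`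
    have hanti : AntitoneOn (fun y ↦ f y * Real.exp (-y ^ 2 / 2)) (Set.Iic w) := by
      refine antitoneOn_of_hasDerivWithinAt_nonpos (convex_Iic w)
        (fun x _ ↦ (hd x).continuousAt.continuousWithinAt)
        (fun x _ ↦ (hd x).hasDerivWithinAt) fun x hx ↦ ?_
      rw [interior_Iic] at hx
      have h3 : H x ≤ H w := hH (le_of_lt hx)
      exact mul_nonpos_of_nonpos_of_nonneg (by linarith) (Real.exp_pos _).le
    have hlim : Tendsto (fun y ↦ f y * Real.exp (-y ^ 2 / 2)) atBot (nhds 0) := by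
      refine tendsto_mul_exp_neg_sq hb ?_
      have := (tendsto_pow_atTop (α := ℝ) (n := 2) two_ne_zero).comp tendsto_neg_atBot_atTop
      refine this.congr fun x ↦ by simp
    have hle := ge_of_tendsto hlim (b := f w * Real.exp (-w ^ 2 / 2)) (by
      filter_upwards [eventually_le_atBot w] with y hy
      exact hanti hy Set.self_mem_Iic hy)
    have h7 : f w ≤ 0 := nonpos_of_mul_nonpos_left hle (Real.exp_pos _)
    have h8 : w * H w ≤ 0 := mul_nonpos_of_nonneg_of_nonpos hw h0.le
    have h9 : (1 + w ^ 2) * f w ≤ 0 := mul_nonpos_of_nonneg_of_nonpos (by positivity) h7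
    linarith

/-- If a bounded `f` solves the Stein equation `f' - x f = H` with `H` nondecreasing, then
`x ↦ x f(x)` is nonincreasing: its derivative is `(1 + x²) f(x) + x H(x) ≤ 0`. -/
lemma stein_monotone {f f' H : ℝ → ℝ} {C : ℝ} (hf : ∀ x, HasDerivAt f (f' x) x)
    (hs : ∀ x, f' x - x * f x = H x) (hH : Monotone H) (hb : ∀ x, |f x| ≤ C) (w : ℝ) :
    (1 + w ^ 2) * f w + w * H w ≤ 0 := by
  rcases le_total 0 w with hw | hw
  · exact stein_monotone_of_nonneg hf hs hH hb hw
  · -- `x ↦ f(-x)` solves the equation with right-hand side `x ↦ -H(-x)`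
    have := stein_monotone_of_nonneg (f := fun x ↦ f (-x)) (f' := fun x ↦ -f' (-x))
      (H := fun x ↦ -H (-x)) (C := C) (fun x ↦ ?_) (fun x ↦ ?_) (fun x y hxy ↦ ?_)
      (fun x ↦ hb _) (neg_nonneg.2 hw)
    · simpa using this
    · exact (((hf (-x)).comp x (hasDerivAt_neg x)).congr_deriv (by simp))
    · simp only [← hs (-x)]; ring
    · exact neg_le_neg (hH (neg_le_neg hxy))

/-- If `h` is `1`-Lipschitz, a bounded solution of its Stein equation has a `2`-Lipschitz
derivative: `h + id` and `id - h` are nondecreasing, so `x f(x) ± x` is monotone by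
`stein_monotone`, and `f' = x f + h - E h(Z)`. -/
lemma stein_deriv_lipschitz {f f' h h' : ℝ → ℝ} {C c : ℝ} (hf : ∀ x, HasDerivAt f (f' x) x)
    (hh : ∀ x, HasDerivAt h (h' x) x) (hh1 : ∀ x, |h' x| ≤ 1)
    (hs : ∀ x, f' x - x * f x = h x - c) (hb : ∀ x, |f x| ≤ C) :
    LipschitzWith 2 f' := by
  have m1 : Monotone fun x ↦ h x - c + x := by
    refine monotone_of_hasDerivAt_nonneg (f' := fun x ↦ h' x + 1)
      (fun x ↦ ((hh x).sub_const c).add (hasDerivAt_id x)) fun x ↦ ?_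
    have := (abs_le.1 (hh1 x)).1
    simp only [Pi.zero_apply]; linarith
  have m2 : Monotone fun x ↦ -(h x - c) + x := by
    refine monotone_of_hasDerivAt_nonneg (f' := fun x ↦ -h' x + 1)
      (fun x ↦ ((hh x).sub_const c).neg.add (hasDerivAt_id x)) fun x ↦ ?_
    have := (abs_le.1 (hh1 x)).2
    simp only [Pi.zero_apply]; linarith
  -- `f - 1` and `-f - 1` solve the Stein equations for `h - c + id` and `-(h - c) + id`
  have k1 := fun w ↦ stein_monotone (f := fun x ↦ f x - 1) (f' := f') (C := C + 1)
    (fun x ↦ (hf x).sub_const 1) (fun x ↦ by simp only [← hs]; ring) m1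
    (fun x ↦ (abs_sub _ _).trans (by simpa using hb x)) w
  have k2 := fun w ↦ stein_monotone (f := fun x ↦ -f x - 1) (f' := fun x ↦ -f' x) (C := C + 1)
    (fun x ↦ (hf x).neg.sub_const 1) (fun x ↦ by simp only [← hs]; ring) m2
    (fun x ↦ (abs_sub _ _).trans (by simpa using hb x)) w
  have e : f' = fun x ↦ x * f x + h x - c := by
    ext x; have := hs x; linarith
  have hd : ∀ x, HasDerivAt f' (f x + x * f' x + h' x) x := fun x ↦ by
    rw [e]
    refine ((((hasDerivAt_id x).mul (hf x)).add (hh x)).sub_const c).congr_deriv ?_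
    simp [e]
  refine lipschitzWith_of_nnnorm_deriv_le (fun x ↦ (hd x).differentiableAt) fun x ↦ ?_
  rw [(hd x).deriv, ← NNReal.coe_le_coe, coe_nnnorm, Real.norm_eq_abs]
  have := abs_le.1 (hh1 x)
  have h1 := k1 x
  have h2 := k2 x
  have h3 := hs x
  have h4 : x * f' x = x ^ 2 * f x + x * (h x - c) := by rw [← h3]; ring
  rw [abs_le]
  push_cast
  constructor <;> nlinarith

/-- The Stein equation `f' - w f = h - E h(Z)` for smooth `1`-Lipschitz `h` has a bounded solution
with `|f'| ≤ √(2/π)` and `f'` `2`-Lipschitz. The solution is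
`f(w) = -∫_0^{π/2} cos θ E[h'(w sin θ + Z cos θ)] dθ`; Gaussian integration by parts turns `f'`
into `-∫_0^{π/2} sin θ E[Z h'(w sin θ + Z cos θ)] dθ`, whence the bound by `E|Z| = √(2/π)`, and
`f' - w f` into the integral of the `θ`-derivative of `E[h(w sin θ + Z cos θ)]`. -/
lemma exists_stein_solution {h h' h'' : ℝ → ℝ} {C : ℝ} (hh : ∀ x, HasDerivAt h (h' x) x)
    (hh' : ∀ x, HasDerivAt h' (h'' x) x) (hc : Continuous h'') (hh1 : ∀ x, |h' x| ≤ 1)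
    (hh2 : ∀ x, |h'' x| ≤ C) :
    ∃ f f' : ℝ → ℝ, (∀ w, HasDerivAt f (f' w) w) ∧
      (∀ w, f' w - w * f w = h w - ∫ z, h z ∂(gaussianReal 0 1)) ∧ (∀ w, |f w| ≤ 2) ∧
      (∀ w, |f' w| ≤ √(2 / Real.pi)) ∧ LipschitzWith 2 f' := by
  have hhc : Continuous h := continuous_iff_continuousAt.2 fun x ↦ (hh x).continuousAt
  have hh'c : Continuous h' := continuous_iff_continuousAt.2 fun x ↦ (hh' x).continuousAt
  have hpi := Real.pi_pos
  have hpi4 := Real.pi_le_four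
  set γ := gaussianReal 0 1 with hγ
  set L : Measure ℝ := volume.restrict (Set.Ioc 0 (Real.pi / 2)) with hL
  have hLuniv : L.real Set.univ = Real.pi / 2 := by
    simp only [hL, measureReal_def, Measure.restrict_apply_univ, Real.volume_Ioc]
    rw [ENNReal.toReal_ofReal] <;> linarith
  have : IsFiniteMeasure L := by rw [hL]; infer_instance
  set ν := L.prod γ with hν
  have hνuniv : ν.real Set.univ = Real.pi / 2 := by
    rw [hν, ← Set.univ_prod_univ, measureReal_prod_prod, hLuniv]; simp
  have hLmem : ∀ᵐ θ ∂L, θ ∈ Set.Ioc 0 (Real.pi / 2) := ae_restrict_mem measurableSet_Ioc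
  set r : ℝ → ℝ × ℝ → ℝ := fun w p ↦ w * Real.sin p.1 + p.2 * Real.cos p.1 with hr
  have hrc : ∀ w, Continuous (r w) := fun w ↦ by simp only [hr]; fun_prop
  have hCnn : 0 ≤ C := (abs_nonneg _).trans (hh2 0)
  have i1 : ∀ w, Integrable (fun p ↦ Real.cos p.1 * h' (r w p)) ν := fun w ↦ by
    refine Integrable.of_bound (C := 1) (Continuous.aestronglyMeasurable ?_)
      (Eventually.of_forall fun p ↦ ?_)
    · have := hrc w; fun_prop
    · rw [norm_mul, Real.norm_eq_abs, Real.norm_eq_abs]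
      exact mul_le_one₀ (Real.abs_cos_le_one _) (abs_nonneg _) (hh1 _)
  have hbd : ∀ w p, |Real.cos p.1 * (h'' (r w p) * Real.sin p.1)| ≤ C := fun w p ↦ by
    rw [abs_mul, abs_mul]
    have a1 := Real.abs_cos_le_one p.1
    have a2 := Real.abs_sin_le_one p.1
    have a3 := hh2 (r w p)
    calc |Real.cos p.1| * (|h'' (r w p)| * |Real.sin p.1|) ≤ 1 * (C * 1) := by gcongr
      _ = C := by ring
  have i2 : ∀ w, Integrable (fun p : ℝ × ℝ ↦ Real.cos p.1 * (h'' (r w p) * Real.sin p.1)) ν :=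
    fun w ↦ by
    refine Integrable.of_bound (C := C) (Continuous.aestronglyMeasurable ?_)
      (Eventually.of_forall fun p ↦ hbd w p)
    have := hrc w; fun_prop
  set f : ℝ → ℝ := fun w ↦ -∫ p, Real.cos p.1 * h' (r w p) ∂ν with hf
  set f' : ℝ → ℝ := fun w ↦ -∫ p, Real.cos p.1 * (h'' (r w p) * Real.sin p.1) ∂ν with hf'
  have hderiv : ∀ w, HasDerivAt f (f' w) w := fun w ↦ by
    refine (hasDerivAt_integral_of_dominated_loc_of_deriv_le (μ := ν)
      (F := fun w p ↦ Real.cos p.1 * h' (r w p))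
      (F' := fun w p ↦ Real.cos p.1 * (h'' (r w p) * Real.sin p.1)) (bound := fun _ ↦ C)
      (s := Set.univ) univ_mem
      (Eventually.of_forall fun w ↦ (i1 w).aestronglyMeasurable) (i1 w)
      (i2 w).aestronglyMeasurable (Eventually.of_forall fun p w _ ↦ hbd w p)
      (integrable_const _) (Eventually.of_forall fun p w _ ↦ ?_)).2.neg
    have e : HasDerivAt (fun w ↦ r w p) (Real.sin p.1) w := by
      simpa [hr] using ((hasDerivAt_id w).mul_const (Real.sin p.1)).add_const
        (p.2 * Real.cos p.1)
    exact ((hh' (r w p)).comp w e).const_mul _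
  -- Gaussian integration by parts for each fixed angle
  have hibp : ∀ w θ, ∫ z, Real.cos θ * (h'' (r w (θ, z)) * Real.sin θ) ∂γ
      = ∫ z, Real.sin θ * (z * h' (r w (θ, z))) ∂γ := fun w θ ↦ by
    have e : ∀ z, HasDerivAt (fun z ↦ h' (r w (θ, z))) (h'' (r w (θ, z)) * Real.cos θ) z :=
      fun z ↦ by
      have e : HasDerivAt (fun z ↦ r w (θ, z)) (Real.cos θ) z := by
        simpa [hr] using ((hasDerivAt_id z).mul_const (Real.cos θ)).const_add
          (w * Real.sin θ)
      exact (hh' _).comp z e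
    have := integral_deriv_gaussianReal (C := 1) (C' := C) e (by
        have := hrc w; fun_prop) (fun z ↦ hh1 _) (fun z ↦ by
        rw [abs_mul]
        calc |h'' (r w (θ, z))| * |Real.cos θ| ≤ C * 1 := by
              gcongr
              · exact hh2 _
              · exact Real.abs_cos_le_one _
          _ = C := mul_one C)
    rw [integral_const_mul, integral_const_mul (r := Real.sin θ), hγ, ← this, ← integral_const_mul,
      ← integral_const_mul]
    congr 1; ext z; ring
  have hzi : Integrable (fun p : ℝ × ℝ ↦ p.2) ν :=
    integrable_id_gaussianReal.comp_snd L
  have i3 : ∀ w, Integrable (fun p : ℝ × ℝ ↦ Real.sin p.1 * (p.2 * h' (r w p))) ν := fun w ↦ by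
    refine hzi.abs.mono' (Continuous.aestronglyMeasurable ?_)
      (Eventually.of_forall fun p ↦ ?_)
    · have := hrc w; fun_prop
    · rw [norm_mul, norm_mul, Real.norm_eq_abs, Real.norm_eq_abs, Real.norm_eq_abs]
      calc _ ≤ 1 * (|p.2| * 1) := by
            gcongr
            · exact Real.abs_sin_le_one _
            · exact hh1 _
        _ = |p.2| := by ring
  have hf'eq : ∀ w, f' w = -∫ p, Real.sin p.1 * (p.2 * h' (r w p)) ∂ν := fun w ↦ by
    simp only [hf']
    rw [integral_prod _ (i2 w), integral_prod _ (i3 w)]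
    simp only [hibp]
  have hbound : ∀ w, |f w| ≤ 2 := fun w ↦ by
    simp only [hf, abs_neg]
    have := norm_integral_le_of_norm_le_const (μ := ν) (C := 1)
      (f := fun p ↦ Real.cos p.1 * h' (r w p)) (Eventually.of_forall fun p ↦ by
        rw [norm_mul, Real.norm_eq_abs, Real.norm_eq_abs]
        exact mul_le_one₀ (Real.abs_cos_le_one _) (abs_nonneg _) (hh1 _))
    rw [hνuniv, Real.norm_eq_abs] at this
    linarith
  have hstein : ∀ w, f' w - w * f w = h w - ∫ z, h z ∂γ := fun w ↦ by
    have i4 : Integrable (fun p : ℝ × ℝ ↦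
        (w * Real.cos p.1 - p.2 * Real.sin p.1) * h' (r w p)) ν := by
      refine (((i1 w).const_mul w).sub (i3 w)).congr (Eventually.of_forall fun p ↦ ?_)
      simp only [Pi.sub_apply]; ring
    have e1 : f' w - w * f w
        = ∫ p, (w * Real.cos p.1 - p.2 * Real.sin p.1) * h' (r w p) ∂ν := by
      rw [hf'eq]
      simp only [hf]
      rw [mul_neg, sub_neg_eq_add, ← integral_const_mul, neg_add_eq_sub,
        ← integral_sub ((i1 w).const_mul w) (i3 w)]
      congr 1; ext p; ring
    -- the integrand is the `θ`-derivative of `h (w sin θ + z cos θ)`, so integrate over `θ` first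
    rw [e1, integral_prod_symm _ i4]
    have e2 : ∀ z, ∫ θ, (w * Real.cos θ - z * Real.sin θ) * h' (r w (θ, z)) ∂L = h w - h z :=
      fun z ↦ by
      rw [hL, ← intervalIntegral.integral_of_le (by positivity)]
      have hd : ∀ θ, HasDerivAt (fun θ ↦ h (r w (θ, z)))
          ((w * Real.cos θ - z * Real.sin θ) * h' (r w (θ, z))) θ := fun θ ↦ by
        have e : HasDerivAt (fun θ ↦ r w (θ, z)) (w * Real.cos θ - z * Real.sin θ) θ := by
          simp only [hr]
          refine (((Real.hasDerivAt_sin θ).const_mul w).add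
            ((Real.hasDerivAt_cos θ).const_mul z)).congr_deriv ?_
          ring
        refine ((hh _).comp θ e).congr_deriv ?_
        ring
      rw [intervalIntegral.integral_eq_sub_of_hasDerivAt (fun θ _ ↦ hd θ)]
      · simp [hr]
      · refine Continuous.intervalIntegrable ?_ _ _
        have : Continuous fun θ ↦ r w (θ, z) := by simp only [hr]; fun_prop
        fun_prop
    simp only [e2]
    have hhi : Integrable h γ := by
      have hlip : ∀ x, |h x| ≤ |h 0| + |x| := fun x ↦ by
        have hL1 : LipschitzWith 1 h := by
          refine lipschitzWith_of_nnnorm_deriv_le (fun x ↦ (hh x).differentiableAt) fun x ↦ ?_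
          rw [(hh x).deriv, ← NNReal.coe_le_coe]
          simpa using hh1 x
        have := hL1.dist_le_mul x 0
        simp only [Real.dist_eq, NNReal.coe_one, one_mul, sub_zero] at this
        have := abs_sub_abs_le_abs_sub (h x) (h 0)
        linarith
      refine Integrable.mono' ((integrable_const |h 0|).add integrable_id_gaussianReal.abs)
        hhc.aestronglyMeasurable (Eventually.of_forall hlip)
    rw [integral_sub (integrable_const _) hhi]
    simp
  refine ⟨f, f', hderiv, hstein, hbound, fun w ↦ ?_, ?_⟩
  · rw [hf'eq, abs_neg, integral_prod _ (i3 w)]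
    have e1 : ∀ θ ∈ Set.Ioc 0 (Real.pi / 2),
        ‖∫ z, Real.sin θ * (z * h' (r w (θ, z))) ∂γ‖ ≤ Real.sin θ * √(2 / Real.pi) := by
      intro θ hθ
      have hs : 0 ≤ Real.sin θ := Real.sin_nonneg_of_nonneg_of_le_pi hθ.1.le (by linarith [hθ.2])
      rw [integral_const_mul, norm_mul, Real.norm_eq_abs, abs_of_nonneg hs]
      refine mul_le_mul_of_nonneg_left ?_ hs
      rw [← integral_abs_gaussianReal]
      refine norm_integral_le_of_norm_le integrable_id_gaussianReal.abs
        (Eventually.of_forall fun z ↦ ?_)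
      rw [norm_mul, Real.norm_eq_abs, Real.norm_eq_abs]
      exact mul_le_of_le_one_right (abs_nonneg _) (hh1 _)
    have e2 := norm_integral_le_of_norm_le (μ := L) (g := fun θ ↦ Real.sin θ * √(2 / Real.pi))
      (f := fun θ ↦ ∫ z, Real.sin θ * (z * h' (r w (θ, z))) ∂γ)
      (by
        refine Integrable.of_bound (C := √(2 / Real.pi))
          (Continuous.aestronglyMeasurable (by fun_prop)) (Eventually.of_forall fun θ ↦ ?_)
        rw [norm_mul, Real.norm_eq_abs, Real.norm_eq_abs, abs_of_nonneg (Real.sqrt_nonneg _)]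
        exact mul_le_of_le_one_left (Real.sqrt_nonneg _) (Real.abs_sin_le_one _))
      (hLmem.mono fun θ hθ ↦ e1 θ hθ)
    rw [Real.norm_eq_abs] at e2
    refine e2.trans (le_of_eq ?_)
    rw [integral_mul_const, hL, ← intervalIntegral.integral_of_le (by positivity), integral_sin]
    simp
  · exact stein_deriv_lipschitz hderiv hh hh1 hstein hbound

/-- The moving average of a `1`-Lipschitz function over windows of length `ε` is `C¹`, is uniformly
`ε`-close to the function, and its derivative is a difference quotient of the function. -/
lemma exists_moving_average {h : ℝ → ℝ} (hh : LipschitzWith 1 h) {ε : ℝ} (hε : 0 < ε) :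
    ∃ g : ℝ → ℝ, (∀ x, HasDerivAt g ((h (x + ε) - h x) / ε) x) ∧ (∀ x, |g x - h x| ≤ ε) ∧
      ∀ x, |(h (x + ε) - h x) / ε| ≤ 1 := by
  have hc := hh.continuous
  have hint : ∀ a b, IntervalIntegrable h volume a b := fun a b ↦ hc.intervalIntegrable a b
  have hd : ∀ x y, |h x - h y| ≤ |x - y| := fun x y ↦ by
    simpa [Real.dist_eq] using hh.dist_le_mul x y
  refine ⟨fun x ↦ (∫ t in x..x + ε, h t) / ε, fun x ↦ ?_, fun x ↦ ?_, fun x ↦ ?_⟩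
  · have e : (fun x ↦ (∫ t in x..x + ε, h t) / ε)
        = fun x ↦ ((∫ t in (0)..x + ε, h t) - ∫ t in (0)..x, h t) / ε := by
      ext x; rw [intervalIntegral.integral_interval_sub_left (hint _ _) (hint _ _)]
    rw [e]
    have h1 : ∀ y, HasDerivAt (fun u ↦ ∫ t in (0)..u, h t) (h y) y := fun y ↦
      intervalIntegral.integral_hasDerivAt_right (hint _ _)
        hc.aestronglyMeasurable.stronglyMeasurableAtFilter hc.continuousAt
    have h2 : HasDerivAt (fun u : ℝ ↦ ∫ t in (0)..u + ε, h t) (h (x + ε)) x :=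
      (h1 (x + ε)).comp_add_const x ε
    exact (h2.sub (h1 x)).div_const ε
  · have e : (∫ t in x..x + ε, h t) / ε - h x = (∫ t in x..x + ε, (h t - h x)) / ε := by
      rw [intervalIntegral.integral_sub (hint _ _) intervalIntegrable_const]
      simp
      field_simp
    rw [e, abs_div, abs_of_pos hε, div_le_iff₀ hε]
    have := intervalIntegral.norm_integral_le_of_norm_le_const (a := x) (b := x + ε) (C := ε)
      (f := fun t ↦ h t - h x) fun t ht ↦ by
        rw [Set.uIoc_of_le (by linarith)] at ht
        refine (hd t x).trans ?_
        rw [abs_of_nonneg] <;> linarith [ht.1, ht.2]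
    simpa [abs_of_pos hε] using this
  · rw [abs_div, abs_of_pos hε, div_le_one hε]
    simpa [abs_of_pos hε] using hd (x + ε) x

/-- Smoothing of a `1`-Lipschitz function, by two successive moving averages. -/
lemma exists_smooth_approx {h : ℝ → ℝ} (hh : LipschitzWith 1 h) {ε : ℝ} (hε : 0 < ε) :
    ∃ (g g' g'' : ℝ → ℝ) (C : ℝ), (∀ x, HasDerivAt g (g' x) x) ∧
      (∀ x, HasDerivAt g' (g'' x) x) ∧ Continuous g'' ∧ (∀ x, |g' x| ≤ 1) ∧
      (∀ x, |g'' x| ≤ C) ∧ ∀ x, |g x - h x| ≤ 2 * ε := by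
  obtain ⟨k, hk1, hk2, hk3⟩ := exists_moving_average hh hε
  have hk : LipschitzWith 1 k := by
    refine lipschitzWith_of_nnnorm_deriv_le (fun x ↦ (hk1 x).differentiableAt) fun x ↦ ?_
    rw [(hk1 x).deriv, ← NNReal.coe_le_coe, coe_nnnorm]
    exact hk3 x
  obtain ⟨g, hg1, hg2, hg3⟩ := exists_moving_average hk hε
  have hc := hh.continuous
  refine ⟨g, _, fun x ↦ ((h (x + ε + ε) - h (x + ε)) / ε - (h (x + ε) - h x) / ε) / ε, 2 / ε,
    hg1, fun x ↦ ?_, by fun_prop, hg3, fun x ↦ ?_, fun x ↦ ?_⟩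
  · refine HasDerivAt.div_const (HasDerivAt.sub ?_ (hk1 x)) ε
    exact (hk1 (x + ε)).comp_add_const x ε
  · rw [abs_div, abs_of_pos hε]
    refine div_le_div_of_nonneg_right ?_ hε.le
    exact (abs_sub _ _).trans (by linarith [hk3 x, hk3 (x + ε)])
  · have := abs_sub_le (g x) (k x) (h x)
    linarith [hg2 x, hk2 x]

/-! ### Averaging operators on a product space -/

section Averaging

set_option linter.unusedSectionVars false

variable {ι : Type*} [Fintype ι] [DecidableEq ι] {E : ι → Type*} [∀ i, MeasurableSpace (E i)]

/-- `condAvg μ K F x` integrates out the coordinates of `F` outside `K`, keeping those of `x` in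
`K`. It is the explicit version of the conditional expectation of `F` given the coordinates in `K`
under the product measure, see `condAvg_ae_eq_condExp`. -/
noncomputable def condAvg (μ : ∀ i, Measure (E i)) (K : Finset ι) (F : (∀ i, E i) → ℝ)
    (x : ∀ i, E i) : ℝ :=
  ∫ y, F (K.piecewise x y) ∂(Measure.pi μ)

/-- The σ-algebra on the product space generated by the coordinates in `K`. -/
@[reducible] def coordAlg (E : ι → Type*) [∀ i, MeasurableSpace (E i)] (K : Finset ι) :
    MeasurableSpace (∀ i, E i) :=
  MeasurableSpace.comap (K.restrict (π := E)) MeasurableSpace.pi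

lemma coordAlg_le (K : Finset ι) : coordAlg E K ≤ MeasurableSpace.pi :=
  Measurable.comap_le (by fun_prop)

lemma measurable_piecewise_prod (K : Finset ι) :
    Measurable fun p : (∀ i, E i) × (∀ i, E i) ↦ K.piecewise p.1 p.2 := by
  refine measurable_pi_iff.2 fun i ↦ ?_
  by_cases hi : i ∈ K
  · simp only [Finset.piecewise, hi, if_true]; fun_prop
  · simp only [Finset.piecewise, hi, if_false]; fun_prop

variable (μ : ∀ i, Measure (E i)) [∀ i, IsProbabilityMeasure (μ i)]

lemma measurePreserving_piecewise (K : Finset ι) :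
    MeasurePreserving (fun p : (∀ i, E i) × (∀ i, E i) ↦ K.piecewise p.1 p.2)
      ((Measure.pi μ).prod (Measure.pi μ)) (Measure.pi μ) := by
  refine ⟨measurable_piecewise_prod K, ?_⟩
  refine (Measure.pi_eq fun s hs ↦ ?_).symm
  rw [Measure.map_apply (measurable_piecewise_prod K) (MeasurableSet.univ_pi hs)]
  have : (fun p : (∀ i, E i) × (∀ i, E i) ↦ K.piecewise p.1 p.2) ⁻¹' Set.univ.pi s
      = (Set.univ.pi fun i ↦ if i ∈ K then s i else Set.univ) ×ˢ
        (Set.univ.pi fun i ↦ if i ∈ K then Set.univ else s i) := by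
    ext p
    simp only [Set.mem_preimage, Set.mem_univ_pi, Set.mem_prod]
    constructor
    · intro h
      refine ⟨fun i ↦ ?_, fun i ↦ ?_⟩ <;> have := h i <;> by_cases hi : i ∈ K <;>
        simp_all [Finset.piecewise]
    · rintro ⟨h1, h2⟩ i
      have := h1 i; have := h2 i
      by_cases hi : i ∈ K <;> simp_all [Finset.piecewise]
  rw [this, Measure.prod_prod, Measure.pi_pi, Measure.pi_pi, ← Finset.prod_mul_distrib]
  refine Finset.prod_congr rfl fun i _ ↦ ?_
  by_cases hi : i ∈ K <;> simp [hi]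

variable {μ}

lemma integral_piecewise_prod (K : Finset ι) {F : (∀ i, E i) → ℝ} (hF : Measurable F) :
    ∫ p : (∀ i, E i) × (∀ i, E i), F (K.piecewise p.1 p.2)
      ∂((Measure.pi μ).prod (Measure.pi μ)) = ∫ x, F x ∂(Measure.pi μ) := by
  conv_rhs => rw [← (measurePreserving_piecewise μ K).map_eq]
  rw [integral_map (measurable_piecewise_prod K).aemeasurable hF.aestronglyMeasurable]

lemma integrable_piecewise_prod (K : Finset ι) {F : (∀ i, E i) → ℝ}
    (hFi : Integrable F (Measure.pi μ)) :
    Integrable (fun p : (∀ i, E i) × (∀ i, E i) ↦ F (K.piecewise p.1 p.2))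
      ((Measure.pi μ).prod (Measure.pi μ)) :=
  (measurePreserving_piecewise μ K).integrable_comp_of_integrable hFi

lemma measurable_condAvg (K : Finset ι) {F : (∀ i, E i) → ℝ}
    (hF : Measurable F) : Measurable (condAvg μ K F) :=
  (StronglyMeasurable.integral_prod_right'
    (f := fun p : (∀ i, E i) × (∀ i, E i) ↦ F (K.piecewise p.1 p.2))
    (hF.comp (measurable_piecewise_prod K)).stronglyMeasurable).measurable

lemma dependsOn_condAvg (K : Finset ι) (F : (∀ i, E i) → ℝ) :
    DependsOn (condAvg μ K F) (K : Set ι) := by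
  intro x y hxy
  simp only [condAvg]
  congr 1; ext z; congr 1; ext i
  by_cases hi : i ∈ K
  · simp [hi, hxy i hi]
  · simp [hi]

/-- Averaging a function of the coordinates in `S` only sees `K ∩ S`. -/
lemma condAvg_eq_of_dependsOn {K S T : Finset ι} {F : (∀ i, E i) → ℝ} (hF : DependsOn F (S : Set ι))
    (hT : ∀ i ∈ S, i ∈ K ↔ i ∈ T) : condAvg μ K F = condAvg μ T F := by
  ext x
  simp only [condAvg]
  congr 1; ext z
  refine hF fun i hi ↦ ?_
  have := hT i hi
  by_cases hi : i ∈ K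
  · simp [hi, this.1 hi]
  · simp [hi, this.not.1 hi]

lemma condAvg_of_dependsOn {K : Finset ι} {F : (∀ i, E i) → ℝ} (hF : DependsOn F (K : Set ι)) :
    condAvg μ K F = F := by
  ext x
  have : ∀ y, F (K.piecewise x y) = F x := fun y ↦ hF fun i hi ↦ by
    simp [Finset.mem_coe.1 hi]
  simp [condAvg, this]

lemma condAvg_mul_of_dependsOn {K : Finset ι} (F : (∀ i, E i) → ℝ) {G : (∀ i, E i) → ℝ}
    (hG : DependsOn G (K : Set ι)) :
    condAvg μ K (fun x ↦ F x * G x) = fun x ↦ condAvg μ K F x * G x := by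
  ext x
  have : ∀ y, G (K.piecewise x y) = G x := fun y ↦ hG fun i hi ↦ by
    simp [Finset.mem_coe.1 hi]
  simp only [condAvg, this, integral_mul_const]

lemma condAvg_congr_ae (K : Finset ι) {F G : (∀ i, E i) → ℝ} (h : F =ᵐ[Measure.pi μ] G) :
    condAvg μ K F =ᵐ[Measure.pi μ] condAvg μ K G := by
  have := (measurePreserving_piecewise μ K).quasiMeasurePreserving.ae_eq_comp h
  filter_upwards [Measure.ae_ae_of_ae_prod this] with x hx
  exact integral_congr_ae hx

lemma integrable_condAvg (K : Finset ι) {F : (∀ i, E i) → ℝ}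
    (hFi : Integrable F (Measure.pi μ)) : Integrable (condAvg μ K F) (Measure.pi μ) :=
  (integrable_piecewise_prod K hFi).integral_prod_left

lemma integral_condAvg (K : Finset ι) {F : (∀ i, E i) → ℝ} (hF : Measurable F)
    (hFi : Integrable F (Measure.pi μ)) :
    ∫ x, condAvg μ K F x ∂(Measure.pi μ) = ∫ x, F x ∂(Measure.pi μ) := by
  rw [← integral_piecewise_prod K hF, integral_prod _ (integrable_piecewise_prod K hFi)]
  rfl

lemma integral_condAvg_mul {K : Finset ι} {F G : (∀ i, E i) → ℝ} (hF : Measurable F)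
    (hGm : Measurable G) (hG : DependsOn G (K : Set ι))
    (hi : Integrable (fun x ↦ F x * G x) (Measure.pi μ)) :
    ∫ x, condAvg μ K F x * G x ∂(Measure.pi μ) = ∫ x, F x * G x ∂(Measure.pi μ) := by
  rw [← integral_condAvg K (F := fun x ↦ F x * G x) (hF.mul hGm) hi,
    condAvg_mul_of_dependsOn F hG]

lemma dependsOn_of_measurable_coordAlg {K : Finset ι} {F : (∀ i, E i) → ℝ}
    (hF : Measurable[coordAlg E K] F) : DependsOn F (K : Set ι) := by
  obtain ⟨g, -, rfl⟩ := hF.exists_eq_measurable_comp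
  intro x y hxy
  simp only [Function.comp]
  congr 1; ext i; exact hxy i i.2

lemma measurable_coordAlg_of_dependsOn [∀ i, Nonempty (E i)] {K : Finset ι}
    {F : (∀ i, E i) → ℝ} (hF : Measurable F) (hd : DependsOn F (K : Set ι)) :
    Measurable[coordAlg E K] F := by
  let x₀ : ∀ i, E i := fun i ↦ Classical.arbitrary _
  have e : F = (fun z : (∀ i : K, E i) ↦ F fun i ↦ if h : i ∈ K then z ⟨i, h⟩ else x₀ i)
      ∘ K.restrict := by
    ext x
    refine hd fun i hi ↦ ?_
    simp [Finset.mem_coe.1 hi]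
  rw [e]
  refine Measurable.comp (hF.comp ?_) (comap_measurable _)
  refine measurable_pi_iff.2 fun i ↦ ?_
  by_cases h : i ∈ K
  · simp only [h, dif_pos]; fun_prop
  · simp only [h, dif_neg, not_false_iff]; fun_prop

lemma condAvg_ae_eq_condExp (K : Finset ι) {F : (∀ i, E i) → ℝ} (hF : Measurable F)
    (hFi : Integrable F (Measure.pi μ)) :
    condAvg μ K F =ᵐ[Measure.pi μ] (Measure.pi μ)[F | coordAlg E K] := by
  have : ∀ i, Nonempty (E i) := fun i ↦ (μ i).nonempty_of_neZero
  refine ae_eq_condExp_of_forall_setIntegral_eq (coordAlg_le K) hFi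
    (fun s _ _ ↦ (integrable_condAvg K hFi).integrableOn) (fun s hs _ ↦ ?_)
    (measurable_coordAlg_of_dependsOn (measurable_condAvg K hF)
      (dependsOn_condAvg K F)).stronglyMeasurable.aestronglyMeasurable
  have hsm := coordAlg_le K s hs
  rw [← integral_indicator hsm, ← integral_indicator hsm]
  have hd : DependsOn (s.indicator fun _ ↦ (1 : ℝ)) (K : Set ι) :=
    dependsOn_of_measurable_coordAlg (measurable_const.indicator hs)
  have e : ∀ F : (∀ i, E i) → ℝ, s.indicator F = fun x ↦ F x * s.indicator (fun _ ↦ (1 : ℝ)) x :=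
    fun F ↦ by ext x; by_cases h : x ∈ s <;> simp [h]
  rw [e F, e (condAvg μ K F)]
  refine integral_condAvg_mul hF (measurable_const.indicator hsm) hd ?_
  rw [← e]
  exact hFi.indicator hsm

lemma memLp_condAvg (K : Finset ι) {F : (∀ i, E i) → ℝ} {p : ℝ≥0∞} (hp : 1 ≤ p)
    (hF : Measurable F) (hFp : MemLp F p (Measure.pi μ)) :
    MemLp (condAvg μ K F) p (Measure.pi μ) :=
  (memLp_congr_ae (condAvg_ae_eq_condExp K hF (hFp.integrable hp))).2 (hFp.condExp hp)

lemma condAvg_condAvg (K L : Finset ι) {F : (∀ i, E i) → ℝ} (hF : Measurable F)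
    (hFi : Integrable F (Measure.pi μ)) :
    condAvg μ K (condAvg μ L F) =ᵐ[Measure.pi μ] condAvg μ (K ∩ L) F := by
  have hi := integrable_piecewise_prod (K ∩ L) hFi
  filter_upwards [hi.prod_right_ae] with x hx
  have e : ∀ p : (∀ i, E i) × (∀ i, E i), L.piecewise (K.piecewise x p.1) p.2
      = (K ∩ L).piecewise x (L.piecewise p.1 p.2) := fun p ↦ by
    ext i
    by_cases h1 : i ∈ K <;> by_cases h2 : i ∈ L <;> simp [h1, h2]
  have hx' := (measurePreserving_piecewise μ L).integrable_comp_of_integrable hx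
  have hm : Measurable fun y ↦ F ((K ∩ L).piecewise x y) :=
    hF.comp ((measurable_piecewise_prod (K ∩ L)).comp measurable_prodMk_left)
  calc condAvg μ K (condAvg μ L F) x
      = ∫ y, ∫ z, F ((K ∩ L).piecewise x (L.piecewise y z)) ∂(Measure.pi μ) ∂(Measure.pi μ) := by
        simp only [condAvg]
        congr 1; ext y; congr 1; ext z; rw [← e (y, z)]
    _ = ∫ p : (∀ i, E i) × (∀ i, E i), F ((K ∩ L).piecewise x (L.piecewise p.1 p.2))
          ∂((Measure.pi μ).prod (Measure.pi μ)) := (integral_prod _ hx').symm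
    _ = condAvg μ (K ∩ L) F x := integral_piecewise_prod L hm

/-- Functions of disjoint sets of coordinates are uncorrelated. -/
lemma integral_mul_of_dependsOn_disjoint {S T : Finset ι} (hST : Disjoint S T)
    {F G : (∀ i, E i) → ℝ} (hF : Measurable F) (hG : Measurable G)
    (hFd : DependsOn F (S : Set ι)) (hGd : DependsOn G (T : Set ι)) :
    ∫ x, F x * G x ∂(Measure.pi μ) = (∫ x, F x ∂(Measure.pi μ)) * ∫ x, G x ∂(Measure.pi μ) := by
  rw [← integral_piecewise_prod S (F := fun x ↦ F x * G x) (hF.mul hG), ← integral_prod_mul]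
  congr 1; ext p
  congr 1
  · exact hFd fun i hi ↦ by simp [Finset.mem_coe.1 hi]
  · exact hGd fun i hi ↦ by simp [Finset.disjoint_right.1 hST hi]

end Averaging

/-! ### The fourth moment of the top-level part -/

section SquareIntegrable

variable {α : Type*} [MeasurableSpace α] {ν : Measure α}

lemma integrable_mul_of_memLp_two {f g : α → ℝ} (hf : MemLp f 2 ν) (hg : MemLp g 2 ν) :
    Integrable (fun x ↦ f x * g x) ν :=
  hf.integrable_mul hg

lemma memLp_mul_of_memLp_four {f g : α → ℝ} (hf : MemLp f 4 ν) (hg : MemLp g 4 ν) :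
    MemLp (fun x ↦ f x * g x) 2 ν := by
  have : ENNReal.HolderTriple 4 4 2 := ⟨by
    rw [← two_mul, show (4 : ℝ≥0∞) = 2 * 2 by norm_num,
      ENNReal.mul_inv (Or.inl (by simp)) (Or.inl (by simp)), ← mul_assoc,
      ENNReal.mul_inv_cancel (by simp) (by simp), one_mul]⟩
  exact hg.mul hf

/-- The Cauchy–Schwarz inequality. -/
lemma sq_integral_mul_le {f g : α → ℝ} (hf : MemLp f 2 ν) (hg : MemLp g 2 ν) :
    (∫ x, f x * g x ∂ν) ^ 2 ≤ (∫ x, f x ^ 2 ∂ν) * ∫ x, g x ^ 2 ∂ν := by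
  have h : ∀ t : ℝ, 0 ≤ (∫ x, g x ^ 2 ∂ν) * (t * t) + (-2 * ∫ x, f x * g x ∂ν) * t
      + ∫ x, f x ^ 2 ∂ν := fun t ↦ by
    have e : (∫ x, g x ^ 2 ∂ν) * (t * t) + (-2 * ∫ x, f x * g x ∂ν) * t + ∫ x, f x ^ 2 ∂ν
        = ∫ x, (f x - t * g x) ^ 2 ∂ν := by
      have i1 := hf.integrable_sq
      have i2 := hg.integrable_sq.const_mul (t * t)
      have i3 := (integrable_mul_of_memLp_two hf hg).const_mul (-2 * t)
      calc _ = ∫ x, (t * t * g x ^ 2) ∂ν + ∫ x, (-2 * t * (f x * g x)) ∂ν + ∫ x, f x ^ 2 ∂ν := by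
            rw [integral_const_mul, integral_const_mul]; ring
        _ = ∫ x, (t * t * g x ^ 2 + -2 * t * (f x * g x) + f x ^ 2) ∂ν := by
            rw [← integral_add i2 i3]
            exact (integral_add (i2.add i3) i1).symm
        _ = _ := by congr 1; ext x; ring
    rw [e]
    exact integral_nonneg fun x ↦ sq_nonneg _
  have := discrim_le_zero h
  rw [discrim] at this
  nlinarith

lemma memLp_two_finset_sum {κ : Type*} (s : Finset κ) {f : κ → α → ℝ}
    (hf : ∀ a ∈ s, MemLp (f a) 2 ν) : MemLp (fun x ↦ ∑ a ∈ s, f a x) 2 ν :=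
  memLp_finsetSum s hf

lemma integral_sum_mul_sum {κ κ' : Type*} (s : Finset κ) (t : Finset κ') {f : κ → α → ℝ}
    {g : κ' → α → ℝ} (hf : ∀ a ∈ s, MemLp (f a) 2 ν) (hg : ∀ a ∈ t, MemLp (g a) 2 ν) :
    ∫ x, (∑ a ∈ s, f a x) * (∑ b ∈ t, g b x) ∂ν = ∑ a ∈ s, ∑ b ∈ t, ∫ x, f a x * g b x ∂ν := by
  simp_rw [Finset.sum_mul_sum]
  have hi : ∀ a ∈ s, ∀ b ∈ t, Integrable (fun x ↦ f a x * g b x) ν := fun a ha b hb ↦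
    integrable_mul_of_memLp_two (hf a ha) (hg b hb)
  rw [integral_finsetSum _ fun a ha ↦ integrable_finsetSum _ fun b hb ↦ hi a ha b hb]
  exact Finset.sum_congr rfl fun a ha ↦ integral_finsetSum _ fun b hb ↦ hi a ha b hb

lemma integral_sq_sum {κ : Type*} (s : Finset κ) {f : κ → α → ℝ}
    (hf : ∀ a ∈ s, MemLp (f a) 2 ν) :
    ∫ x, (∑ a ∈ s, f a x) ^ 2 ∂ν = ∑ a ∈ s, ∑ b ∈ s, ∫ x, f a x * f b x ∂ν := by
  simp_rw [pow_two]
  exact integral_sum_mul_sum s s hf hf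

end SquareIntegrable

section FourthMoment

set_option linter.unusedSectionVars false

variable {ι : Type*} [Fintype ι] [DecidableEq ι] {E : ι → Type*} [∀ i, MeasurableSpace (E i)]
  {μ : ∀ i, Measure (E i)} [∀ i, IsProbabilityMeasure (μ i)]

lemma integrable_mul_of_dependsOn_disjoint {S T : Finset ι} (hST : Disjoint S T)
    {F G : (∀ i, E i) → ℝ} (hF : Measurable F) (hG : Measurable G)
    (hFd : DependsOn F (S : Set ι)) (hGd : DependsOn G (T : Set ι))
    (hFi : Integrable F (Measure.pi μ)) (hGi : Integrable G (Measure.pi μ)) :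
    Integrable (fun x ↦ F x * G x) (Measure.pi μ) := by
  rw [← (measurePreserving_piecewise μ S).integrable_comp (g := fun x ↦ F x * G x)
    (hF.mul hG).aestronglyMeasurable]
  refine (hFi.mul_prod hGi).congr (Eventually.of_forall fun p ↦ ?_)
  simp only [Function.comp]
  congr 1
  · exact hFd fun i hi ↦ by simp [Finset.mem_coe.1 hi]
  · exact hGd fun i hi ↦ by simp [Finset.disjoint_right.1 hST hi]

lemma _root_.DependsOn.mul {S T : Set ι} {F G : (∀ i, E i) → ℝ} (hF : DependsOn F S)
    (hG : DependsOn G T) : DependsOn (fun x ↦ F x * G x) (S ∪ T) := fun x y h ↦ by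
  simp only
  rw [hF fun i hi ↦ h i (Or.inl hi), hG fun i hi ↦ h i (Or.inr hi)]

variable (μ) in
/-- A family of functions `w J` on the product space, each of which depends only on the
coordinates in `J`, is in `L⁴`, and vanishes when any coordinate in `J` is averaged out:
canonical representatives of the Hoeffding components of a `U`-statistic. -/
structure IsCanonicalFamily (w : Finset ι → (∀ i, E i) → ℝ) : Prop where
  measurable : ∀ J, Measurable (w J)
  dependsOn : ∀ J, DependsOn (w J) (J : Set ι)
  memLp : ∀ J, MemLp (w J) 4 (Measure.pi μ)
  condAvg_eq_zero : ∀ J, ∀ i ∈ J, condAvg μ (Finset.univ.erase i) (w J) =ᵐ[Measure.pi μ] 0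

namespace IsCanonicalFamily

variable {w : Finset ι → (∀ i, E i) → ℝ} (hw : IsCanonicalFamily μ w)
include hw

lemma memLp_two (J : Finset ι) : MemLp (w J) 2 (Measure.pi μ) :=
  (hw.memLp J).mono_exponent (by norm_num)

lemma memLp_mul (J K : Finset ι) : MemLp (fun x ↦ w J x * w K x) 2 (Measure.pi μ) :=
  memLp_mul_of_memLp_four (hw.memLp J) (hw.memLp K)

lemma measurable_mul (J K : Finset ι) : Measurable fun x ↦ w J x * w K x :=
  (hw.measurable J).mul (hw.measurable K)

lemma dependsOn_mul (J K : Finset ι) :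
    DependsOn (fun x ↦ w J x * w K x) ((J ∪ K : Finset ι) : Set ι) := by
  rw [Finset.coe_union]
  exact (hw.dependsOn J).mul (hw.dependsOn K)

lemma integral_mul_eq_zero {J : Finset ι} {i : ι} (hi : i ∈ J) {G : (∀ i, E i) → ℝ}
    (hG : Measurable G) (hGd : DependsOn G ((Finset.univ.erase i : Finset ι) : Set ι))
    (hint : Integrable (fun x ↦ w J x * G x) (Measure.pi μ)) :
    ∫ x, w J x * G x ∂(Measure.pi μ) = 0 := by
  rw [← integral_condAvg_mul (hw.measurable J) hG hGd hint]
  rw [← integral_zero (∀ i, E i) ℝ (μ := Measure.pi μ)]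
  refine integral_congr_ae ?_
  filter_upwards [hw.condAvg_eq_zero J i hi] with x hx
  simp [hx]

/-- `E[w_J w_K w_{J'} w_{K'}] = 0` if some index lies in exactly one of the four sets. -/
lemma integral_mul_mul_eq_zero {J K J' K' : Finset ι} {i : ι} (hi : i ∈ J) (h2 : i ∉ K)
    (h3 : i ∉ J') (h4 : i ∉ K') :
    ∫ x, (w J x * w K x) * (w J' x * w K' x) ∂(Measure.pi μ) = 0 := by
  simp_rw [mul_assoc (w J _)]
  have hd : DependsOn (fun x ↦ w K x * (w J' x * w K' x))
      ((Finset.univ.erase i : Finset ι) : Set ι) := by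
    refine ((hw.dependsOn K).mul (hw.dependsOn_mul J' K')).mono fun j hj ↦ ?_
    have : j ≠ i := by
      rintro rfl
      simp [h2, h3, h4] at hj
    simpa using this
  refine hw.integral_mul_eq_zero hi ((hw.measurable K).mul (hw.measurable_mul J' K')) hd ?_
  refine (integrable_mul_of_memLp_two (hw.memLp_mul J K) (hw.memLp_mul J' K')).congr
    (Eventually.of_forall fun x ↦ ?_)
  simp only; ring

lemma integral_mul_mul_eq_zero_of_union_ne {J K J' K' : Finset ι} (h1 : Disjoint J K)
    (h2 : Disjoint J' K') (h : J ∪ K ≠ J' ∪ K') :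
    ∫ x, (w J x * w K x) * (w J' x * w K' x) ∂(Measure.pi μ) = 0 := by
  have : ∃ i, ¬ (i ∈ J ∪ K ↔ i ∈ J' ∪ K') := by
    by_contra! hc
    exact h (Finset.ext hc)
  obtain ⟨i, hi⟩ := this
  simp only [Finset.mem_union] at hi
  rw [Finset.disjoint_left] at h1 h2
  have h1 := @h1 i
  have h2 := @h2 i
  by_cases a : i ∈ J
  · exact hw.integral_mul_mul_eq_zero a (h1 a) (by tauto) (by tauto)
  by_cases b : i ∈ K
  · rw [← hw.integral_mul_mul_eq_zero b a (J' := J') (K' := K') (by tauto) (by tauto)]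
    congr 1; ext x; ring
  by_cases c : i ∈ J'
  · rw [← hw.integral_mul_mul_eq_zero c (h2 c) (J' := J) (K' := K) a b]
    congr 1; ext x; ring
  · rw [← hw.integral_mul_mul_eq_zero (by tauto : i ∈ K') c (J' := J) (K' := K) a b]
    congr 1; ext x; ring

end IsCanonicalFamily

variable (μ) in
/-- The conditional expectation of `w_J w_K` given the coordinates in the symmetric difference of
`J` and `K`. -/
noncomputable def contraction (w : Finset ι → (∀ i, E i) → ℝ) (J K : Finset ι) :
    (∀ i, E i) → ℝ :=
  condAvg μ (symmDiff J K) fun x ↦ w J x * w K x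

namespace IsCanonicalFamily

variable {w : Finset ι → (∀ i, E i) → ℝ} (hw : IsCanonicalFamily μ w)
include hw

lemma memLp_contraction (J K : Finset ι) : MemLp (contraction μ w J K) 2 (Measure.pi μ) :=
  memLp_condAvg _ (by norm_num) (hw.measurable_mul J K) (hw.memLp_mul J K)

lemma integral_sq_mul_sq {J K : Finset ι} (h : Disjoint J K) :
    ∫ x, (w J x * w K x) ^ 2 ∂(Measure.pi μ)
      = (∫ x, w J x ^ 2 ∂(Measure.pi μ)) * ∫ x, w K x ^ 2 ∂(Measure.pi μ) := by
  simp_rw [mul_pow]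
  refine integral_mul_of_dependsOn_disjoint h ((hw.measurable J).pow_const 2)
    ((hw.measurable K).pow_const 2) (fun x y hxy ↦ ?_) fun x y hxy ↦ ?_
  · simp only [hw.dependsOn J hxy]
  · simp only [hw.dependsOn K hxy]

/-- By Cauchy–Schwarz in the averaged coordinates, and as the two resulting conditional second
moments depend on the disjoint sets `J \ K` and `K \ J`, the contraction of `w_J` and `w_K` has
second moment at most `σ_J² σ_K²`. -/
lemma integral_contraction_sq_le (J K : Finset ι) :
    ∫ x, contraction μ w J K x ^ 2 ∂(Measure.pi μ)
      ≤ (∫ x, w J x ^ 2 ∂(Measure.pi μ)) * ∫ x, w K x ^ 2 ∂(Measure.pi μ) := by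
  have dJ : ∀ J, DependsOn (fun x ↦ w J x ^ 2) (J : Set ι) := fun J x y hxy ↦ by
    simp only [hw.dependsOn J hxy]
  have mJ : ∀ J, Measurable fun x ↦ w J x ^ 2 := fun J ↦ (hw.measurable J).pow_const 2
  have iJ : ∀ J, Integrable (fun x ↦ w J x ^ 2) (Measure.pi μ) := fun J ↦
    (hw.memLp_two J).integrable_sq
  have hae : ∀ᵐ x ∂(Measure.pi μ), contraction μ w J K x ^ 2
      ≤ condAvg μ (J \ K) (fun x ↦ w J x ^ 2) x * condAvg μ (K \ J) (fun x ↦ w K x ^ 2) x := by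
    have hm : ∀ L, ∀ᵐ x ∂(Measure.pi μ),
        MemLp (fun y ↦ w L ((symmDiff J K).piecewise x y)) 2 (Measure.pi μ) := fun L ↦ by
      filter_upwards [(integrable_piecewise_prod (symmDiff J K) (iJ L)).prod_right_ae] with x hx
      refine (memLp_two_iff_integrable_sq ?_).2 hx
      exact ((hw.measurable L).comp ((measurable_piecewise_prod (symmDiff J K)).comp
        measurable_prodMk_left)).aestronglyMeasurable
    filter_upwards [hm J, hm K] with x h1 h2
    rw [condAvg_eq_of_dependsOn (dJ J) (K := J \ K) (T := symmDiff J K)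
        fun i hi ↦ by simp [Finset.mem_symmDiff, hi],
      condAvg_eq_of_dependsOn (dJ K) (K := K \ J) (T := symmDiff J K)
        fun i hi ↦ by simp [Finset.mem_symmDiff, hi]]
    exact sq_integral_mul_le h1 h2
  have hdis : Disjoint (J \ K) (K \ J) := disjoint_sdiff_sdiff
  have mA : ∀ J K, Measurable (condAvg μ (J \ K) fun x ↦ w J x ^ 2) := fun J K ↦
    measurable_condAvg _ (mJ J)
  have iA : ∀ J K, Integrable (condAvg μ (J \ K) fun x ↦ w J x ^ 2) (Measure.pi μ) := fun J K ↦
    integrable_condAvg _ (iJ J)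
  calc _ ≤ ∫ x, condAvg μ (J \ K) (fun x ↦ w J x ^ 2) x * condAvg μ (K \ J) (fun x ↦ w K x ^ 2) x
        ∂(Measure.pi μ) :=
        integral_mono_ae (hw.memLp_contraction J K).integrable_sq
          (integrable_mul_of_dependsOn_disjoint hdis (mA J K) (mA K J) (dependsOn_condAvg _ _)
            (dependsOn_condAvg _ _) (iA J K) (iA K J)) hae
    _ = _ := by
        rw [integral_mul_of_dependsOn_disjoint hdis (mA J K) (mA K J) (dependsOn_condAvg _ _)
            (dependsOn_condAvg _ _), integral_condAvg _ (mJ J) (iJ J),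
          integral_condAvg _ (mJ K) (iJ K)]

/-- Conditional independence given the coordinates in the common symmetric difference. -/
lemma integral_mul_eq_integral_contraction {J J' K K' : Finset ι}
    (hs : symmDiff J J' = symmDiff K K') (hd : Disjoint (J ∩ J') (K ∩ K')) :
    ∫ x, (w J x * w J' x) * (w K x * w K' x) ∂(Measure.pi μ)
      = ∫ x, contraction μ w J J' x * contraction μ w K K' x ∂(Measure.pi μ) := by
  have hmem : ∀ i, i ∈ symmDiff J J' ↔ i ∈ symmDiff K K' := fun i ↦ by rw [hs]
  simp only [Finset.mem_symmDiff] at hmem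
  have hd' : ∀ i, ¬ (i ∈ J ∩ J' ∧ i ∈ K ∩ K') := fun i hi ↦ Finset.disjoint_left.1 hd hi.1 hi.2
  simp only [Finset.mem_inter] at hd'
  have e1 : condAvg μ (K ∪ K') (fun x ↦ w J x * w J' x) = contraction μ w J J' :=
    condAvg_eq_of_dependsOn (hw.dependsOn_mul J J') fun i hi ↦ by
      have h1 := hmem i
      have h2 := hd' i
      simp only [Finset.mem_union, Finset.mem_symmDiff] at hi ⊢
      tauto
  have hint := integrable_mul_of_memLp_two (hw.memLp_mul J J') (hw.memLp_mul K K')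
  have hint2 := integrable_mul_of_memLp_two (hw.memLp_mul K K') (hw.memLp_contraction J J')
  rw [← integral_condAvg_mul (hw.measurable_mul J J') (hw.measurable_mul K K')
    (hw.dependsOn_mul K K') hint, e1]
  have e2 := integral_condAvg_mul (K := symmDiff K K') (hw.measurable_mul K K')
    (measurable_condAvg (symmDiff J J') (hw.measurable_mul J J'))
    (by rw [← hs]; exact dependsOn_condAvg _ _) hint2
  calc _ = ∫ x, (w K x * w K' x) * contraction μ w J J' x ∂(Measure.pi μ) := by
        congr 1; ext x; ring
    _ = _ := e2.symm
    _ = _ := by congr 1; ext x; rw [mul_comm]; rfl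

/-- The bound pairs `J` with `K` and `J'` with `K'`: if `J ∩ J'` and `K ∩ K'` meet, both of these
pairs intersect, so that the bound is part of the sum over intersecting pairs. -/
lemma abs_integral_contraction_mul_le (J J' K K' : Finset ι) :
    |∫ x, contraction μ w J J' x * contraction μ w K' K x ∂(Measure.pi μ)|
      ≤ ((∫ x, w J x ^ 2 ∂(Measure.pi μ)) * (∫ x, w K x ^ 2 ∂(Measure.pi μ))
        + (∫ x, w J' x ^ 2 ∂(Measure.pi μ)) * (∫ x, w K' x ^ 2 ∂(Measure.pi μ))) / 2 := by
  have h1 := sq_integral_mul_le (hw.memLp_contraction J J') (hw.memLp_contraction K' K)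
  have h2 := hw.integral_contraction_sq_le J J'
  have h3 := hw.integral_contraction_sq_le K' K
  have nn : ∀ J, 0 ≤ ∫ x, w J x ^ 2 ∂(Measure.pi μ) := fun J ↦ integral_nonneg fun x ↦ sq_nonneg _
  set a := ∫ x, w J x ^ 2 ∂(Measure.pi μ)
  set b := ∫ x, w J' x ^ 2 ∂(Measure.pi μ)
  set c := ∫ x, w K' x ^ 2 ∂(Measure.pi μ)
  set e := ∫ x, w K x ^ 2 ∂(Measure.pi μ)
  have ha : 0 ≤ a := nn J
  have hb : 0 ≤ b := nn J'
  have hc : 0 ≤ c := nn K'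
  have he : 0 ≤ e := nn K
  refine abs_le_of_sq_le_sq ?_ (by positivity)
  have h4 := mul_le_mul h2 h3 (integral_nonneg fun x ↦ sq_nonneg _) (by positivity)
  nlinarith [sq_nonneg (a * e - b * c)]

end IsCanonicalFamily

/-- The number of pairs `(J', K')` forming, together with a given pair `(J, K)`, a configuration
in which `K \ K' = J' \ J` and `K' \ K = J \ J'`: such a pair is determined by `J ∩ J'` and
`K ∩ K'`. -/
lemma card_exchange_le {d : ℕ} {J K : Finset ι} (hJ : J.card = d) (hK : K.card = d)
    (P : Finset (Finset ι × Finset ι))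
    (hP : ∀ q ∈ P, J \ q.1 = q.2 \ K ∧ q.1 \ J = K \ q.2) : P.card ≤ 4 ^ d := by
  have h4 : (J.powerset ×ˢ K.powerset).card = 4 ^ d := by
    rw [Finset.card_product, Finset.card_powerset, Finset.card_powerset, hJ, hK, ← mul_pow]
    norm_num
  rw [← h4]
  refine Finset.card_le_card_of_injOn (fun q ↦ (J ∩ q.1, K ∩ q.2)) (fun q _ ↦ by simp) ?_
  intro q hq q' hq' h
  have e : ∀ q ∈ P, q = ((J ∩ q.1) ∪ (K \ (K ∩ q.2)), (K ∩ q.2) ∪ (J \ (J ∩ q.1))) := by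
    intro q hq
    obtain ⟨a1, a2⟩ := hP q hq
    rw [Finset.sdiff_inter_self_left, Finset.sdiff_inter_self_left, ← a2, a1, Finset.inter_comm J,
      Finset.inter_comm K, Finset.union_comm, Finset.sdiff_union_inter, Finset.union_comm,
      Finset.sdiff_union_inter]
  simp only [Prod.mk.injEq] at h
  rw [e q hq, e q' hq', h.1, h.2]

/-- Two ways of splitting a set into two disjoint parts, in terms of differences. -/
lemma disjoint_union_eq_iff (J K J' K' : Finset ι) :
    (Disjoint J K ∧ Disjoint J' K' ∧ J ∪ K = J' ∪ K') ↔
      ((J \ J' = K' \ K ∧ J' \ J = K \ K') ∧ Disjoint (J ∩ J') (K' ∩ K)) := by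
  simp only [Finset.disjoint_left, Finset.ext_iff, Finset.mem_union, Finset.mem_sdiff,
    Finset.mem_inter]
  constructor
  · rintro ⟨h1, h2, h3⟩
    refine ⟨⟨fun i ↦ ?_, fun i ↦ ?_⟩, fun i ↦ ?_⟩ <;>
    · have := @h1 i; have := @h2 i; have := h3 i
      tauto
  · rintro ⟨⟨h1, h2⟩, h3⟩
    refine ⟨fun i ↦ ?_, fun i ↦ ?_, fun i ↦ ?_⟩ <;>
    · have := h1 i; have := h2 i; have := @h3 i
      tauto

variable (μ) in
/-- The second moment `σ_J²` of a component. -/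
noncomputable def sqNorm (w : Finset ι → (∀ i, E i) → ℝ) (J : Finset ι) : ℝ :=
  ∫ x, w J x ^ 2 ∂(Measure.pi μ)

lemma sqNorm_nonneg (w : Finset ι → (∀ i, E i) → ℝ) (J : Finset ι) : 0 ≤ sqNorm μ w J :=
  integral_nonneg fun _ ↦ sq_nonneg _

/-- The sum of `w_J w_K` over disjoint `J, K`: the part of `(∑ w_J)²` of the highest order. -/
noncomputable def topPart (D : Finset (Finset ι)) (w : Finset ι → (∀ i, E i) → ℝ)
    (x : ∀ i, E i) : ℝ :=
  ∑ p ∈ D ×ˢ D with Disjoint p.1 p.2, w p.1 x * w p.2 x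

variable (μ) in
/-- The sum of `σ_J² σ_K²` over intersecting `J, K`. -/
noncomputable def meetSum (D : Finset (Finset ι)) (w : Finset ι → (∀ i, E i) → ℝ) : ℝ :=
  ∑ p ∈ D ×ˢ D with ¬ Disjoint p.1 p.2, sqNorm μ w p.1 * sqNorm μ w p.2

lemma meetSum_le {D : Finset (Finset ι)} {d : ℕ} (hD : ∀ J ∈ D, J.card = d)
    {w : Finset ι → (∀ i, E i) → ℝ} {ρ : ℝ} (h1 : ∑ J ∈ D, sqNorm μ w J = 1)
    (hρ : ∀ i, ∑ K ∈ D with i ∈ K, sqNorm μ w K ≤ ρ) : meetSum μ D w ≤ d * ρ := by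
  rw [meetSum, Finset.sum_filter, Finset.sum_product]
  have key : ∀ J ∈ D, (∑ K ∈ D, if ¬ Disjoint J K then sqNorm μ w J * sqNorm μ w K else 0)
      ≤ sqNorm μ w J * (d * ρ) := fun J hJ ↦ by
    calc (∑ K ∈ D, if ¬ Disjoint J K then sqNorm μ w J * sqNorm μ w K else 0)
        ≤ ∑ K ∈ D, ∑ i ∈ J, if i ∈ K then sqNorm μ w J * sqNorm μ w K else 0 := by
          refine Finset.sum_le_sum fun K _ ↦ ?_
          have nn := mul_nonneg (sqNorm_nonneg (μ := μ) w J) (sqNorm_nonneg (μ := μ) w K)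
          have nn' : ∀ i ∈ J, 0 ≤ if i ∈ K then sqNorm μ w J * sqNorm μ w K else 0 :=
            fun i _ ↦ by split_ifs <;> simp [nn]
          by_cases h : ¬ Disjoint J K
          · rw [if_pos h]
            obtain ⟨i, hi, hi'⟩ := Finset.not_disjoint_iff.1 h
            have := Finset.single_le_sum nn' hi
            rwa [if_pos hi'] at this
          · rw [if_neg h]
            exact Finset.sum_nonneg nn'
      _ = ∑ i ∈ J, sqNorm μ w J * ∑ K ∈ D with i ∈ K, sqNorm μ w K := by
          rw [Finset.sum_comm]
          refine Finset.sum_congr rfl fun i _ ↦ ?_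
          rw [Finset.mul_sum, Finset.sum_filter]
      _ ≤ ∑ i ∈ J, sqNorm μ w J * ρ :=
          Finset.sum_le_sum fun i _ ↦ mul_le_mul_of_nonneg_left (hρ i) (sqNorm_nonneg w J)
      _ = sqNorm μ w J * (d * ρ) := by
          rw [Finset.sum_const, hD J hJ]; simp; ring
  refine (Finset.sum_le_sum key).trans ?_
  rw [← Finset.sum_mul, h1, one_mul]

end FourthMoment

section TopPart

set_option linter.unusedSectionVars false

lemma sum_sum_reorder {κ : Type*} (D : Finset κ) (F : κ → κ → κ → κ → ℝ) :
    ∑ p ∈ D ×ˢ D, ∑ q ∈ D ×ˢ D, F p.1 p.2 q.1 q.2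
      = ∑ p ∈ D ×ˢ D, ∑ q ∈ D ×ˢ D, F p.1 q.1 q.2 p.2 := by
  simp_rw [Finset.sum_product]
  refine Finset.sum_congr rfl fun a _ ↦ ?_
  rw [Finset.sum_comm (s := D) (t := D) (f := fun d b ↦ ∑ c ∈ D, F a b c d)]
  refine Finset.sum_congr rfl fun b _ ↦ ?_
  rw [Finset.sum_comm]

lemma sum_sum_swap {κ : Type*} (D : Finset κ) (F : κ → κ → κ → κ → ℝ) :
    ∑ p ∈ D ×ˢ D, ∑ q ∈ D ×ˢ D, F p.1 p.2 q.1 q.2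
      = ∑ p ∈ D ×ˢ D, ∑ q ∈ D ×ˢ D, F p.2 p.1 q.2 q.1 := by
  simp_rw [Finset.sum_product]
  rw [Finset.sum_comm]
  refine Finset.sum_congr rfl fun a _ ↦ Finset.sum_congr rfl fun b _ ↦ ?_
  rw [Finset.sum_comm]

variable {ι : Type*} [Fintype ι] [DecidableEq ι] {E : ι → Type*} [∀ i, MeasurableSpace (E i)]
  {μ : ∀ i, Measure (E i)} [∀ i, IsProbabilityMeasure (μ i)]

/-- The pair of differences `(J \ J', J' \ J)`. -/
def diffs (p : Finset ι × Finset ι) : Finset ι × Finset ι := (p.1 \ p.2, p.2 \ p.1)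

variable {w : Finset ι → (∀ i, E i) → ℝ} {D : Finset (Finset ι)} {d : ℕ}

lemma memLp_topPart (hw : IsCanonicalFamily μ w) :
    MemLp (topPart D w) 2 (Measure.pi μ) :=
  memLp_two_finset_sum _ fun p _ ↦ hw.memLp_mul p.1 p.2

/-- Expansion of `E[T²]` along configurations: a product of four components with
`J ⊔ K = J' ⊔ K'` is regrouped as `(w_J w_{J'}) (w_{K'} w_K)`. -/
lemma integral_topPart_sq_eq (hw : IsCanonicalFamily μ w) :
    ∫ x, topPart D w x ^ 2 ∂(Measure.pi μ) = ∑ p ∈ D ×ˢ D, ∑ q ∈ D ×ˢ D,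
      if diffs p = diffs q ∧ Disjoint (p.1 ∩ p.2) (q.1 ∩ q.2) then
        ∫ x, contraction μ w p.1 p.2 x * contraction μ w q.1 q.2 x ∂(Measure.pi μ) else 0 := by
  simp only [topPart]
  rw [integral_sq_sum _ fun p _ ↦ hw.memLp_mul p.1 p.2, Finset.sum_filter,
    sum_sum_reorder D (fun a b c e ↦ if diffs (a, b) = diffs (c, e) ∧ Disjoint (a ∩ b) (c ∩ e) then
        ∫ x, contraction μ w a b x * contraction μ w c e x ∂(Measure.pi μ) else 0)]
  refine Finset.sum_congr rfl fun p _ ↦ ?_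
  rw [Finset.sum_filter]
  have e : (if Disjoint p.1 p.2 then ∑ q ∈ D ×ˢ D, (if Disjoint q.1 q.2 then
        ∫ x, (w p.1 x * w p.2 x) * (w q.1 x * w q.2 x) ∂(Measure.pi μ) else 0) else 0)
      = ∑ q ∈ D ×ˢ D, (if Disjoint p.1 p.2 ∧ Disjoint q.1 q.2 then
        ∫ x, (w p.1 x * w p.2 x) * (w q.1 x * w q.2 x) ∂(Measure.pi μ) else 0) := by
    by_cases h : Disjoint p.1 p.2 <;> simp [h]
  rw [e]
  refine Finset.sum_congr rfl fun q _ ↦ ?_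
  have hiff := disjoint_union_eq_iff p.1 p.2 q.1 q.2
  by_cases h1 : Disjoint p.1 p.2 ∧ Disjoint q.1 q.2
  · rw [if_pos h1]
    by_cases h2 : p.1 ∪ p.2 = q.1 ∪ q.2
    · have h3 := hiff.1 ⟨h1.1, h1.2, h2⟩
      rw [if_pos ⟨by simp [diffs, h3.1.1, h3.1.2], h3.2⟩,
        ← hw.integral_mul_eq_integral_contraction
          (by rw [symmDiff_def, symmDiff_def, h3.1.1, h3.1.2]) h3.2]
      congr 1; ext x; ring
    · rw [hw.integral_mul_mul_eq_zero_of_union_ne h1.1 h1.2 h2, if_neg]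
      rintro ⟨h3, h4⟩
      simp only [diffs, Prod.mk.injEq] at h3
      exact h2 (hiff.2 ⟨h3, h4⟩).2.2
  · rw [if_neg h1, if_neg]
    rintro ⟨h3, h4⟩
    simp only [diffs, Prod.mk.injEq] at h3
    exact h1 ⟨(hiff.2 ⟨h3, h4⟩).1, (hiff.2 ⟨h3, h4⟩).2.1⟩

lemma sum_diffs_eq (hw : IsCanonicalFamily μ w) :
    ∑ p ∈ D ×ˢ D, ∑ q ∈ D ×ˢ D, (if diffs p = diffs q then
        ∫ x, contraction μ w p.1 p.2 x * contraction μ w q.1 q.2 x ∂(Measure.pi μ) else 0)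
      = ∑ v, ∫ x, (∑ p ∈ D ×ˢ D with diffs p = v, contraction μ w p.1 p.2 x) ^ 2
          ∂(Measure.pi μ) := by
  have e : ∀ v, ∫ x, (∑ p ∈ D ×ˢ D with diffs p = v, contraction μ w p.1 p.2 x) ^ 2
          ∂(Measure.pi μ) = ∑ p ∈ D ×ˢ D, if diffs p = v then ∑ q ∈ D ×ˢ D, (if diffs q = v then
        ∫ x, contraction μ w p.1 p.2 x * contraction μ w q.1 q.2 x ∂(Measure.pi μ) else 0)
        else 0 := fun v ↦ by
    rw [integral_sq_sum _ fun p _ ↦ hw.memLp_contraction p.1 p.2, Finset.sum_filter]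
    simp_rw [Finset.sum_filter]
  simp_rw [e]
  conv_rhs => rw [Finset.sum_comm]
  refine Finset.sum_congr rfl fun p _ ↦ ?_
  rw [Finset.sum_ite_eq, if_pos (Finset.mem_univ _)]
  simp_rw [eq_comm (a := diffs p)]

/-- The sum over all configurations, including those whose parts `J ∩ J'` and `K ∩ K'` meet, is a
sum of squares over the possible differences. The differences `(∅, ∅)` contribute `1`, and
`(J, K)` with `J`, `K` disjoint contributes `σ_J² σ_K²`. -/
lemma le_sum_diffs (hw : IsCanonicalFamily μ w) (hd : 1 ≤ d) (hD : ∀ J ∈ D, J.card = d)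
    (h1 : ∑ J ∈ D, sqNorm μ w J = 1) :
    2 - meetSum μ D w ≤ ∑ p ∈ D ×ˢ D, ∑ q ∈ D ×ˢ D, (if diffs p = diffs q then
        ∫ x, contraction μ w p.1 p.2 x * contraction μ w q.1 q.2 x ∂(Measure.pi μ) else 0) := by
  rw [sum_diffs_eq hw]
  set V : Finset (Finset ι × Finset ι) := (D ×ˢ D).filter fun p ↦ Disjoint p.1 p.2 with hV
  have hnot : ((∅, ∅) : Finset ι × Finset ι) ∉ V := by
    intro h
    have := hD ∅ (Finset.mem_product.1 (Finset.mem_filter.1 h).1).1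
    simp at this
    omega
  -- keep only the squares indexed by `(∅, ∅)` and by disjoint pairs of sets of the family
  have hle := Finset.sum_le_sum_of_subset_of_nonneg
    (f := fun v ↦ ∫ x, (∑ p ∈ D ×ˢ D with diffs p = v, contraction μ w p.1 p.2 x) ^ 2
          ∂(Measure.pi μ)) (Finset.subset_univ (insert (∅, ∅) V))
    fun v _ _ ↦ integral_nonneg fun x ↦ sq_nonneg _
  refine le_trans ?_ hle
  rw [Finset.sum_insert hnot]
  have e1 : ∫ x, (∑ p ∈ D ×ˢ D with diffs p = (∅, ∅), contraction μ w p.1 p.2 x) ^ 2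
          ∂(Measure.pi μ) = 1 := by
    have : ∀ x, ∑ p ∈ D ×ˢ D with diffs p = (∅, ∅), contraction μ w p.1 p.2 x = 1 := fun x ↦ by
      rw [← h1, Finset.sum_filter, Finset.sum_product]
      refine Finset.sum_congr rfl fun J hJ ↦ ?_
      have : ∀ K, diffs (J, K) = (∅, ∅) ↔ J = K := fun K ↦ by
        simp only [diffs, Prod.mk.injEq, Finset.sdiff_eq_empty_iff_subset]
        exact ⟨fun h ↦ h.1.antisymm h.2, by rintro rfl; simp⟩
      simp_rw [this]
      rw [Finset.sum_ite_eq, if_pos hJ]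
      have h0 : symmDiff J J = ∅ := symmDiff_self J
      rw [contraction, h0]
      simp [condAvg, sqNorm, pow_two]
    simp [this]
  have e2 : ∀ v ∈ V, ∫ x, (∑ p ∈ D ×ˢ D with diffs p = v, contraction μ w p.1 p.2 x) ^ 2
          ∂(Measure.pi μ) = sqNorm μ w v.1 * sqNorm μ w v.2 := fun v hv ↦ by
    obtain ⟨hv1, hv2⟩ := Finset.mem_filter.1 hv
    obtain ⟨hvJ, hvK⟩ := Finset.mem_product.1 hv1
    -- as all sets have the same size, a pair whose differences have full size is disjoint
    have : (D ×ˢ D).filter (fun p ↦ diffs p = v) = {v} := by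
      ext p
      simp only [Finset.mem_filter, Finset.mem_product, Finset.mem_singleton]
      constructor
      · rintro ⟨⟨hp1, hp2⟩, hp3⟩
        have f1 : p.1 \ p.2 = v.1 := congrArg Prod.fst hp3
        have f2 : p.2 \ p.1 = v.2 := congrArg Prod.snd hp3
        refine Prod.ext (Finset.eq_of_subset_of_card_le ?_ ?_).symm
          (Finset.eq_of_subset_of_card_le ?_ ?_).symm
        · rw [← f1]; exact Finset.sdiff_subset
        · rw [hD _ hp1, hD _ hvJ]
        · rw [← f2]; exact Finset.sdiff_subset
        · rw [hD _ hp2, hD _ hvK]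
      · rintro rfl
        refine ⟨⟨hvJ, hvK⟩, ?_⟩
        simp only [diffs, Finset.sdiff_eq_self_of_disjoint hv2,
          Finset.sdiff_eq_self_of_disjoint hv2.symm]
    rw [this]
    simp only [Finset.sum_singleton]
    have hc : contraction μ w v.1 v.2 = fun x ↦ w v.1 x * w v.2 x := by
      rw [contraction]
      refine condAvg_of_dependsOn ?_
      have : symmDiff v.1 v.2 = v.1 ∪ v.2 := hv2.symmDiff_eq_sup
      rw [this]
      exact hw.dependsOn_mul _ _
    rw [hc]
    exact hw.integral_sq_mul_sq hv2
  rw [e1, Finset.sum_congr rfl e2]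
  have e3 : ∑ p ∈ D ×ˢ D, sqNorm μ w p.1 * sqNorm μ w p.2 = 1 := by
    rw [Finset.sum_product, ← Finset.sum_mul_sum, h1, one_mul]
  rw [← Finset.sum_filter_add_sum_filter_not (D ×ˢ D) fun p ↦ Disjoint p.1 p.2] at e3
  rw [meetSum]
  linarith

/-- The configurations in which `J ∩ J'` and `K ∩ K'` meet contribute at most
`4 ^ d ∑ σ_J² σ_K²`, the sum extending over intersecting pairs. -/
lemma abs_sum_meeting_le (hw : IsCanonicalFamily μ w) (hD : ∀ J ∈ D, J.card = d) :
    |∑ p ∈ D ×ˢ D, ∑ q ∈ D ×ˢ D,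
      if diffs p = diffs q ∧ ¬ Disjoint (p.1 ∩ p.2) (q.1 ∩ q.2) then
        ∫ x, contraction μ w p.1 p.2 x * contraction μ w q.1 q.2 x ∂(Measure.pi μ) else 0|
      ≤ 4 ^ d * meetSum μ D w := by
  set F : Finset ι → Finset ι → Finset ι → Finset ι → ℝ := fun a b c e ↦
    if diffs (a, b) = diffs (c, e) ∧ ¬ Disjoint (a ∩ b) (c ∩ e) then
      sqNorm μ w a * sqNorm μ w e else 0 with hF
  have hFle : ∑ p ∈ D ×ˢ D, ∑ q ∈ D ×ˢ D, F p.1 p.2 q.1 q.2 ≤ 4 ^ d * meetSum μ D w := by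
    rw [sum_sum_reorder, meetSum, Finset.mul_sum, Finset.sum_filter]
    refine Finset.sum_le_sum fun p hp ↦ ?_
    obtain ⟨hp1, hp2⟩ := Finset.mem_product.1 hp
    have nn := mul_nonneg (sqNorm_nonneg (μ := μ) w p.1) (sqNorm_nonneg (μ := μ) w p.2)
    simp only [hF]
    rw [← Finset.sum_filter, Finset.sum_const, nsmul_eq_mul]
    by_cases h : Disjoint p.1 p.2
    · rw [if_neg (by simpa using h), Finset.filter_eq_empty_iff.2]
      · simp
      · rintro q _ ⟨-, h2⟩
        exact h2 (h.mono Finset.inter_subset_left Finset.inter_subset_right)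
    · rw [if_pos h]
      refine mul_le_mul_of_nonneg_right ?_ nn
      have := card_exchange_le (hD _ hp1) (hD _ hp2)
        ((D ×ˢ D).filter fun q ↦ diffs (p.1, q.1) = diffs (q.2, p.2) ∧
          ¬ Disjoint (p.1 ∩ q.1) (q.2 ∩ p.2)) fun q hq ↦ by
        have := (Finset.mem_filter.1 hq).2.1
        simpa [diffs] using this
      exact_mod_cast this
  have hsym : ∑ p ∈ D ×ˢ D, ∑ q ∈ D ×ˢ D, F p.2 p.1 q.2 q.1
      = ∑ p ∈ D ×ˢ D, ∑ q ∈ D ×ˢ D, F p.1 p.2 q.1 q.2 := (sum_sum_swap D F).symm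
  calc _ ≤ ∑ p ∈ D ×ˢ D, ∑ q ∈ D ×ˢ D, (F p.1 p.2 q.1 q.2 + F p.2 p.1 q.2 q.1) / 2 := by
        refine (Finset.abs_sum_le_sum_abs _ _).trans (Finset.sum_le_sum fun p _ ↦ ?_)
        refine (Finset.abs_sum_le_sum_abs _ _).trans (Finset.sum_le_sum fun q _ ↦ ?_)
        by_cases h : diffs p = diffs q ∧ ¬ Disjoint (p.1 ∩ p.2) (q.1 ∩ q.2)
        · have h' : diffs (p.2, p.1) = diffs (q.2, q.1) ∧ ¬ Disjoint (p.2 ∩ p.1) (q.2 ∩ q.1) := by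
            rw [Finset.inter_comm p.2, Finset.inter_comm q.2]
            refine ⟨?_, h.2⟩
            have := h.1
            simp only [diffs, Prod.mk.injEq] at this ⊢
            exact this.symm
          simp only [hF]
          rw [if_pos h, if_pos h, if_pos h']
          exact hw.abs_integral_contraction_mul_le p.1 p.2 q.2 q.1
        · have h' : ¬ (diffs (p.2, p.1) = diffs (q.2, q.1) ∧
              ¬ Disjoint (p.2 ∩ p.1) (q.2 ∩ q.1)) := by
            rw [Finset.inter_comm p.2, Finset.inter_comm q.2]
            rintro ⟨h1, h2⟩
            refine h ⟨?_, h2⟩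
            simp only [diffs, Prod.mk.injEq] at h1 ⊢
            exact h1.symm
          simp only [hF]
          rw [if_neg h, if_neg h, if_neg h']
          simp
    _ = ∑ p ∈ D ×ˢ D, ∑ q ∈ D ×ˢ D, F p.1 p.2 q.1 q.2 := by
        simp_rw [← Finset.sum_div, Finset.sum_add_distrib, hsym]
        ring
    _ ≤ _ := hFle

/-- The top-level part has second moment at least `2`, up to the maximal influence. -/
lemma le_integral_topPart_sq (hw : IsCanonicalFamily μ w) (hd : 1 ≤ d)
    (hD : ∀ J ∈ D, J.card = d) (h1 : ∑ J ∈ D, sqNorm μ w J = 1) {ρ : ℝ}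
    (hρ : ∀ i, ∑ K ∈ D with i ∈ K, sqNorm μ w K ≤ ρ) :
    2 - (4 ^ d + 1) * d * ρ ≤ ∫ x, topPart D w x ^ 2 ∂(Measure.pi μ) := by
  have a1 := meetSum_le hD h1 hρ
  have a2 := le_sum_diffs hw hd hD h1
  have a3 := (abs_le.1 (abs_sum_meeting_le hw hD)).2
  have e : ∫ x, topPart D w x ^ 2 ∂(Measure.pi μ)
      = ∑ p ∈ D ×ˢ D, ∑ q ∈ D ×ˢ D, (if diffs p = diffs q then
        ∫ x, contraction μ w p.1 p.2 x * contraction μ w q.1 q.2 x ∂(Measure.pi μ) else 0)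
      - ∑ p ∈ D ×ˢ D, ∑ q ∈ D ×ˢ D,
      if diffs p = diffs q ∧ ¬ Disjoint (p.1 ∩ p.2) (q.1 ∩ q.2) then
        ∫ x, contraction μ w p.1 p.2 x * contraction μ w q.1 q.2 x ∂(Measure.pi μ) else 0 := by
    rw [integral_topPart_sq_eq hw, ← Finset.sum_sub_distrib]
    refine Finset.sum_congr rfl fun p _ ↦ ?_
    rw [← Finset.sum_sub_distrib]
    refine Finset.sum_congr rfl fun q _ ↦ ?_
    by_cases h : diffs p = diffs q <;> by_cases h' : Disjoint (p.1 ∩ p.2) (q.1 ∩ q.2) <;>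
      simp [h, h']
  rw [e]
  have : (4 : ℝ) ^ d * meetSum μ D w ≤ 4 ^ d * (d * ρ) :=
    mul_le_mul_of_nonneg_left a1 (by positivity)
  nlinarith

end TopPart

/-! ### The number operator and its spectral bounds -/

section NumberOperator

set_option linter.unusedSectionVars false

variable {ι : Type*} [Fintype ι] [DecidableEq ι] {E : ι → Type*} [∀ i, MeasurableSpace (E i)]
  {μ : ∀ i, Measure (E i)} [∀ i, IsProbabilityMeasure (μ i)]

lemma condAvg_finset_sum {κ : Type*} (s : Finset κ) (K : Finset ι) {f : κ → (∀ i, E i) → ℝ}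
    (hf : ∀ a ∈ s, Integrable (f a) (Measure.pi μ)) :
    condAvg μ K (fun x ↦ ∑ a ∈ s, f a x)
      =ᵐ[Measure.pi μ] fun x ↦ ∑ a ∈ s, condAvg μ K (f a) x := by
  have h : ∀ᵐ x ∂(Measure.pi μ), ∀ a ∈ s,
      Integrable (fun y ↦ f a (K.piecewise x y)) (Measure.pi μ) := by
    rw [eventually_all_finset]
    exact fun a ha ↦ (integrable_piecewise_prod K (hf a ha)).prod_right_ae
  filter_upwards [h] with x hx
  exact integral_finsetSum _ hx

lemma condAvg_const_mul (K : Finset ι) (c : ℝ) (F : (∀ i, E i) → ℝ) :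
    condAvg μ K (fun x ↦ c * F x) = fun x ↦ c * condAvg μ K F x := by
  ext x
  exact integral_const_mul _ _

lemma condAvg_sub (K : Finset ι) {F G : (∀ i, E i) → ℝ} (hF : Integrable F (Measure.pi μ))
    (hG : Integrable G (Measure.pi μ)) :
    condAvg μ K (fun x ↦ F x - G x)
      =ᵐ[Measure.pi μ] fun x ↦ condAvg μ K F x - condAvg μ K G x := by
  filter_upwards [(integrable_piecewise_prod K hF).prod_right_ae,
    (integrable_piecewise_prod K hG).prod_right_ae] with x h1 h2
  exact integral_sub h1 h2

lemma condAvg_zero (K : Finset ι) : condAvg μ K (0 : (∀ i, E i) → ℝ) = 0 := by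
  ext x; simp [condAvg]

lemma dependsOn_condAvg_inter {K S : Finset ι} {F : (∀ i, E i) → ℝ}
    (hF : DependsOn F (S : Set ι)) :
    DependsOn (condAvg μ K F) ((K ∩ S : Finset ι) : Set ι) := by
  rw [condAvg_eq_of_dependsOn hF (T := K ∩ S) fun i hi ↦ by simp [hi]]
  exact dependsOn_condAvg _ _

/-- Averaging operators are symmetric. -/
lemma integral_condAvg_mul_comm (K : Finset ι) {F G : (∀ i, E i) → ℝ} (hF : Measurable F)
    (hG : Measurable G) (hF2 : MemLp F 2 (Measure.pi μ)) (hG2 : MemLp G 2 (Measure.pi μ)) :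
    ∫ x, condAvg μ K F x * G x ∂(Measure.pi μ) = ∫ x, F x * condAvg μ K G x ∂(Measure.pi μ) := by
  have h1 := integral_condAvg_mul hF (measurable_condAvg (μ := μ) K hG) (dependsOn_condAvg K G)
    (integrable_mul_of_memLp_two hF2 (memLp_condAvg K (by norm_num) hG hG2))
  have h2 := integral_condAvg_mul hG (measurable_condAvg (μ := μ) K hF) (dependsOn_condAvg K F)
    (integrable_mul_of_memLp_two hG2 (memLp_condAvg K (by norm_num) hF hF2))
  rw [← h1]
  calc _ = ∫ x, G x * condAvg μ K F x ∂(Measure.pi μ) := by simp_rw [mul_comm]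
    _ = _ := h2.symm
    _ = _ := by simp_rw [mul_comm]

variable (μ) in
/-- A square-integrable function of the coordinates in `M` which vanishes when any of these
coordinates is averaged out: a function equal to its own Hoeffding component of index `M`. -/
structure IsPure (M : Finset ι) (F : (∀ i, E i) → ℝ) : Prop where
  measurable : Measurable F
  memLp : MemLp F 2 (Measure.pi μ)
  dependsOn : DependsOn F (M : Set ι)
  condAvg_eq_zero : ∀ i ∈ M, condAvg μ (Finset.univ.erase i) F =ᵐ[Measure.pi μ] 0

lemma isPure_zero (M : Finset ι) : IsPure μ M (0 : (∀ i, E i) → ℝ) where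
  measurable := measurable_const
  memLp := MemLp.zero
  dependsOn := fun _ _ _ ↦ rfl
  condAvg_eq_zero i _ := by rw [condAvg_zero]

lemma IsPure.sum {κ : Type*} {s : Finset κ} {M : Finset ι} {f : κ → (∀ i, E i) → ℝ}
    (hf : ∀ a ∈ s, IsPure μ M (f a)) : IsPure μ M fun x ↦ ∑ a ∈ s, f a x where
  measurable := Finset.measurable_fun_sum _ fun a ha ↦ (hf a ha).measurable
  memLp := memLp_two_finset_sum _ fun a ha ↦ (hf a ha).memLp
  dependsOn := fun x y h ↦ Finset.sum_congr rfl fun a ha ↦ (hf a ha).dependsOn h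
  condAvg_eq_zero i hi := by
    have h : ∀ᵐ x ∂(Measure.pi μ), ∀ a ∈ s, condAvg μ (Finset.univ.erase i) (f a) x = 0 := by
      rw [eventually_all_finset]
      exact fun a ha ↦ (hf a ha).condAvg_eq_zero i hi
    filter_upwards [condAvg_finset_sum s (Finset.univ.erase i)
      fun a ha ↦ (hf a ha).memLp.integrable (by norm_num), h] with x h1 h2
    rw [h1, Finset.sum_eq_zero h2]
    rfl

lemma IsPure.const_mul {M : Finset ι} {F : (∀ i, E i) → ℝ} (hF : IsPure μ M F) (c : ℝ) :
    IsPure μ M fun x ↦ c * F x where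
  measurable := hF.measurable.const_mul c
  memLp := hF.memLp.const_mul c
  dependsOn := fun x y h ↦ by simp only [hF.dependsOn h]
  condAvg_eq_zero i hi := by
    rw [condAvg_const_mul]
    filter_upwards [hF.condAvg_eq_zero i hi] with x hx
    simp [hx]

lemma IsPure.integral_mul_eq_zero {M M' : Finset ι} {F G : (∀ i, E i) → ℝ} (hF : IsPure μ M F)
    (hG : IsPure μ M' G) (h : M ≠ M') : ∫ x, F x * G x ∂(Measure.pi μ) = 0 := by
  have key : ∀ {M M' : Finset ι} {F G : (∀ i, E i) → ℝ}, IsPure μ M F → IsPure μ M' G →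
      ∀ i ∈ M, i ∉ M' → ∫ x, F x * G x ∂(Measure.pi μ) = 0 := by
    intro M M' F G hF hG i hi hi'
    rw [← integral_condAvg_mul (K := Finset.univ.erase i) hF.measurable hG.measurable
      (hG.dependsOn.mono fun j hj ↦ by
        have : j ≠ i := by rintro rfl; exact hi' hj
        simpa using this) (integrable_mul_of_memLp_two hF.memLp hG.memLp),
      ← integral_zero (∀ i, E i) ℝ (μ := Measure.pi μ)]
    refine integral_congr_ae ?_
    filter_upwards [hF.condAvg_eq_zero i hi] with x hx
    simp [hx]
  have : ∃ i, ¬ (i ∈ M ↔ i ∈ M') := by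
    by_contra! hc
    exact h (Finset.ext hc)
  obtain ⟨i, hi⟩ := this
  by_cases h1 : i ∈ M
  · exact key hF hG i h1 fun h2 ↦ hi ⟨fun _ ↦ h2, fun _ ↦ h1⟩
  · have h2 : i ∈ M' := by tauto
    rw [← key hG hF i h2 h1]
    simp_rw [mul_comm]

/-- Existence of the Hoeffding decomposition, one coordinate at a time: for a coordinate `i` that
has not yet been treated, `F` splits into its average over `i` and the remainder. The set `P`
collects the coordinates over which `F` already has zero average. -/
lemma exists_pure_decomposition_aux (L : Finset ι) : ∀ (P : Finset ι) (F : (∀ i, E i) → ℝ),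
    Disjoint L P → Measurable F → MemLp F 2 (Measure.pi μ) →
    DependsOn F ((L ∪ P : Finset ι) : Set ι) →
    (∀ j ∈ P, condAvg μ (Finset.univ.erase j) F =ᵐ[Measure.pi μ] 0) →
    ∃ c : Finset ι → (∀ i, E i) → ℝ, (∀ M ∈ L.powerset, IsPure μ (M ∪ P) (c M)) ∧
      ∀ x, F x = ∑ M ∈ L.powerset, c M x := by
  induction L using Finset.induction_on with
  | empty =>
    intro P F _ hm h2 hd hz
    refine ⟨fun _ ↦ F, fun M hM ↦ ?_, fun x ↦ by simp⟩
    rw [Finset.powerset_empty, Finset.mem_singleton] at hM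
    subst hM
    rw [Finset.empty_union] at hd ⊢
    exact ⟨hm, h2, hd, hz⟩
  | insert i L hi ih =>
    intro P F hdis hm h2 hd hz
    rw [Finset.disjoint_insert_left] at hdis
    set R := condAvg μ (Finset.univ.erase i) F with hR
    have hF1 : Integrable F (Measure.pi μ) := h2.integrable (by norm_num)
    have hRm : Measurable R := measurable_condAvg _ hm
    have hR2 : MemLp R 2 (Measure.pi μ) := memLp_condAvg _ (by norm_num) hm h2
    have hR1 : Integrable R (Measure.pi μ) := hR2.integrable (by norm_num)
    have hRz : ∀ j ∈ P, condAvg μ (Finset.univ.erase j) R =ᵐ[Measure.pi μ] 0 := fun j hj ↦ by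
      have a1 := condAvg_condAvg (Finset.univ.erase j) (Finset.univ.erase i) hm hF1
      have a2 := condAvg_condAvg (Finset.univ.erase i) (Finset.univ.erase j) hm hF1
      have a3 := condAvg_congr_ae (Finset.univ.erase i) (hz j hj)
      rw [condAvg_zero] at a3
      rw [Finset.inter_comm] at a1
      exact a1.trans (a2.symm.trans a3)
    have hRd : DependsOn R ((L ∪ P : Finset ι) : Set ι) :=
      (dependsOn_condAvg_inter hd).mono fun j hj ↦ by
        simp only [Finset.coe_inter, Finset.coe_union, Finset.coe_insert, Finset.coe_erase,
          Set.mem_inter_iff, Set.mem_sdiff, Set.mem_union, Set.mem_insert_iff,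
          Set.mem_singleton_iff] at hj ⊢
        tauto
    obtain ⟨c₁, hc₁, hs₁⟩ := ih P R hdis.2 hRm hR2 hRd hRz
    obtain ⟨c₂, hc₂, hs₂⟩ := ih (insert i P) (fun x ↦ F x - R x)
      (by rw [Finset.disjoint_insert_right]; exact ⟨hi, hdis.2⟩) (hm.sub hRm) (h2.sub hR2)
      (fun x y hxy ↦ by
        have a1 := hd fun j hj ↦ hxy j (by
          simp only [Finset.coe_union, Finset.coe_insert, Set.mem_union, Set.mem_insert_iff]
            at hj ⊢
          tauto)
        have a2 := hRd fun j hj ↦ hxy j (by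
          simp only [Finset.coe_union, Finset.coe_insert, Set.mem_union, Set.mem_insert_iff]
            at hj ⊢
          tauto)
        simp only [a1, a2])
      (fun j hj ↦ by
        refine (condAvg_sub _ hF1 hR1).trans ?_
        rcases Finset.mem_insert.1 hj with rfl | hj
        · rw [condAvg_of_dependsOn (F := R) (dependsOn_condAvg _ _)]
          exact Eventually.of_forall fun x ↦ by simp [hR]
        · filter_upwards [hz j hj, hRz j hj] with x b1 b2
          simp [b1, b2])
    refine ⟨fun M ↦ if i ∈ M then c₂ (M.erase i) else c₁ M, fun M hM ↦ ?_, fun x ↦ ?_⟩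
    · rw [Finset.mem_powerset] at hM
      by_cases h : i ∈ M
      · simp only [h, if_true]
        have := hc₂ (M.erase i) (Finset.mem_powerset.2 (Finset.subset_insert_iff.1 hM))
        rwa [Finset.union_insert, ← Finset.insert_union, Finset.insert_erase h] at this
      · simp only [h, if_false]
        exact hc₁ M (Finset.mem_powerset.2 ((Finset.subset_insert_iff_of_notMem h).1 hM))
    · rw [Finset.sum_powerset_insert hi]
      have e1 : ∑ M ∈ L.powerset, (if i ∈ M then c₂ (M.erase i) else c₁ M) x = R x := by
        rw [hs₁]
        refine Finset.sum_congr rfl fun M hM ↦ ?_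
        rw [if_neg fun h ↦ hi (Finset.mem_powerset.1 hM h)]
      have e2 : ∑ M ∈ L.powerset, (if i ∈ insert i M then c₂ ((insert i M).erase i)
          else c₁ (insert i M)) x = F x - R x := by
        rw [hs₂]
        refine Finset.sum_congr rfl fun M hM ↦ ?_
        rw [if_pos (Finset.mem_insert_self _ _),
          Finset.erase_insert fun h ↦ hi (Finset.mem_powerset.1 hM h)]
      rw [e1, e2]; ring

variable (μ) in
/-- `F` is a sum of Hoeffding components of order at most `m`. -/
def HasOrderLE (m : ℕ) (F : (∀ i, E i) → ℝ) : Prop :=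
  ∃ c : Finset ι → (∀ i, E i) → ℝ, (∀ M, IsPure μ M (c M)) ∧ (∀ M, m < M.card → c M = 0) ∧
    ∀ x, F x = ∑ M, c M x

lemma hasOrderLE_of_dependsOn {L : Finset ι} {F : (∀ i, E i) → ℝ} (hm : Measurable F)
    (h2 : MemLp F 2 (Measure.pi μ)) (hd : DependsOn F (L : Set ι)) {m : ℕ} (hL : L.card ≤ m) :
    HasOrderLE μ m F := by
  obtain ⟨c, hc, hs⟩ := exists_pure_decomposition_aux (μ := μ) L ∅ F (by simp) hm h2 (by simpa)
    (by simp)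
  refine ⟨fun M ↦ if M ∈ L.powerset then c M else 0, fun M ↦ ?_, fun M hM ↦ ?_, fun x ↦ ?_⟩
  · by_cases h : M ∈ L.powerset
    · simpa only [h, if_true, Finset.union_empty] using hc M h
    · simp only [h, if_false]
      exact isPure_zero M
  · refine if_neg fun h ↦ ?_
    have := Finset.card_le_card (Finset.mem_powerset.1 h)
    omega
  · rw [hs]
    refine Finset.sum_subset_zero_on_sdiff (Finset.subset_univ _) (fun M hM ↦ ?_) fun M hM ↦ ?_
    · simp only [if_neg (Finset.mem_sdiff.1 hM).2]; rfl
    · simp only [if_pos hM]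

lemma HasOrderLE.sum {κ : Type*} {s : Finset κ} {m : ℕ} {f : κ → (∀ i, E i) → ℝ}
    (hf : ∀ a ∈ s, HasOrderLE μ m (f a)) : HasOrderLE μ m fun x ↦ ∑ a ∈ s, f a x := by
  choose! c hc1 hc2 hc3 using hf
  refine ⟨fun M x ↦ ∑ a ∈ s, c a M x, fun M ↦ IsPure.sum fun a ha ↦ hc1 a ha M,
    fun M hM ↦ ?_, fun x ↦ ?_⟩
  · ext x
    exact Finset.sum_eq_zero fun a ha ↦ by rw [hc2 a ha M hM]; rfl
  · rw [Finset.sum_comm]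
    exact Finset.sum_congr rfl fun a ha ↦ hc3 a ha x

lemma HasOrderLE.sub {m : ℕ} {F G : (∀ i, E i) → ℝ} (hF : HasOrderLE μ m F)
    (hG : HasOrderLE μ m G) : HasOrderLE μ m fun x ↦ F x - G x := by
  obtain ⟨c, hc1, hc2, hc3⟩ := hF
  obtain ⟨e, he1, he2, he3⟩ := hG
  refine ⟨fun M x ↦ ∑ b : Bool, (if b then c M x else -1 * e M x), fun M ↦ ?_, fun M hM ↦ ?_,
    fun x ↦ ?_⟩
  · refine IsPure.sum (f := fun (b : Bool) x ↦ if b then c M x else -1 * e M x) fun b _ ↦ ?_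
    cases b
    · simpa using (he1 M).const_mul (-1)
    · simpa using hc1 M
  · ext x; simp [hc2 M hM, he2 M hM]
  · simp only [Fintype.sum_bool, Bool.false_eq_true, if_true, if_false]
    rw [hc3, he3, Finset.sum_add_distrib, ← Finset.mul_sum]
    ring

variable (μ) in
/-- The number operator `∑_i (I - R_i)`, where `R_i` averages over the `i`-th coordinate. It acts
on Hoeffding components as multiplication by the order. -/
noncomputable def numOp (F : (∀ i, E i) → ℝ) (x : ∀ i, E i) : ℝ :=
  ∑ i, (F x - condAvg μ (Finset.univ.erase i) F x)

lemma memLp_numOp {F : (∀ i, E i) → ℝ} (hm : Measurable F) (h2 : MemLp F 2 (Measure.pi μ)) :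
    MemLp (numOp μ F) 2 (Measure.pi μ) :=
  memLp_two_finset_sum _ fun _ _ ↦ h2.sub (memLp_condAvg _ (by norm_num) hm h2)

lemma numOp_sum {κ : Type*} (s : Finset κ) {f : κ → (∀ i, E i) → ℝ}
    (hf : ∀ a ∈ s, Integrable (f a) (Measure.pi μ)) :
    numOp μ (fun x ↦ ∑ a ∈ s, f a x) =ᵐ[Measure.pi μ] fun x ↦ ∑ a ∈ s, numOp μ (f a) x := by
  have h : ∀ᵐ x ∂(Measure.pi μ), ∀ i : ι, condAvg μ (Finset.univ.erase i)
      (fun x ↦ ∑ a ∈ s, f a x) x = ∑ a ∈ s, condAvg μ (Finset.univ.erase i) (f a) x :=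
    ae_all_iff.2 fun i ↦ condAvg_finset_sum s _ hf
  filter_upwards [h] with x hx
  simp only [numOp, hx]
  rw [Finset.sum_comm]
  refine Finset.sum_congr rfl fun i _ ↦ ?_
  rw [Finset.sum_sub_distrib]

lemma numOp_sub {F G : (∀ i, E i) → ℝ} (hF : Integrable F (Measure.pi μ))
    (hG : Integrable G (Measure.pi μ)) :
    numOp μ (fun x ↦ F x - G x) =ᵐ[Measure.pi μ] fun x ↦ numOp μ F x - numOp μ G x := by
  have h : ∀ᵐ x ∂(Measure.pi μ), ∀ i : ι, condAvg μ (Finset.univ.erase i) (fun x ↦ F x - G x) x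
      = condAvg μ (Finset.univ.erase i) F x - condAvg μ (Finset.univ.erase i) G x :=
    ae_all_iff.2 fun i ↦ condAvg_sub _ hF hG
  filter_upwards [h] with x hx
  simp only [numOp, hx]
  rw [← Finset.sum_sub_distrib]
  exact Finset.sum_congr rfl fun i _ ↦ by ring

lemma numOp_const (c : ℝ) : numOp μ (fun _ : (∀ i, E i) ↦ c) = 0 := by
  ext x; simp [numOp, condAvg]

lemma integral_numOp {F : (∀ i, E i) → ℝ} (hm : Measurable F)
    (hF : Integrable F (Measure.pi μ)) : ∫ x, numOp μ F x ∂(Measure.pi μ) = 0 := by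
  simp only [numOp]
  have hi : ∀ i : ι, Integrable (fun x ↦ F x - condAvg μ (Finset.univ.erase i) F x)
      (Measure.pi μ) := fun i ↦ hF.sub (integrable_condAvg _ hF)
  rw [integral_finsetSum _ fun i _ ↦ hi i]
  refine Finset.sum_eq_zero fun i _ ↦ ?_
  rw [integral_sub hF (integrable_condAvg _ hF), integral_condAvg _ hm hF, sub_self]

lemma integral_numOp_mul_comm {F G : (∀ i, E i) → ℝ} (hF : Measurable F) (hG : Measurable G)
    (hF2 : MemLp F 2 (Measure.pi μ)) (hG2 : MemLp G 2 (Measure.pi μ)) :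
    ∫ x, numOp μ F x * G x ∂(Measure.pi μ) = ∫ x, F x * numOp μ G x ∂(Measure.pi μ) := by
  simp only [numOp, Finset.sum_mul, Finset.mul_sum, sub_mul, mul_sub]
  have i0 := integrable_mul_of_memLp_two hF2 hG2
  have i1 : ∀ i : ι, Integrable (fun x ↦ condAvg μ (Finset.univ.erase i) F x * G x)
      (Measure.pi μ) := fun i ↦
    integrable_mul_of_memLp_two (memLp_condAvg _ (by norm_num) hF hF2) hG2
  have i2 : ∀ i : ι, Integrable (fun x ↦ F x * condAvg μ (Finset.univ.erase i) G x)
      (Measure.pi μ) := fun i ↦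
    integrable_mul_of_memLp_two hF2 (memLp_condAvg _ (by norm_num) hG hG2)
  have j1 : ∀ i : ι, Integrable (fun x ↦ F x * G x - condAvg μ (Finset.univ.erase i) F x * G x)
      (Measure.pi μ) := fun i ↦ i0.sub (i1 i)
  have j2 : ∀ i : ι, Integrable (fun x ↦ F x * G x - F x * condAvg μ (Finset.univ.erase i) G x)
      (Measure.pi μ) := fun i ↦ i0.sub (i2 i)
  rw [integral_finsetSum _ fun i _ ↦ j1 i, integral_finsetSum _ fun i _ ↦ j2 i]
  refine Finset.sum_congr rfl fun i _ ↦ ?_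
  rw [integral_sub i0 (i1 i), integral_sub i0 (i2 i), integral_condAvg_mul_comm _ hF hG hF2 hG2]

lemma IsPure.numOp_eq {M : Finset ι} {F : (∀ i, E i) → ℝ} (hF : IsPure μ M F) :
    numOp μ F =ᵐ[Measure.pi μ] fun x ↦ M.card * F x := by
  have h : ∀ᵐ x ∂(Measure.pi μ), ∀ i ∈ M, condAvg μ (Finset.univ.erase i) F x = 0 := by
    rw [eventually_all_finset]
    exact hF.condAvg_eq_zero
  filter_upwards [h] with x hx
  have : ∀ i : ι, F x - condAvg μ (Finset.univ.erase i) F x = if i ∈ M then F x else 0 := fun i ↦ by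
    by_cases hi : i ∈ M
    · simp [hi, hx i hi]
    · rw [condAvg_of_dependsOn (hF.dependsOn.mono fun j hj ↦ ?_), if_neg hi, sub_self]
      have : j ≠ i := by rintro rfl; exact hi hj
      simpa using this
  simp [numOp, this]

lemma IsPure.integral_sum_mul_sum {c : Finset ι → (∀ i, E i) → ℝ} (hc : ∀ M, IsPure μ M (c M))
    (a b : Finset ι → ℝ) :
    ∫ x, (∑ M, a M * c M x) * (∑ M, b M * c M x) ∂(Measure.pi μ)
      = ∑ M, a M * b M * ∫ x, c M x ^ 2 ∂(Measure.pi μ) := by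
  rw [DegenerateUStat.integral_sum_mul_sum _ _ (fun M _ ↦ ((hc M).const_mul (a M)).memLp)
    (fun M _ ↦ ((hc M).const_mul (b M)).memLp)]
  refine Finset.sum_congr rfl fun M _ ↦ ?_
  rw [Finset.sum_eq_single M]
  · rw [← integral_const_mul]
    congr 1; ext x; ring
  · intro M' _ h
    exact ((hc M).const_mul (a M)).integral_mul_eq_zero ((hc M').const_mul (b M')) h.symm
  · simp

/-- On functions of order at most `m`, the operator `I - N / m` lies between `0` and `I`. -/
lemma HasOrderLE.spectral_bounds {m : ℕ} (hm : 1 ≤ m) {F : (∀ i, E i) → ℝ}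
    (hF : HasOrderLE μ m F) :
    ∫ x, (F x - numOp μ F x / m) ^ 2 ∂(Measure.pi μ) ≤ ∫ x, F x ^ 2 ∂(Measure.pi μ) ∧
      ∫ x, F x * (F x - numOp μ F x / m) ∂(Measure.pi μ) ≤ ∫ x, F x ^ 2 ∂(Measure.pi μ) := by
  obtain ⟨c, hc, hc0, hs⟩ := hF
  have hFe : F = fun x ↦ ∑ M, c M x := funext hs
  set a : Finset ι → ℝ := fun M ↦ if M.card ≤ m then 1 - (M.card : ℝ) / m else 0 with ha
  have hm' : (0 : ℝ) < m := by exact_mod_cast hm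
  have ha0 : ∀ M, 0 ≤ a M ∧ a M ≤ 1 := fun M ↦ by
    simp only [ha]
    split_ifs with h
    · have h1 : (M.card : ℝ) / m ≤ 1 := by
        rw [div_le_one hm']; exact_mod_cast h
      have h2 : 0 ≤ (M.card : ℝ) / m := by positivity
      constructor <;> linarith
    · simp
  have hN : (fun x ↦ F x - numOp μ F x / m) =ᵐ[Measure.pi μ] fun x ↦ ∑ M, a M * c M x := by
    have h1 := numOp_sum (μ := μ) Finset.univ (f := c)
      fun M _ ↦ (hc M).memLp.integrable (by norm_num)
    have h2 : ∀ᵐ x ∂(Measure.pi μ), ∀ M, numOp μ (c M) x = M.card * c M x :=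
      ae_all_iff.2 fun M ↦ (hc M).numOp_eq
    rw [← hFe] at h1
    filter_upwards [h1, h2] with x h1 h2
    rw [h1, hs, Finset.sum_div, ← Finset.sum_sub_distrib]
    refine Finset.sum_congr rfl fun M _ ↦ ?_
    rw [h2]
    simp only [ha]
    split_ifs with h
    · ring
    · rw [hc0 M (by omega)]; simp
  have nn : ∀ M, 0 ≤ ∫ x, c M x ^ 2 ∂(Measure.pi μ) := fun M ↦ integral_nonneg fun x ↦ sq_nonneg _
  have e0 : ∫ x, F x ^ 2 ∂(Measure.pi μ) = ∑ M, 1 * 1 * ∫ x, c M x ^ 2 ∂(Measure.pi μ) := by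
    rw [← IsPure.integral_sum_mul_sum hc]
    congr 1; ext x; rw [hs]; simp [pow_two]
  have e1 : ∫ x, (F x - numOp μ F x / m) ^ 2 ∂(Measure.pi μ)
      = ∑ M, a M * a M * ∫ x, c M x ^ 2 ∂(Measure.pi μ) := by
    rw [← IsPure.integral_sum_mul_sum hc]
    refine integral_congr_ae ?_
    filter_upwards [hN] with x hx
    rw [hx, pow_two]
  have e2 : ∫ x, F x * (F x - numOp μ F x / m) ∂(Measure.pi μ)
      = ∑ M, 1 * a M * ∫ x, c M x ^ 2 ∂(Measure.pi μ) := by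
    rw [← IsPure.integral_sum_mul_sum hc]
    refine integral_congr_ae ?_
    filter_upwards [hN] with x hx
    rw [hx, hs]; simp
  rw [e0, e1, e2]
  constructor <;> refine Finset.sum_le_sum fun M _ ↦ mul_le_mul_of_nonneg_right ?_ (nn M)
  · have := ha0 M; nlinarith
  · have := ha0 M; linarith

end NumberOperator

/-! ### The carré-du-champ of a degenerate `U`-statistic -/

section CarreDuChamp

set_option linter.unusedSectionVars false

variable {ι : Type*} [Fintype ι] [DecidableEq ι] {E : ι → Type*} [∀ i, MeasurableSpace (E i)]
  {μ : ∀ i, Measure (E i)} [∀ i, IsProbabilityMeasure (μ i)]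

/-- The `U`-statistic with components `w J`, `J ∈ D`, as a function on the product space. -/
def uStat (D : Finset (Finset ι)) (w : Finset ι → (∀ i, E i) → ℝ) (x : ∀ i, E i) : ℝ :=
  ∑ J ∈ D, w J x

variable (μ) in
/-- `Γ(W) = W² - N(W²) / (2d)`, which for a degenerate `U`-statistic `W` of order `d` is
`(2d)⁻¹ ∑_i E[(W^{(i)} - W)² | X]`, where `W^{(i)}` is `W` with the `i`-th variable resampled. -/
noncomputable def carre (d : ℕ) (D : Finset (Finset ι)) (w : Finset ι → (∀ i, E i) → ℝ)
    (x : ∀ i, E i) : ℝ :=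
  uStat D w x ^ 2 - numOp μ (fun x ↦ uStat D w x ^ 2) x / (2 * d)

variable {w : Finset ι → (∀ i, E i) → ℝ} {D : Finset (Finset ι)} {d : ℕ}

lemma IsCanonicalFamily.isPure (hw : IsCanonicalFamily μ w) (J : Finset ι) : IsPure μ J (w J) where
  measurable := hw.measurable J
  memLp := hw.memLp_two J
  dependsOn := hw.dependsOn J
  condAvg_eq_zero := hw.condAvg_eq_zero J

lemma IsCanonicalFamily.isPure_mul (hw : IsCanonicalFamily μ w) {J K : Finset ι}
    (h : Disjoint J K) : IsPure μ (J ∪ K) fun x ↦ w J x * w K x where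
  measurable := hw.measurable_mul J K
  memLp := hw.memLp_mul J K
  dependsOn := hw.dependsOn_mul J K
  condAvg_eq_zero i hi := by
    have key : ∀ J K : Finset ι, Disjoint J K → i ∈ J →
        condAvg μ (Finset.univ.erase i) (fun x ↦ w J x * w K x) =ᵐ[Measure.pi μ] 0 := by
      intro J K h hJ
      rw [condAvg_mul_of_dependsOn (w J) ((hw.dependsOn K).mono fun j hj ↦ ?_)]
      · filter_upwards [hw.condAvg_eq_zero J i hJ] with x hx
        simp [hx]
      · have : j ≠ i := by rintro rfl; exact Finset.disjoint_left.1 h hJ hj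
        simpa using this
    rcases Finset.mem_union.1 hi with h1 | h1
    · exact key J K h h1
    · simp_rw [mul_comm (w J _)]
      exact key K J h.symm h1

lemma memLp_uStat (hw : IsCanonicalFamily μ w) : MemLp (uStat D w) 4 (Measure.pi μ) :=
  memLp_finsetSum D fun J _ ↦ hw.memLp J

lemma measurable_uStat (hw : IsCanonicalFamily μ w) : Measurable (uStat D w) :=
  Finset.measurable_fun_sum _ fun J _ ↦ hw.measurable J

lemma memLp_uStat_two (hw : IsCanonicalFamily μ w) : MemLp (uStat D w) 2 (Measure.pi μ) :=
  (memLp_uStat hw).mono_exponent (by norm_num)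

lemma memLp_uStat_sq (hw : IsCanonicalFamily μ w) :
    MemLp (fun x ↦ uStat D w x ^ 2) 2 (Measure.pi μ) := by
  simp_rw [pow_two]
  exact memLp_mul_of_memLp_four (memLp_uStat hw) (memLp_uStat hw)

lemma memLp_carre (hw : IsCanonicalFamily μ w) : MemLp (carre μ d D w) 2 (Measure.pi μ) := by
  refine (memLp_uStat_sq hw).sub ?_
  have := (memLp_numOp ((measurable_uStat hw).pow_const 2) (memLp_uStat_sq (D := D) hw)).const_mul
    (2 * d : ℝ)⁻¹
  refine this.ae_eq (Eventually.of_forall fun x ↦ ?_)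
  simp only; rw [div_eq_inv_mul]

lemma integral_uStat_sq (hw : IsCanonicalFamily μ w) :
    ∫ x, uStat D w x ^ 2 ∂(Measure.pi μ) = ∑ J ∈ D, sqNorm μ w J := by
  simp only [uStat]
  rw [integral_sq_sum _ fun J _ ↦ hw.memLp_two J]
  refine Finset.sum_congr rfl fun J hJ ↦ ?_
  rw [Finset.sum_eq_single J]
  · simp [sqNorm, pow_two]
  · exact fun K _ h ↦ (hw.isPure J).integral_mul_eq_zero (hw.isPure K) h.symm
  · exact fun h ↦ absurd hJ h

lemma numOp_uStat (hw : IsCanonicalFamily μ w) (hD : ∀ J ∈ D, J.card = d) :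
    numOp μ (uStat D w) =ᵐ[Measure.pi μ] fun x ↦ d * uStat D w x := by
  have h1 := numOp_sum (μ := μ) D (f := w) fun J _ ↦ (hw.memLp_two J).integrable (by norm_num)
  have h2 : ∀ᵐ x ∂(Measure.pi μ), ∀ J ∈ D, numOp μ (w J) x = J.card * w J x := by
    rw [eventually_all_finset]
    exact fun J _ ↦ (hw.isPure J).numOp_eq
  filter_upwards [h1, h2] with x h1 h2
  have : numOp μ (uStat D w) x = _ := h1
  rw [this, uStat, Finset.mul_sum]
  exact Finset.sum_congr rfl fun J hJ ↦ by rw [h2 J hJ, hD J hJ]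

/-- The sum of `w_J w_K` over intersecting `J, K`. -/
noncomputable def lowPart (D : Finset (Finset ι)) (w : Finset ι → (∀ i, E i) → ℝ)
    (x : ∀ i, E i) : ℝ :=
  ∑ p ∈ D ×ˢ D with ¬ Disjoint p.1 p.2, w p.1 x * w p.2 x

lemma topPart_add_lowPart (x : ∀ i, E i) :
    topPart D w x + lowPart D w x = uStat D w x ^ 2 := by
  rw [topPart, lowPart, Finset.sum_filter_add_sum_filter_not, pow_two, uStat,
    Finset.sum_mul_sum, Finset.sum_product]

lemma memLp_lowPart (hw : IsCanonicalFamily μ w) : MemLp (lowPart D w) 2 (Measure.pi μ) :=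
  memLp_two_finset_sum _ fun p _ ↦ hw.memLp_mul p.1 p.2

lemma measurable_lowPart (hw : IsCanonicalFamily μ w) : Measurable (lowPart D w) :=
  Finset.measurable_fun_sum _ fun p _ ↦ hw.measurable_mul p.1 p.2

lemma measurable_topPart (hw : IsCanonicalFamily μ w) : Measurable (topPart D w) :=
  Finset.measurable_fun_sum _ fun p _ ↦ hw.measurable_mul p.1 p.2

lemma numOp_topPart (hw : IsCanonicalFamily μ w) (hD : ∀ J ∈ D, J.card = d) :
    numOp μ (topPart D w) =ᵐ[Measure.pi μ] fun x ↦ (2 * d) * topPart D w x := by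
  have h1 := numOp_sum (μ := μ) ((D ×ˢ D).filter fun p ↦ Disjoint p.1 p.2)
    (f := fun p x ↦ w p.1 x * w p.2 x) fun p _ ↦ (hw.memLp_mul p.1 p.2).integrable (by norm_num)
  have h2 : ∀ᵐ x ∂(Measure.pi μ), ∀ p ∈ (D ×ˢ D).filter (fun p ↦ Disjoint p.1 p.2),
      numOp μ (fun x ↦ w p.1 x * w p.2 x) x = (p.1 ∪ p.2).card * (w p.1 x * w p.2 x) := by
    rw [eventually_all_finset]
    exact fun p hp ↦ (hw.isPure_mul (Finset.mem_filter.1 hp).2).numOp_eq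
  filter_upwards [h1, h2] with x h1 h2
  have : numOp μ (topPart D w) x = _ := h1
  rw [this, topPart, Finset.mul_sum]
  refine Finset.sum_congr rfl fun p hp ↦ ?_
  obtain ⟨hp1, hp2⟩ := Finset.mem_filter.1 hp
  obtain ⟨hp3, hp4⟩ := Finset.mem_product.1 hp1
  rw [h2 p hp, Finset.card_union_of_disjoint hp2, hD _ hp3, hD _ hp4]
  push_cast; ring

lemma integral_topPart (hw : IsCanonicalFamily μ w) (hd : 1 ≤ d) (hD : ∀ J ∈ D, J.card = d) :
    ∫ x, topPart D w x ∂(Measure.pi μ) = 0 := by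
  simp only [topPart]
  rw [integral_finsetSum _ fun p _ ↦ (hw.memLp_mul p.1 p.2).integrable (by norm_num)]
  refine Finset.sum_eq_zero fun p hp ↦ ?_
  obtain ⟨hp1, hp2⟩ := Finset.mem_filter.1 hp
  obtain ⟨hp3, -⟩ := Finset.mem_product.1 hp1
  refine (hw.isPure _).integral_mul_eq_zero (hw.isPure _) fun h ↦ ?_
  rw [h, Finset.disjoint_self_iff_empty] at hp2
  have := hD _ hp3
  rw [h, hp2, Finset.card_empty] at this
  omega

lemma integral_topPart_mul_lowPart (hw : IsCanonicalFamily μ w) (hD : ∀ J ∈ D, J.card = d) :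
    ∫ x, topPart D w x * lowPart D w x ∂(Measure.pi μ) = 0 := by
  simp only [topPart, lowPart]
  rw [integral_sum_mul_sum _ _ (fun p _ ↦ hw.memLp_mul p.1 p.2) fun p _ ↦ hw.memLp_mul p.1 p.2]
  refine Finset.sum_eq_zero fun p hp ↦ Finset.sum_eq_zero fun q hq ↦ ?_
  obtain ⟨hp1, hp2⟩ := Finset.mem_filter.1 hp
  obtain ⟨hp3, hp4⟩ := Finset.mem_product.1 hp1
  obtain ⟨hq1, hq2⟩ := Finset.mem_filter.1 hq
  obtain ⟨hq3, hq4⟩ := Finset.mem_product.1 hq1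
  -- `q.1 ∪ q.2` has fewer than `2d` elements, so it misses an element of `p.1 ∪ p.2`
  have hlt : (q.1 ∪ q.2).card < (p.1 ∪ p.2).card := by
    rw [Finset.card_union_of_disjoint hp2, hD _ hp3, hD _ hp4]
    have h1 := Finset.card_union_add_card_inter q.1 q.2
    rw [hD _ hq3, hD _ hq4] at h1
    have h2 : 0 < (q.1 ∩ q.2).card := by
      rw [Finset.card_pos]
      exact Finset.not_disjoint_iff_nonempty_inter.1 hq2
    omega
  obtain ⟨i, hi, hi'⟩ := Finset.exists_mem_notMem_of_card_lt_card hlt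
  rw [Finset.mem_union, not_or] at hi'
  rcases Finset.mem_union.1 hi with h | h
  · exact hw.integral_mul_mul_eq_zero h (Finset.disjoint_left.1 hp2 h) hi'.1 hi'.2
  · rw [← hw.integral_mul_mul_eq_zero h (Finset.disjoint_right.1 hp2 h) hi'.1 hi'.2]
    congr 1; ext x; ring

/-- `Γ(W)` is close to `1` in `L²`, and `E[W² Γ(W)]` is at most close to `1`, when `E[W⁴]` is close
to `3` and all influences are small. The top-level part `T` of `W²` satisfies `N T = 2d T` and so
disappears from `Γ(W)`; by orthogonality the remaining part of `W²`, whose mean is `1`, has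
variance `E[W⁴] - E[T²] - 1`. -/
lemma carre_bounds (hw : IsCanonicalFamily μ w) (hd : 1 ≤ d) (hD : ∀ J ∈ D, J.card = d)
    (h1 : ∑ J ∈ D, sqNorm μ w J = 1) {ρ : ℝ}
    (hρ : ∀ i, ∑ K ∈ D with i ∈ K, sqNorm μ w K ≤ ρ) :
    ∫ x, (1 - carre μ d D w x) ^ 2 ∂(Measure.pi μ)
        ≤ ∫ x, uStat D w x ^ 4 ∂(Measure.pi μ) - 3 + (4 ^ d + 1) * d * ρ ∧
      ∫ x, uStat D w x ^ 2 * carre μ d D w x ∂(Measure.pi μ)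
        ≤ 1 + (∫ x, uStat D w x ^ 4 ∂(Measure.pi μ) - 3 + (4 ^ d + 1) * d * ρ) := by
  have hT := le_integral_topPart_sq hw hd hD h1 hρ
  have hd0 : (2 * d : ℝ) ≠ 0 := by
    have : (1 : ℝ) ≤ d := by exact_mod_cast hd
    positivity
  set T := topPart D w with hTdef
  set Q := lowPart D w with hQdef
  have mT : Measurable T := measurable_topPart hw
  have mQ : Measurable Q := measurable_lowPart hw
  have T2 : MemLp T 2 (Measure.pi μ) := memLp_topPart hw
  have Q2 : MemLp Q 2 (Measure.pi μ) := memLp_lowPart hw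
  have T1 := T2.integrable (by norm_num)
  have Q1 := Q2.integrable (by norm_num)
  set F : (∀ i, E i) → ℝ := fun x ↦ Q x - 1 with hF
  have mF : Measurable F := mQ.sub_const 1
  have F2 : MemLp F 2 (Measure.pi μ) := Q2.sub (memLp_const 1)
  have F1 := F2.integrable (by norm_num)
  have hW2 : ∀ x, uStat D w x ^ 2 = T x + Q x := fun x ↦ (topPart_add_lowPart x).symm
  have iTQ : ∫ x, T x * Q x ∂(Measure.pi μ) = 0 := integral_topPart_mul_lowPart hw hD
  have iT : ∫ x, T x ∂(Measure.pi μ) = 0 := integral_topPart hw hd hD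
  have iQ : ∫ x, Q x ∂(Measure.pi μ) = 1 := by
    have := integral_uStat_sq (μ := μ) (D := D) hw
    simp_rw [hW2] at this
    rw [integral_add T1 Q1, iT, zero_add, h1] at this
    exact this
  have iW4 : ∫ x, uStat D w x ^ 4 ∂(Measure.pi μ)
      = ∫ x, T x ^ 2 ∂(Measure.pi μ) + ∫ x, Q x ^ 2 ∂(Measure.pi μ) := by
    have i1 := integrable_mul_of_memLp_two T2 Q2
    calc _ = ∫ x, (T x ^ 2 + Q x ^ 2 + 2 * (T x * Q x)) ∂(Measure.pi μ) := by
          congr 1; ext x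
          rw [show uStat D w x ^ 4 = (uStat D w x ^ 2) ^ 2 by ring, hW2]; ring
      _ = _ := by
          have hs : Integrable (fun x ↦ T x ^ 2 + Q x ^ 2) (Measure.pi μ) :=
            T2.integrable_sq.add Q2.integrable_sq
          rw [integral_add hs (i1.const_mul 2), integral_add T2.integrable_sq Q2.integrable_sq,
            integral_const_mul, iTQ]
          ring
  have iF : ∫ x, F x ∂(Measure.pi μ) = 0 := by
    simp only [hF]
    rw [integral_sub Q1 (integrable_const _), iQ]; simp
  have iF2 : ∫ x, F x ^ 2 ∂(Measure.pi μ) = ∫ x, Q x ^ 2 ∂(Measure.pi μ) - 1 := by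
    calc _ = ∫ x, (Q x ^ 2 - (2 * Q x - 1)) ∂(Measure.pi μ) := by
          congr 1; ext x; simp only [hF]; ring
      _ = _ := by
          have hs : Integrable (fun x ↦ 2 * Q x - 1) (Measure.pi μ) :=
            (Q1.const_mul 2).sub (integrable_const _)
          rw [integral_sub Q2.integrable_sq hs, integral_sub (Q1.const_mul 2) (integrable_const _),
            integral_const_mul, iQ]
          simp
          ring
  have hord : HasOrderLE μ (2 * d) F := by
    refine HasOrderLE.sub (HasOrderLE.sum fun p hp ↦ ?_) ?_
    · obtain ⟨hp3, hp4⟩ := Finset.mem_product.1 (Finset.mem_filter.1 hp).1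
      refine hasOrderLE_of_dependsOn (hw.measurable_mul _ _) (hw.memLp_mul _ _)
        (hw.dependsOn_mul _ _) ((Finset.card_union_le _ _).trans ?_)
      rw [hD _ hp3, hD _ hp4]; omega
    · exact hasOrderLE_of_dependsOn (L := ∅) measurable_const (memLp_const 1)
        (by simpa using dependsOn_const 1) (by simp)
  obtain ⟨b1, b2⟩ := hord.spectral_bounds (by omega)
  push_cast at b1 b2
  have N2 : MemLp (numOp μ F) 2 (Measure.pi μ) := memLp_numOp mF F2
  have N2' : MemLp (fun x ↦ numOp μ F x / (2 * d)) 2 (Measure.pi μ) := by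
    refine (N2.const_mul (2 * d : ℝ)⁻¹).ae_eq (Eventually.of_forall fun x ↦ ?_)
    simp only; rw [div_eq_inv_mul]
  set A : (∀ i, E i) → ℝ := fun x ↦ F x - numOp μ F x / (2 * d) with hA
  have A2 : MemLp A 2 (Measure.pi μ) := F2.sub N2'
  have A1 := A2.integrable (by norm_num)
  -- `1 - N / (2 d)` annihilates the top-level part and fixes constants
  have hcarre : carre μ d D w =ᵐ[Measure.pi μ] fun x ↦ 1 + A x := by
    have e2 := numOp_sub (μ := μ) T1 Q1.neg
    have e3 := numOp_topPart (μ := μ) hw hD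
    have e4 := numOp_sub (μ := μ) (F := fun _ ↦ -1) (integrable_const _) F1
    have e5 : (fun x ↦ (fun _ ↦ (-1 : ℝ)) x - F x) = -Q := by
      ext x; simp only [hF, Pi.neg_apply]; ring
    rw [e5] at e4
    have e6 : (fun x ↦ T x - (-Q) x) = fun x ↦ uStat D w x ^ 2 := by
      ext x; simp only [Pi.neg_apply]; rw [hW2]; ring
    rw [e6] at e2
    filter_upwards [e2, e3, e4] with x e2 e3 e4
    rw [carre, e2, e3, e4, hW2, numOp_const]
    simp only [Pi.zero_apply, hA, hF]
    field_simp
    ring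
  have c1 : ∫ x, (1 - carre μ d D w x) ^ 2 ∂(Measure.pi μ) = ∫ x, A x ^ 2 ∂(Measure.pi μ) := by
    refine integral_congr_ae ?_
    filter_upwards [hcarre] with x hx
    rw [hx]; ring
  have iA : ∫ x, A x ∂(Measure.pi μ) = 0 := by
    simp only [hA]
    rw [integral_sub F1 (N2'.integrable (by norm_num)), iF, integral_div, integral_numOp mF F1]
    simp
  have iTF : ∫ x, T x * F x ∂(Measure.pi μ) = 0 := by
    simp only [hF, mul_sub, mul_one]
    rw [integral_sub (integrable_mul_of_memLp_two T2 Q2) T1, iTQ, iT, sub_zero]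
  -- `N` is symmetric and `T` is one of its eigenfunctions
  have iTA : ∫ x, T x * A x ∂(Measure.pi μ) = 0 := by
    have a1 := integral_numOp_mul_comm mT mF T2 F2
    have a2 : ∫ x, numOp μ T x * F x ∂(Measure.pi μ) = (2 * d) * ∫ x, T x * F x ∂(Measure.pi μ) := by
      rw [← integral_const_mul]
      refine integral_congr_ae ?_
      filter_upwards [numOp_topPart (μ := μ) hw hD] with x hx
      rw [hx, mul_assoc]
    simp only [hA, mul_sub]
    rw [integral_sub (integrable_mul_of_memLp_two T2 F2) (integrable_mul_of_memLp_two T2 N2')]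
    simp_rw [← mul_div_assoc]
    rw [integral_div, ← a1, a2, iTF]
    simp
  have c2 : ∫ x, uStat D w x ^ 2 * carre μ d D w x ∂(Measure.pi μ)
      = 1 + ∫ x, F x * A x ∂(Measure.pi μ) := by
    calc _ = ∫ x, (T x + Q x + (T x * A x + (F x * A x + A x))) ∂(Measure.pi μ) := by
          refine integral_congr_ae ?_
          filter_upwards [hcarre] with x hx
          rw [hx, hW2]
          simp only [hF]
          ring
      _ = _ := by
          have j1 := integrable_mul_of_memLp_two T2 A2
          have j2 := integrable_mul_of_memLp_two F2 A2
          have j3 : Integrable (fun x ↦ F x * A x + A x) (Measure.pi μ) := j2.add A1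
          have j4 : Integrable (fun x ↦ T x * A x + (F x * A x + A x)) (Measure.pi μ) := j1.add j3
          have j5 : Integrable (fun x ↦ T x + Q x) (Measure.pi μ) := T1.add Q1
          rw [integral_add j5 j4, integral_add T1 Q1, integral_add j1 j3, integral_add j2 A1,
            iT, iQ, iTA, iA]
          ring
  rw [c1, c2]
  constructor
  · linarith
  · linarith

end CarreDuChamp

/-! ### Resampling one coordinate -/

section Taylor

lemma taylor_le {F f f' : ℝ → ℝ} (hF : ∀ x, HasDerivAt F (f x) x)
    (hf : ∀ x, HasDerivAt f (f' x) x) (hl : LipschitzWith 2 f') (a : ℝ) {t : ℝ} (ht : 0 ≤ t) :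
    F (a + t) - F a - f a * t - f' a * t ^ 2 / 2 ≤ t ^ 3 / 3 := by
  have d1 : ∀ s, HasDerivAt (fun s ↦ s ^ 2 - (f (a + s) - f a - f' a * s))
      (2 * s - (f' (a + s) - f' a)) s := fun s ↦ by
    refine (((hasDerivAt_id s).pow 2).sub ((((hf (a + s)).comp_const_add a s).sub_const (f a)).sub
      ((hasDerivAt_id s).const_mul (f' a)))).congr_deriv ?_
    simp
  have d2 : ∀ s, HasDerivAt (fun s ↦ s ^ 3 / 3 - (F (a + s) - F a - f a * s - f' a * s ^ 2 / 2))
      (s ^ 2 - (f (a + s) - f a - f' a * s)) s := fun s ↦ by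
    refine ((((hasDerivAt_id s).pow 3).div_const 3).sub
      (((((hF (a + s)).comp_const_add a s).sub_const (F a)).sub
      ((hasDerivAt_id s).const_mul (f a))).sub
      ((((hasDerivAt_id s).pow 2).const_mul (f' a)).div_const 2))).congr_deriv ?_
    simp
    ring
  have m1 : MonotoneOn (fun s ↦ s ^ 2 - (f (a + s) - f a - f' a * s)) (Set.Ici 0) := by
    refine monotoneOn_of_hasDerivWithinAt_nonneg (convex_Ici 0)
      (fun x _ ↦ (d1 x).continuousAt.continuousWithinAt)
      (fun x _ ↦ (d1 x).hasDerivWithinAt) fun s hs ↦ ?_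
    rw [interior_Ici, Set.mem_Ioi] at hs
    have := hl.dist_le_mul (a + s) a
    rw [Real.dist_eq, Real.dist_eq, add_sub_cancel_left, abs_of_pos hs] at this
    have := (abs_le.1 this).2
    push_cast at this
    linarith
  have m2 : MonotoneOn (fun s ↦ s ^ 3 / 3 - (F (a + s) - F a - f a * s - f' a * s ^ 2 / 2))
      (Set.Ici 0) := by
    refine monotoneOn_of_hasDerivWithinAt_nonneg (convex_Ici 0)
      (fun x _ ↦ (d2 x).continuousAt.continuousWithinAt)
      (fun x _ ↦ (d2 x).hasDerivWithinAt) fun s hs ↦ ?_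
    rw [interior_Ici, Set.mem_Ioi] at hs
    have := m1 (Set.self_mem_Ici (a := (0 : ℝ))) (Set.mem_Ici.2 hs.le) hs.le
    simp at this
    linarith
  have := m2 (Set.self_mem_Ici (a := (0 : ℝ))) (Set.mem_Ici.2 ht) ht
  simp at this
  linarith

/-- Second-order Taylor expansion with a `2`-Lipschitz second derivative. -/
lemma abs_taylor_le {F f f' : ℝ → ℝ} (hF : ∀ x, HasDerivAt F (f x) x)
    (hf : ∀ x, HasDerivAt f (f' x) x) (hl : LipschitzWith 2 f') (a b : ℝ) :
    |F b - F a - f a * (b - a) - f' a * (b - a) ^ 2 / 2| ≤ |b - a| ^ 3 / 3 := by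
  have key : ∀ {F f f' : ℝ → ℝ}, (∀ x, HasDerivAt F (f x) x) → (∀ x, HasDerivAt f (f' x) x) →
      LipschitzWith 2 f' → ∀ a t : ℝ, 0 ≤ t →
      |F (a + t) - F a - f a * t - f' a * t ^ 2 / 2| ≤ t ^ 3 / 3 := by
    intro F f f' hF hf hl a t ht
    rw [abs_le]
    refine ⟨?_, taylor_le hF hf hl a ht⟩
    have := taylor_le (F := fun x ↦ -F x) (f := fun x ↦ -f x) (f' := fun x ↦ -f' x)
      (fun x ↦ (hF x).neg) (fun x ↦ (hf x).neg) hl.neg a ht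
    linarith
  rcases le_total a b with h | h
  · have := key hF hf hl a (b - a) (sub_nonneg.2 h)
    rw [add_sub_cancel] at this
    rwa [abs_of_nonneg (sub_nonneg.2 h)]
  · have hr : LipschitzWith 2 fun x ↦ f' (-x) := by
      refine LipschitzWith.of_dist_le_mul fun x y ↦ (hl.dist_le_mul (-x) (-y)).trans_eq ?_
      rw [dist_neg_neg]
    have := key (F := fun x ↦ F (-x)) (f := fun x ↦ -f (-x)) (f' := fun x ↦ f' (-x))
      (fun x ↦ (((hF (-x)).comp x (hasDerivAt_neg x))).congr_deriv (by ring))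
      (fun x ↦ (((hf (-x)).comp x (hasDerivAt_neg x)).neg).congr_deriv (by ring))
      hr (-a) (a - b) (sub_nonneg.2 h)
    rw [abs_sub_comm b a, abs_of_nonneg (sub_nonneg.2 h)]
    convert this using 2
    have e : -(-a + (a - b)) = b := by ring
    simp only [neg_neg, e]
    ring

end Taylor

section Resampling

set_option linter.unusedSectionVars false

variable {ι : Type*} [Fintype ι] [DecidableEq ι] {E : ι → Type*} [∀ i, MeasurableSpace (E i)]
  {μ : ∀ i, Measure (E i)} [∀ i, IsProbabilityMeasure (μ i)]

lemma integral_fst_mul_piecewise (K : Finset ι) {F G : (∀ i, E i) → ℝ}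
    (h : Integrable (fun p : (∀ i, E i) × (∀ i, E i) ↦ F p.1 * G (K.piecewise p.1 p.2))
      ((Measure.pi μ).prod (Measure.pi μ))) :
    ∫ p : (∀ i, E i) × (∀ i, E i), F p.1 * G (K.piecewise p.1 p.2)
        ∂((Measure.pi μ).prod (Measure.pi μ))
      = ∫ x, F x * condAvg μ K G x ∂(Measure.pi μ) := by
  rw [integral_prod _ h]
  simp only [integral_const_mul]
  rfl

/-- The pair formed by a point and the point resampled off `K` is exchangeable. -/
lemma integral_fst_mul_piecewise_comm (K : Finset ι) {F G : (∀ i, E i) → ℝ} (hF : Measurable F)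
    (hG : Measurable G)
    (h : Integrable (fun p : (∀ i, E i) × (∀ i, E i) ↦ F p.1 * G (K.piecewise p.1 p.2))
      ((Measure.pi μ).prod (Measure.pi μ)))
    (h' : Integrable (fun p : (∀ i, E i) × (∀ i, E i) ↦ G p.1 * F (K.piecewise p.1 p.2))
      ((Measure.pi μ).prod (Measure.pi μ))) :
    ∫ p : (∀ i, E i) × (∀ i, E i), F p.1 * G (K.piecewise p.1 p.2)
        ∂((Measure.pi μ).prod (Measure.pi μ))
      = ∫ p : (∀ i, E i) × (∀ i, E i), G p.1 * F (K.piecewise p.1 p.2)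
        ∂((Measure.pi μ).prod (Measure.pi μ)) := by
  have key : ∀ {F G : (∀ i, E i) → ℝ}, Measurable F → Measurable G →
      Integrable (fun p : (∀ i, E i) × (∀ i, E i) ↦ F p.1 * G (K.piecewise p.1 p.2))
        ((Measure.pi μ).prod (Measure.pi μ)) →
      ∫ x, F x * condAvg μ K G x ∂(Measure.pi μ)
        = ∫ x, condAvg μ K F x * condAvg μ K G x ∂(Measure.pi μ) := by
    intro F G hF hG h
    refine (integral_condAvg_mul hF (measurable_condAvg K hG) (dependsOn_condAvg K G) ?_).symm
    have := h.integral_prod_left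
    simp only [integral_const_mul] at this
    exact this
  rw [integral_fst_mul_piecewise K h, integral_fst_mul_piecewise K h', key hF hG h,
    key hG hF h']
  simp_rw [mul_comm]

variable {w : Finset ι → (∀ i, E i) → ℝ} {D : Finset (Finset ι)} {d : ℕ}

/-- The increment `W(x') - W(x)`, where `x'` is `x` with its `i`-th coordinate taken from an
independent copy `y`. -/
def increment (D : Finset (Finset ι)) (w : Finset ι → (∀ i, E i) → ℝ) (i : ι)
    (p : (∀ i, E i) × (∀ i, E i)) : ℝ :=
  uStat D w ((Finset.univ.erase i).piecewise p.1 p.2) - uStat D w p.1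

lemma memLp_uStat_fst (hw : IsCanonicalFamily μ w) :
    MemLp (fun p : (∀ i, E i) × (∀ i, E i) ↦ uStat D w p.1) 4
      ((Measure.pi μ).prod (Measure.pi μ)) :=
  (memLp_uStat hw).comp_measurePreserving measurePreserving_fst

lemma memLp_uStat_piecewise (hw : IsCanonicalFamily μ w) (K : Finset ι) :
    MemLp (fun p : (∀ i, E i) × (∀ i, E i) ↦ uStat D w (K.piecewise p.1 p.2)) 4
      ((Measure.pi μ).prod (Measure.pi μ)) :=
  (memLp_uStat hw).comp_measurePreserving (measurePreserving_piecewise μ K)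

lemma memLp_increment (hw : IsCanonicalFamily μ w) (i : ι) :
    MemLp (increment D w i) 4 ((Measure.pi μ).prod (Measure.pi μ)) :=
  (memLp_uStat_piecewise hw _).sub (memLp_uStat_fst hw)

/-- `∑_i E[F(X) (W^{(i)} - W)²] = 2d E[F(X) Γ(W)]` for bounded `F`. -/
lemma sum_integral_mul_increment_sq (hw : IsCanonicalFamily μ w) (hd : 1 ≤ d)
    (hD : ∀ J ∈ D, J.card = d) {F : (∀ i, E i) → ℝ} (hF : Measurable F) {C : ℝ}
    (hb : ∀ x, |F x| ≤ C) :
    ∑ i, ∫ p, F p.1 * increment D w i p ^ 2 ∂((Measure.pi μ).prod (Measure.pi μ))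
      = 2 * d * ∫ x, F x * carre μ d D w x ∂(Measure.pi μ) := by
  have hd0 : (d : ℝ) ≠ 0 := by
    have : (1 : ℝ) ≤ d := by exact_mod_cast hd
    positivity
  set W := uStat D w with hW
  have mW : Measurable W := measurable_uStat hw
  have W2 : MemLp W 2 (Measure.pi μ) := memLp_uStat_two hw
  have W2i : Integrable (fun x ↦ W x ^ 2) (Measure.pi μ) := W2.integrable_sq
  have W22 : MemLp (fun x ↦ W x ^ 2) 2 (Measure.pi μ) := memLp_uStat_sq hw
  have bi : ∀ {G : (∀ i, E i) → ℝ}, Integrable G (Measure.pi μ) →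
      Integrable (fun x ↦ F x * G x) (Measure.pi μ) := fun hG ↦
    hG.bdd_mul hF.aestronglyMeasurable (Eventually.of_forall hb)
  have bi2 : ∀ {G : (∀ i, E i) × (∀ i, E i) → ℝ},
      Integrable G ((Measure.pi μ).prod (Measure.pi μ)) →
      Integrable (fun p : (∀ i, E i) × (∀ i, E i) ↦ F p.1 * G p)
        ((Measure.pi μ).prod (Measure.pi μ)) := fun hG ↦
    hG.bdd_mul (hF.comp measurable_fst).aestronglyMeasurable (Eventually.of_forall fun p ↦ hb p.1)
  have each : ∀ i : ι, ∫ p, F p.1 * increment D w i p ^ 2 ∂((Measure.pi μ).prod (Measure.pi μ))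
      = ∫ x, F x * (condAvg μ (Finset.univ.erase i) (fun x ↦ W x ^ 2) x
        - 2 * (W x * condAvg μ (Finset.univ.erase i) W x) + W x ^ 2) ∂(Measure.pi μ) := by
    intro i
    set K := Finset.univ.erase i
    have b2 : Integrable (fun p : (∀ i, E i) × (∀ i, E i) ↦ W (K.piecewise p.1 p.2) ^ 2)
        ((Measure.pi μ).prod (Measure.pi μ)) := integrable_piecewise_prod K W2i
    have a2 : Integrable (fun p : (∀ i, E i) × (∀ i, E i) ↦ W p.1 ^ 2)
        ((Measure.pi μ).prod (Measure.pi μ)) := W2i.comp_fst _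
    have ab : Integrable (fun p : (∀ i, E i) × (∀ i, E i) ↦ W p.1 * W (K.piecewise p.1 p.2))
        ((Measure.pi μ).prod (Measure.pi μ)) :=
      integrable_mul_of_memLp_two ((memLp_uStat_fst hw).mono_exponent (by norm_num))
        ((memLp_uStat_piecewise hw K).mono_exponent (by norm_num))
    have j1 := bi2 b2
    have j2 : Integrable (fun p : (∀ i, E i) × (∀ i, E i) ↦
        (F p.1 * W p.1) * W (K.piecewise p.1 p.2)) ((Measure.pi μ).prod (Measure.pi μ)) :=
      (bi2 ab).congr (Eventually.of_forall fun p ↦ by simp only; ring)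
    have j3 := bi2 a2
    have e1 := integral_fst_mul_piecewise K (F := F) (G := fun x ↦ W x ^ 2) j1
    have e2 := integral_fst_mul_piecewise K (F := fun x ↦ F x * W x) (G := W) j2
    have e3 : ∫ p : (∀ i, E i) × (∀ i, E i), F p.1 * W p.1 ^ 2
        ∂((Measure.pi μ).prod (Measure.pi μ)) = ∫ x, F x * W x ^ 2 ∂(Measure.pi μ) := by
      rw [integral_prod _ j3]; simp
    have k1 := bi (integrable_condAvg K W2i)
    have k2 : Integrable (fun x ↦ F x * W x * condAvg μ K W x) (Measure.pi μ) :=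
      (bi (integrable_mul_of_memLp_two W2 (memLp_condAvg K (by norm_num) mW W2))).congr
        (Eventually.of_forall fun x ↦ by simp only; ring)
    have k3 := bi W2i
    calc _ = ∫ p : (∀ i, E i) × (∀ i, E i), (F p.1 * W (K.piecewise p.1 p.2) ^ 2
          - 2 * ((F p.1 * W p.1) * W (K.piecewise p.1 p.2)) + F p.1 * W p.1 ^ 2)
          ∂((Measure.pi μ).prod (Measure.pi μ)) := by
          congr 1; ext p; simp only [increment]; ring
      _ = ∫ x, F x * condAvg μ K (fun x ↦ W x ^ 2) x ∂(Measure.pi μ)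
          - 2 * ∫ x, F x * W x * condAvg μ K W x ∂(Measure.pi μ)
          + ∫ x, F x * W x ^ 2 ∂(Measure.pi μ) := by
          rw [← e1, ← e2, ← e3, ← integral_const_mul, ← integral_sub j1 (j2.const_mul 2)]
          exact integral_add (j1.sub (j2.const_mul 2)) j3
      _ = _ := by
          rw [← integral_const_mul, ← integral_sub k1 (k2.const_mul 2)]
          refine (integral_add (k1.sub (k2.const_mul 2)) k3).symm.trans ?_
          congr 1; ext x; simp only [Pi.sub_apply]; ring
  simp_rw [each]
  rw [← integral_finsetSum, ← integral_const_mul]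
  · refine integral_congr_ae ?_
    filter_upwards [numOp_uStat hw hD] with x hx
    have e1 : ∑ i, condAvg μ (Finset.univ.erase i) (fun x ↦ W x ^ 2) x
        = Fintype.card ι * W x ^ 2 - numOp μ (fun x ↦ W x ^ 2) x := by
      simp [numOp, Finset.sum_sub_distrib]
    have e2 : ∑ i, condAvg μ (Finset.univ.erase i) W x
        = Fintype.card ι * W x - d * W x := by
      rw [← hx]
      simp [numOp, Finset.sum_sub_distrib, hW]
    rw [← Finset.mul_sum, Finset.sum_add_distrib, Finset.sum_sub_distrib, ← Finset.mul_sum,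
      ← Finset.mul_sum, e1, e2, carre]
    simp only [Finset.sum_const, Finset.card_univ, nsmul_eq_mul]
    field_simp
    ring
  · intro i _
    exact bi (((integrable_condAvg _ W2i).sub ((integrable_mul_of_memLp_two W2
      (memLp_condAvg _ (by norm_num) mW W2)).const_mul 2)).add W2i)

/-- The fourth moments of the increments, `∑_i E[(W^{(i)} - W)⁴] = 4d (3 E[W² Γ(W)] - E[W⁴])`. -/
lemma sum_integral_increment_pow_four (hw : IsCanonicalFamily μ w) (hd : 1 ≤ d)
    (hD : ∀ J ∈ D, J.card = d) :
    ∑ i, ∫ p, increment D w i p ^ 4 ∂((Measure.pi μ).prod (Measure.pi μ))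
      = 12 * d * ∫ x, uStat D w x ^ 2 * carre μ d D w x ∂(Measure.pi μ)
        - 4 * d * ∫ x, uStat D w x ^ 4 ∂(Measure.pi μ) := by
  have hd0 : (d : ℝ) ≠ 0 := by
    have : (1 : ℝ) ≤ d := by exact_mod_cast hd
    positivity
  set W := uStat D w with hW
  have mW : Measurable W := measurable_uStat hw
  have W2 : MemLp W 2 (Measure.pi μ) := memLp_uStat_two hw
  have W22 : MemLp (fun x ↦ W x ^ 2) 2 (Measure.pi μ) := memLp_uStat_sq hw
  have W4i : Integrable (fun x ↦ W x ^ 4) (Measure.pi μ) :=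
    W22.integrable_sq.congr (Eventually.of_forall fun x ↦ by simp only; ring)
  set M4 := ∫ x, W x ^ 4 ∂(Measure.pi μ) with hM4
  have each : ∀ i : ι, ∫ p, increment D w i p ^ 4 ∂((Measure.pi μ).prod (Measure.pi μ))
      = 2 * M4 - 8 * ∫ x, W x ^ 3 * condAvg μ (Finset.univ.erase i) W x ∂(Measure.pi μ)
        + 6 * ∫ x, W x ^ 2 * condAvg μ (Finset.univ.erase i) (fun x ↦ W x ^ 2) x
          ∂(Measure.pi μ) := by
    intro i
    set K := Finset.univ.erase i
    set ν := (Measure.pi μ).prod (Measure.pi μ)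
    set a : (∀ i, E i) × (∀ i, E i) → ℝ := fun p ↦ W p.1 with ha
    set b : (∀ i, E i) × (∀ i, E i) → ℝ := fun p ↦ W (K.piecewise p.1 p.2) with hb
    have a4 : MemLp a 4 ν := memLp_uStat_fst hw
    have b4 : MemLp b 4 ν := memLp_uStat_piecewise hw K
    have aa := memLp_mul_of_memLp_four a4 a4
    have ab := memLp_mul_of_memLp_four a4 b4
    have bb := memLp_mul_of_memLp_four b4 b4
    have i1 : Integrable (fun p ↦ b p ^ 4) ν := (integrable_mul_of_memLp_two bb bb).congr
      (Eventually.of_forall fun p ↦ by simp only; ring)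
    have i2 : Integrable (fun p ↦ a p * b p ^ 3) ν := (integrable_mul_of_memLp_two ab bb).congr
      (Eventually.of_forall fun p ↦ by simp only; ring)
    have i3 : Integrable (fun p ↦ a p ^ 2 * b p ^ 2) ν := (integrable_mul_of_memLp_two aa bb).congr
      (Eventually.of_forall fun p ↦ by simp only; ring)
    have i4 : Integrable (fun p ↦ a p ^ 3 * b p) ν := (integrable_mul_of_memLp_two aa ab).congr
      (Eventually.of_forall fun p ↦ by simp only; ring)
    have i5 : Integrable (fun p ↦ a p ^ 4) ν := (integrable_mul_of_memLp_two aa aa).congr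
      (Eventually.of_forall fun p ↦ by simp only; ring)
    have e1 : ∫ p, b p ^ 4 ∂ν = M4 := integral_piecewise_prod K (mW.pow_const 4)
    have e5 : ∫ p, a p ^ 4 ∂ν = M4 := by
      rw [integral_prod _ i5]; simp [ha, hM4]
    have e4 : ∫ p, a p ^ 3 * b p ∂ν = ∫ x, W x ^ 3 * condAvg μ K W x ∂(Measure.pi μ) :=
      integral_fst_mul_piecewise K (F := fun x ↦ W x ^ 3) (G := W) i4
    have e3 : ∫ p, a p ^ 2 * b p ^ 2 ∂ν
        = ∫ x, W x ^ 2 * condAvg μ K (fun x ↦ W x ^ 2) x ∂(Measure.pi μ) :=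
      integral_fst_mul_piecewise K (F := fun x ↦ W x ^ 2) (G := fun x ↦ W x ^ 2) i3
    have e2 : ∫ p, a p * b p ^ 3 ∂ν = ∫ p, a p ^ 3 * b p ∂ν :=
      integral_fst_mul_piecewise_comm K (F := W) (G := fun x ↦ W x ^ 3) mW (mW.pow_const 3) i2 i4
    calc _ = ∫ p, (b p ^ 4 + a p ^ 4 - 4 * (a p * b p ^ 3 + a p ^ 3 * b p)
          + 6 * (a p ^ 2 * b p ^ 2)) ∂ν := by
          congr 1; ext p; simp only [increment, ha, hb]; ring
      _ = (∫ p, b p ^ 4 ∂ν + ∫ p, a p ^ 4 ∂ν)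
          - 4 * (∫ p, a p * b p ^ 3 ∂ν + ∫ p, a p ^ 3 * b p ∂ν)
          + 6 * ∫ p, a p ^ 2 * b p ^ 2 ∂ν := by
          have s1 : Integrable (fun p ↦ b p ^ 4 + a p ^ 4) ν := i1.add i5
          have s2 : Integrable (fun p ↦ a p * b p ^ 3 + a p ^ 3 * b p) ν := i2.add i4
          have s3 : Integrable (fun p ↦ b p ^ 4 + a p ^ 4
            - 4 * (a p * b p ^ 3 + a p ^ 3 * b p)) ν := s1.sub (s2.const_mul 4)
          rw [integral_add s3 (i3.const_mul 6), integral_sub s1 (s2.const_mul 4),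
            integral_const_mul, integral_const_mul, integral_add i1 i5, integral_add i2 i4]
      _ = _ := by rw [e1, e5, e2, e4, e3]; ring
  have W3i : ∀ G : (∀ i, E i) → ℝ, MemLp G 4 (Measure.pi μ) →
      Integrable (fun x ↦ W x ^ 3 * G x) (Measure.pi μ) := fun G hG ↦
    (integrable_mul_of_memLp_two W22 (memLp_mul_of_memLp_four (memLp_uStat hw) hG)).congr
      (Eventually.of_forall fun x ↦ by simp only [hW]; ring)
  have hR4 : ∀ i : ι, MemLp (condAvg μ (Finset.univ.erase i) W) 4 (Measure.pi μ) := fun i ↦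
    memLp_condAvg _ (by norm_num) mW (memLp_uStat hw)
  have hR22 : ∀ i : ι, MemLp (condAvg μ (Finset.univ.erase i) fun x ↦ W x ^ 2) 2 (Measure.pi μ) :=
    fun i ↦ memLp_condAvg _ (by norm_num) (mW.pow_const 2) W22
  have s1 : ∑ i, ∫ x, W x ^ 3 * condAvg μ (Finset.univ.erase i) W x ∂(Measure.pi μ)
      = Fintype.card ι * M4 - d * M4 := by
    rw [← integral_finsetSum _ fun i _ ↦ W3i _ (hR4 i), ← sub_mul, hM4, ← integral_const_mul]
    refine integral_congr_ae ?_
    filter_upwards [numOp_uStat hw hD] with x hx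
    have e2 : ∑ i, condAvg μ (Finset.univ.erase i) W x
        = Fintype.card ι * W x - d * W x := by
      rw [← hx]
      simp [numOp, Finset.sum_sub_distrib, hW]
    rw [← Finset.mul_sum, e2]
    ring
  have s2 : ∑ i, ∫ x, W x ^ 2 * condAvg μ (Finset.univ.erase i) (fun x ↦ W x ^ 2) x
        ∂(Measure.pi μ)
      = Fintype.card ι * M4 - 2 * d * M4 + 2 * d * ∫ x, W x ^ 2 * carre μ d D w x
        ∂(Measure.pi μ) := by
    have iS := integrable_mul_of_memLp_two W22 (memLp_carre (d := d) (D := D) hw)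
    rw [← integral_finsetSum _ fun i _ ↦ integrable_mul_of_memLp_two W22 (hR22 i), ← sub_mul, hM4,
      ← integral_const_mul, ← integral_const_mul,
      ← integral_add (W4i.const_mul _) (iS.const_mul _)]
    refine integral_congr_ae (Eventually.of_forall fun x ↦ ?_)
    have e1 : ∑ i, condAvg μ (Finset.univ.erase i) (fun x ↦ W x ^ 2) x
        = Fintype.card ι * W x ^ 2 - numOp μ (fun x ↦ W x ^ 2) x := by
      simp [numOp, Finset.sum_sub_distrib]
    simp only [← Finset.mul_sum, e1, carre]
    field_simp
    ring
  simp_rw [each]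
  rw [Finset.sum_add_distrib, Finset.sum_sub_distrib, ← Finset.mul_sum, ← Finset.mul_sum, ← Finset.mul_sum,
    s1, s2]
  simp only [Finset.sum_const, Finset.card_univ, nsmul_eq_mul]
  ring

end Resampling

/-! ### Stein's method for degenerate `U`-statistics on a product space -/

section SteinBound

set_option linter.unusedSectionVars false

variable {ι : Type*} [Fintype ι] [DecidableEq ι] {E : ι → Type*} [∀ i, MeasurableSpace (E i)]
  {μ : ∀ i, Measure (E i)} [∀ i, IsProbabilityMeasure (μ i)]
  {w : Finset ι → (∀ i, E i) → ℝ} {D : Finset (Finset ι)} {d : ℕ}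

lemma integrable_abs_pow_three {α : Type*} [MeasurableSpace α] {ν : Measure α} {f : α → ℝ}
    (hf : MemLp f 2 ν) (hf2 : MemLp (fun x ↦ f x ^ 2) 2 ν) :
    Integrable (fun x ↦ |f x| ^ 3) ν := by
  have ha : MemLp (fun x ↦ |f x|) 2 ν := hf.abs
  exact (integrable_mul_of_memLp_two ha hf2).congr (Eventually.of_forall fun x ↦ by
    simp only [← sq_abs (f x)]; ring)

lemma integral_abs_pow_three_le {α : Type*} [MeasurableSpace α] {ν : Measure α} {f : α → ℝ}
    (hf : MemLp f 2 ν) (hf2 : MemLp (fun x ↦ f x ^ 2) 2 ν) :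
    ∫ x, |f x| ^ 3 ∂ν ≤ √(∫ x, f x ^ 2 ∂ν) * √(∫ x, f x ^ 4 ∂ν) := by
  have ha : MemLp (fun x ↦ |f x|) 2 ν := hf.abs
  have h := sq_integral_mul_le ha hf2
  have e1 : ∫ x, |f x| * f x ^ 2 ∂ν = ∫ x, |f x| ^ 3 ∂ν := by
    congr 1; ext x; rw [← sq_abs (f x)]; ring
  have e2 : ∫ x, |f x| ^ 2 ∂ν = ∫ x, f x ^ 2 ∂ν := by simp_rw [sq_abs]
  have e3 : ∫ x, (f x ^ 2) ^ 2 ∂ν = ∫ x, f x ^ 4 ∂ν := by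
    congr 1; ext x; ring
  rw [e1, e2, e3] at h
  rw [← Real.sqrt_mul (integral_nonneg fun x ↦ sq_nonneg _)]
  exact Real.le_sqrt_of_sq_le h

lemma memLp_increment_sq (hw : IsCanonicalFamily μ w) (i : ι) :
    MemLp (fun p ↦ increment D w i p ^ 2) 2 ((Measure.pi μ).prod (Measure.pi μ)) := by
  simp_rw [pow_two]
  exact memLp_mul_of_memLp_four (memLp_increment hw i) (memLp_increment hw i)

/-- Expanding `E[F(W^{(i)}) - F(W)] = 0` to second order, where `F' = f`, and summing over `i`,
shows that `E[W f(W)]` and `E[f'(W) Γ(W)]` differ by a third-order remainder. -/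
lemma abs_stein_remainder_le (hw : IsCanonicalFamily μ w) (hd : 1 ≤ d)
    (hD : ∀ J ∈ D, J.card = d) {f f' : ℝ → ℝ} (hf : ∀ x, HasDerivAt f (f' x) x)
    (hb : ∀ x, |f x| ≤ 2) {C : ℝ} (hb' : ∀ x, |f' x| ≤ C) (hl : LipschitzWith 2 f') :
    |∫ x, f' (uStat D w x) * carre μ d D w x ∂(Measure.pi μ)
        - ∫ x, uStat D w x * f (uStat D w x) ∂(Measure.pi μ)|
      ≤ (∑ i, ∫ p, |increment D w i p| ^ 3 ∂((Measure.pi μ).prod (Measure.pi μ))) / (3 * d) := by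
  have hd0 : (0 : ℝ) < d := by exact_mod_cast hd
  have hfc : Continuous f := continuous_iff_continuousAt.2 fun x ↦ (hf x).continuousAt
  have hf'c : Continuous f' := hl.continuous
  set F : ℝ → ℝ := fun x ↦ ∫ t in (0)..x, f t with hF
  have hFd : ∀ x, HasDerivAt F (f x) x := fun x ↦
    intervalIntegral.integral_hasDerivAt_right (hfc.intervalIntegrable _ _)
      hfc.aestronglyMeasurable.stronglyMeasurableAtFilter hfc.continuousAt
  have hFc : Continuous F := continuous_iff_continuousAt.2 fun x ↦ (hFd x).continuousAt
  have hFb : ∀ x, |F x| ≤ 2 * |x| := fun x ↦ by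
    have := intervalIntegral.norm_integral_le_of_norm_le_const (a := 0) (b := x) (C := 2) (f := f)
      fun t _ ↦ hb t
    simpa using this
  set W := uStat D w with hW
  have mW : Measurable W := measurable_uStat hw
  have W2 : MemLp W 2 (Measure.pi μ) := memLp_uStat_two hw
  have W1 : Integrable W (Measure.pi μ) := W2.integrable (by norm_num)
  set ν := (Measure.pi μ).prod (Measure.pi μ) with hν
  have FWi : Integrable (fun x ↦ F (W x)) (Measure.pi μ) :=
    (W1.abs.const_mul 2).mono' (hFc.measurable.comp mW).aestronglyMeasurable
      (Eventually.of_forall fun x ↦ hFb _)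
  have mfW : Measurable fun x ↦ f (W x) := hfc.measurable.comp mW
  have mf'W : Measurable fun x ↦ f' (W x) := hf'c.measurable.comp mW
  have bi2 : ∀ {H : ℝ → ℝ} {c : ℝ}, Measurable (fun x ↦ H (W x)) → (∀ x, |H x| ≤ c) →
      ∀ {G : (∀ i, E i) × (∀ i, E i) → ℝ}, Integrable G ν →
      Integrable (fun p : (∀ i, E i) × (∀ i, E i) ↦ H (W p.1) * G p) ν := fun mH hc _ hG ↦
    hG.bdd_mul (mH.comp measurable_fst).aestronglyMeasurable
      (Eventually.of_forall fun p ↦ hc (W p.1))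
  have Δ1 : ∀ i, Integrable (increment D w i) ν := fun i ↦
    (memLp_increment hw i).integrable (by norm_num)
  have Δ2 : ∀ i, MemLp (increment D w i) 2 ν := fun i ↦
    (memLp_increment hw i).mono_exponent (by norm_num)
  have Δ22 : ∀ i, MemLp (fun p ↦ increment D w i p ^ 2) 2 ν := fun i ↦ memLp_increment_sq hw i
  have Δ2i : ∀ i, Integrable (fun p ↦ increment D w i p ^ 2) ν := fun i ↦
    (Δ2 i).integrable_sq
  have Δ3 : ∀ i, Integrable (fun p ↦ |increment D w i p| ^ 3) ν := fun i ↦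
    integrable_abs_pow_three (Δ2 i) (Δ22 i)
  have first : ∑ i, ∫ p, f (W p.1) * increment D w i p ∂ν
      = -(d * ∫ x, W x * f (W x) ∂(Measure.pi μ)) := by
    have each : ∀ i, ∫ p, f (W p.1) * increment D w i p ∂ν
        = ∫ x, f (W x) * (condAvg μ (Finset.univ.erase i) W x - W x) ∂(Measure.pi μ) := by
      intro i
      set K := Finset.univ.erase i
      have a1 : Integrable (fun p : (∀ i, E i) × (∀ i, E i) ↦ W p.1) ν := W1.comp_fst _
      have b1 : Integrable (fun p : (∀ i, E i) × (∀ i, E i) ↦ W (K.piecewise p.1 p.2)) ν :=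
        integrable_piecewise_prod K W1
      have j1 := bi2 mfW hb a1
      have j2 := bi2 mfW hb b1
      have e2 := integral_fst_mul_piecewise K (F := fun x ↦ f (W x)) (G := W) j2
      have e3 : ∫ p : (∀ i, E i) × (∀ i, E i), f (W p.1) * W p.1 ∂ν
          = ∫ x, f (W x) * W x ∂(Measure.pi μ) := by
        rw [integral_prod _ j1]; simp
      have k1 : Integrable (fun x ↦ f (W x) * condAvg μ K W x) (Measure.pi μ) :=
        (integrable_condAvg K W1).bdd_mul mfW.aestronglyMeasurable
          (Eventually.of_forall fun x ↦ hb _)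
      have k2 : Integrable (fun x ↦ f (W x) * W x) (Measure.pi μ) :=
        W1.bdd_mul mfW.aestronglyMeasurable (Eventually.of_forall fun x ↦ hb _)
      simp only [increment, mul_sub]
      rw [integral_sub k1 k2, ← e2, ← e3]
      exact integral_sub j2 j1
    simp_rw [each]
    rw [← integral_finsetSum, ← integral_const_mul, ← integral_neg]
    · refine integral_congr_ae ?_
      filter_upwards [numOp_uStat hw hD] with x hx
      have e2 : ∑ i, (condAvg μ (Finset.univ.erase i) W x - W x) = -(d * W x) := by
        rw [← hx, numOp, ← Finset.sum_neg_distrib]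
        exact Finset.sum_congr rfl fun i _ ↦ by simp only [hW]; ring
      rw [← Finset.mul_sum, e2]
      ring
    · intro i _
      exact ((integrable_condAvg _ W1).sub W1).bdd_mul mfW.aestronglyMeasurable
        (Eventually.of_forall fun x ↦ hb _)
  have second := sum_integral_mul_increment_sq hw hd hD mf'W (fun x ↦ hb' (W x))
  have hzero : ∀ i : ι, ∫ p : (∀ i, E i) × (∀ i, E i),
      (F (W ((Finset.univ.erase i).piecewise p.1 p.2)) - F (W p.1)) ∂ν = 0 := fun i ↦ by
    rw [integral_sub (integrable_piecewise_prod _ FWi) (FWi.comp_fst _),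
      integral_piecewise_prod (Finset.univ.erase i) (F := fun x ↦ F (W x))
        (hFc.measurable.comp mW),
      integral_prod _ (FWi.comp_fst _)]
    simp
  have hrem : ∀ i : ι, |∫ p, f (W p.1) * increment D w i p ∂ν
      + (∫ p, f' (W p.1) * increment D w i p ^ 2 ∂ν) / 2|
      ≤ (∫ p, |increment D w i p| ^ 3 ∂ν) / 3 := fun i ↦ by
    have j1 := bi2 mfW hb (Δ1 i)
    have j2 := bi2 mf'W hb' (Δ2i i)
    have j3 : Integrable (fun p : (∀ i, E i) × (∀ i, E i) ↦
        F (W ((Finset.univ.erase i).piecewise p.1 p.2)) - F (W p.1)) ν :=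
      (integrable_piecewise_prod _ FWi).sub (FWi.comp_fst _)
    have e : ∫ p, f (W p.1) * increment D w i p ∂ν
      + (∫ p, f' (W p.1) * increment D w i p ^ 2 ∂ν) / 2
      = -∫ p : (∀ i, E i) × (∀ i, E i),
        (F (W ((Finset.univ.erase i).piecewise p.1 p.2)) - F (W p.1)
        - f (W p.1) * increment D w i p - f' (W p.1) * increment D w i p ^ 2 / 2) ∂ν := by
      have j4 : Integrable (fun p : (∀ i, E i) × (∀ i, E i) ↦
        F (W ((Finset.univ.erase i).piecewise p.1 p.2)) - F (W p.1)
          - f (W p.1) * increment D w i p) ν := j3.sub j1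
      rw [integral_sub j4 (j2.div_const 2), integral_sub j3 j1, hzero, integral_div]
      ring
    rw [e, abs_neg, ← integral_div, ← Real.norm_eq_abs]
    refine norm_integral_le_of_norm_le ((Δ3 i).div_const 3) (Eventually.of_forall fun p ↦ ?_)
    rw [Real.norm_eq_abs]
    exact abs_taylor_le hFd hf hl (W p.1) (W ((Finset.univ.erase i).piecewise p.1 p.2))
  have hsum : |∑ i, (∫ p, f (W p.1) * increment D w i p ∂ν
      + (∫ p, f' (W p.1) * increment D w i p ^ 2 ∂ν) / 2)|
      ≤ (∑ i, ∫ p, |increment D w i p| ^ 3 ∂ν) / 3 := by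
    rw [Finset.sum_div]
    exact (Finset.abs_sum_le_sum_abs _ _).trans (Finset.sum_le_sum fun i _ ↦ hrem i)
  rw [Finset.sum_add_distrib, ← Finset.sum_div, first, second] at hsum
  have e : -(d * ∫ x, W x * f (W x) ∂(Measure.pi μ))
      + 2 * d * (∫ x, f' (W x) * carre μ d D w x ∂(Measure.pi μ)) / 2
      = d * (∫ x, f' (W x) * carre μ d D w x ∂(Measure.pi μ)
        - ∫ x, W x * f (W x) ∂(Measure.pi μ)) := by ring
  rw [e, abs_mul, abs_of_pos hd0] at hsum
  rw [le_div_iff₀ (by positivity)]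
  rw [le_div_iff₀ (by norm_num)] at hsum
  linarith

/-- The bound for smooth test functions, before the numerical simplification. -/
lemma abs_integral_smooth_sub_le (hw : IsCanonicalFamily μ w) (hd : 1 ≤ d)
    (hD : ∀ J ∈ D, J.card = d) (h1 : ∑ J ∈ D, sqNorm μ w J = 1)
    {h h' h'' : ℝ → ℝ} {C : ℝ} (hh : ∀ x, HasDerivAt h (h' x) x)
    (hh' : ∀ x, HasDerivAt h' (h'' x) x) (hc : Continuous h'') (hh1 : ∀ x, |h' x| ≤ 1)
    (hh2 : ∀ x, |h'' x| ≤ C) :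
    |∫ x, h (uStat D w x) ∂(Measure.pi μ) - ∫ z, h z ∂(gaussianReal 0 1)|
      ≤ √(2 / Real.pi) * √(∫ x, (1 - carre μ d D w x) ^ 2 ∂(Measure.pi μ))
        + √2 / 3 * √(12 * ∫ x, uStat D w x ^ 2 * carre μ d D w x ∂(Measure.pi μ)
          - 4 * ∫ x, uStat D w x ^ 4 ∂(Measure.pi μ)) := by
  obtain ⟨f, f', hf, hs, hb, hb', hl⟩ := exists_stein_solution hh hh' hc hh1 hh2
  have hd0 : (0 : ℝ) < d := by exact_mod_cast hd
  have hrem := abs_stein_remainder_le hw hd hD hf hb hb' hl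
  have hfc : Continuous f := continuous_iff_continuousAt.2 fun x ↦ (hf x).continuousAt
  have hf'c : Continuous f' := hl.continuous
  set W := uStat D w with hW
  set S := carre μ d D w with hS
  have mW : Measurable W := measurable_uStat hw
  have W2 : MemLp W 2 (Measure.pi μ) := memLp_uStat_two hw
  have W1 : Integrable W (Measure.pi μ) := W2.integrable (by norm_num)
  have S2 : MemLp S 2 (Measure.pi μ) := memLp_carre hw
  have S1 : Integrable S (Measure.pi μ) := S2.integrable (by norm_num)
  have T2 : MemLp (fun x ↦ 1 - S x) 2 (Measure.pi μ) := (memLp_const 1).sub S2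
  have T1 := T2.integrable (by norm_num)
  have mf'W : AEStronglyMeasurable (fun x ↦ f' (W x)) (Measure.pi μ) :=
    (hf'c.measurable.comp mW).aestronglyMeasurable
  have k1 : Integrable (fun x ↦ W x * f (W x)) (Measure.pi μ) :=
    W1.mul_bdd (hfc.measurable.comp mW).aestronglyMeasurable (Eventually.of_forall fun x ↦ hb _)
  have k2 : Integrable (fun x ↦ f' (W x) * S x) (Measure.pi μ) :=
    S1.bdd_mul mf'W (Eventually.of_forall fun x ↦ hb' _)
  have k3 : Integrable (fun x ↦ f' (W x)) (Measure.pi μ) :=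
    Integrable.of_bound mf'W _ (Eventually.of_forall fun x ↦ hb' _)
  have k4 : Integrable (fun x ↦ f' (W x) * (1 - S x)) (Measure.pi μ) :=
    T1.bdd_mul mf'W (Eventually.of_forall fun x ↦ hb' _)
  have e1 : ∫ x, h (W x) ∂(Measure.pi μ) - ∫ z, h z ∂(gaussianReal 0 1)
      = ∫ x, f' (W x) * (1 - S x) ∂(Measure.pi μ) + (∫ x, f' (W x) * S x ∂(Measure.pi μ)
        - ∫ x, W x * f (W x) ∂(Measure.pi μ)) := by
    have e : ∀ x, h (W x) = f' (W x) - W x * f (W x) + ∫ z, h z ∂(gaussianReal 0 1) :=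
      fun x ↦ by rw [hs]; ring
    have k5 : Integrable (fun x ↦ f' (W x) - W x * f (W x)) (Measure.pi μ) := k3.sub k1
    simp_rw [e]
    rw [integral_add k5 (integrable_const _), integral_sub k3 k1]
    simp_rw [mul_sub, mul_one]
    rw [integral_sub k3 k2]
    simp
  have e2 : |∫ x, f' (W x) * (1 - S x) ∂(Measure.pi μ)|
      ≤ √(2 / Real.pi) * √(∫ x, (1 - S x) ^ 2 ∂(Measure.pi μ)) := by
    have a1 : |∫ x, f' (W x) * (1 - S x) ∂(Measure.pi μ)|
        ≤ ∫ x, √(2 / Real.pi) * |1 - S x| ∂(Measure.pi μ) := by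
      rw [← Real.norm_eq_abs]
      refine norm_integral_le_of_norm_le (T1.abs.const_mul _) (Eventually.of_forall fun x ↦ ?_)
      rw [norm_mul, Real.norm_eq_abs, Real.norm_eq_abs]
      exact mul_le_mul_of_nonneg_right (hb' _) (abs_nonneg _)
    rw [integral_const_mul] at a1
    refine a1.trans (mul_le_mul_of_nonneg_left ?_ (Real.sqrt_nonneg _))
    have T2a : MemLp (fun x ↦ |1 - S x|) 2 (Measure.pi μ) := T2.abs
    have a2 := sq_integral_mul_le T2a (memLp_const (1 : ℝ))
    simp only [mul_one, one_pow, integral_const, probReal_univ, smul_eq_mul, sq_abs] at a2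
    exact Real.le_sqrt_of_sq_le a2
  have e3 : ∑ i, ∫ p, |increment D w i p| ^ 3 ∂((Measure.pi μ).prod (Measure.pi μ))
      ≤ √2 * d * √(12 * ∫ x, W x ^ 2 * S x ∂(Measure.pi μ) - 4 * ∫ x, W x ^ 4 ∂(Measure.pi μ)) := by
    have b1 := sum_integral_mul_increment_sq hw hd hD (F := fun _ ↦ 1) measurable_const (C := 1)
      (fun x ↦ by simp)
    have b2 := sum_integral_increment_pow_four hw hd hD
    have b3 : ∫ x, S x ∂(Measure.pi μ) = 1 := by
      have W22 := memLp_uStat_sq (D := D) hw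
      have W21 := W22.integrable (by norm_num)
      have n1 : Integrable (fun x ↦ numOp μ (fun x ↦ W x ^ 2) x / (2 * d)) (Measure.pi μ) :=
        ((memLp_numOp (mW.pow_const 2) W22).integrable (by norm_num)).div_const _
      simp only [hS, carre]
      rw [integral_sub W21 n1, integral_div, integral_numOp (mW.pow_const 2) W21,
        integral_uStat_sq hw, h1]
      simp
    simp only [one_mul] at b1
    rw [b3, mul_one] at b1
    calc _ ≤ ∑ i, √(∫ p, increment D w i p ^ 2 ∂((Measure.pi μ).prod (Measure.pi μ)))
          * √(∫ p, increment D w i p ^ 4 ∂((Measure.pi μ).prod (Measure.pi μ))) :=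
          Finset.sum_le_sum fun i _ ↦ integral_abs_pow_three_le
            ((memLp_increment hw i).mono_exponent (by norm_num)) (memLp_increment_sq hw i)
      _ ≤ √(∑ i, ∫ p, increment D w i p ^ 2 ∂((Measure.pi μ).prod (Measure.pi μ)))
          * √(∑ i, ∫ p, increment D w i p ^ 4 ∂((Measure.pi μ).prod (Measure.pi μ))) :=
          Real.sum_sqrt_mul_sqrt_le _ (fun i ↦ integral_nonneg fun p ↦ sq_nonneg _)
            fun i ↦ integral_nonneg fun p ↦ by positivity
      _ = √(2 * d) * √(d * (12 * ∫ x, W x ^ 2 * S x ∂(Measure.pi μ)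
          - 4 * ∫ x, W x ^ 4 ∂(Measure.pi μ))) := by
          rw [b1, b2]; congr 2; ring
      _ = _ := by
          rw [Real.sqrt_mul (by norm_num), Real.sqrt_mul hd0.le]
          linear_combination √2 * √(12 * ∫ x, W x ^ 2 * S x ∂(Measure.pi μ)
            - 4 * ∫ x, W x ^ 4 ∂(Measure.pi μ)) * Real.mul_self_sqrt hd0.le
  rw [e1]
  refine (abs_add_le _ _).trans (add_le_add e2 (hrem.trans ?_))
  rw [div_le_iff₀ (by positivity)]
  refine e3.trans (le_of_eq ?_)
  ring

lemma abs_integral_comp_sub_le {α : Type*} [MeasurableSpace α] {ν : Measure α}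
    [IsProbabilityMeasure ν] {X : α → ℝ} (hX : Integrable X ν) {h g : ℝ → ℝ}
    (hh : LipschitzWith 1 h) (hg : Continuous g) {ε : ℝ} (hgh : ∀ x, |g x - h x| ≤ ε) :
    |∫ x, h (X x) ∂ν - ∫ x, g (X x) ∂ν| ≤ ε := by
  have ih : Integrable (fun x ↦ h (X x)) ν := by
    refine ((integrable_const |h 0|).add hX.abs).mono'
      (hh.continuous.comp_aestronglyMeasurable hX.aestronglyMeasurable)
      (Eventually.of_forall fun x ↦ ?_)
    have := hh.dist_le_mul (X x) 0
    simp only [Real.dist_eq, NNReal.coe_one, one_mul, sub_zero] at this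
    have := abs_sub_abs_le_abs_sub (h (X x)) (h 0)
    simp only [Real.norm_eq_abs, Pi.add_apply]
    linarith
  have ig : Integrable (fun x ↦ g (X x)) ν := by
    refine (ih.abs.add (integrable_const ε)).mono'
      (hg.comp_aestronglyMeasurable hX.aestronglyMeasurable)
      (Eventually.of_forall fun x ↦ ?_)
    have := abs_sub_abs_le_abs_sub (g (X x)) (h (X x))
    have := hgh (X x)
    simp only [Real.norm_eq_abs, Pi.add_apply]
    linarith
  rw [← integral_sub ih ig]
  have := norm_integral_le_of_norm_le_const (μ := ν) (C := ε)
    (f := fun x ↦ h (X x) - g (X x)) (Eventually.of_forall fun x ↦ by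
      rw [Real.norm_eq_abs, abs_sub_comm]
      exact hgh (X x))
  simpa using this

/-- The bound for all `1`-Lipschitz test functions. -/
lemma abs_integral_lipschitz_sub_le (hw : IsCanonicalFamily μ w) (hd : 1 ≤ d)
    (hD : ∀ J ∈ D, J.card = d) (h1 : ∑ J ∈ D, sqNorm μ w J = 1) {ρ : ℝ} (hρ0 : 0 ≤ ρ)
    (hρ : ∀ i, ∑ K ∈ D with i ∈ K, sqNorm μ w K ≤ ρ) {h : ℝ → ℝ} (hh : LipschitzWith 1 h) :
    |∫ x, h (uStat D w x) ∂(Measure.pi μ) - ∫ z, h z ∂(gaussianReal 0 1)|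
      ≤ (√(2 / Real.pi) + 4 / 3) * √|∫ x, uStat D w x ^ 4 ∂(Measure.pi μ) - 3|
        + √((4 ^ d + 1) * d * ρ) * (√(2 / Real.pi) + 2 * √2 / √3) := by
  obtain ⟨v1, v2⟩ := carre_bounds hw hd hD h1 hρ
  set δ := ∫ x, uStat D w x ^ 4 ∂(Measure.pi μ) - 3 with hδ
  set κ : ℝ := (4 ^ d + 1) * d * ρ with hκ
  have hκ0 : 0 ≤ κ := by positivity
  have sqrt_add : ∀ {a b : ℝ}, 0 ≤ a → 0 ≤ b → √(a + b) ≤ √a + √b := by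
    intro a b ha hb
    refine Real.sqrt_le_iff.2 ⟨by positivity, ?_⟩
    rw [add_sq, Real.sq_sqrt ha, Real.sq_sqrt hb]
    have : 0 ≤ 2 * √a * √b := by positivity
    linarith
  have c1 : √(∫ x, (1 - carre μ d D w x) ^ 2 ∂(Measure.pi μ)) ≤ √|δ| + √κ := by
    refine (Real.sqrt_le_sqrt ?_).trans (sqrt_add (abs_nonneg δ) hκ0)
    linarith [le_abs_self δ]
  have c2 : √2 / 3 * √(12 * ∫ x, uStat D w x ^ 2 * carre μ d D w x ∂(Measure.pi μ)
          - 4 * ∫ x, uStat D w x ^ 4 ∂(Measure.pi μ)) ≤ 4 / 3 * √|δ| + 2 * √2 / √3 * √κ := by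
    have a1 : √(12 * ∫ x, uStat D w x ^ 2 * carre μ d D w x ∂(Measure.pi μ)
          - 4 * ∫ x, uStat D w x ^ 4 ∂(Measure.pi μ)) ≤ √(8 * |δ|) + √(12 * κ) := by
      refine (Real.sqrt_le_sqrt ?_).trans (sqrt_add (by positivity) (by positivity))
      linarith [le_abs_self δ]
    refine (mul_le_mul_of_nonneg_left a1 (by positivity)).trans (le_of_eq ?_)
    have s2 : √2 * √2 = 2 := Real.mul_self_sqrt (by norm_num)
    have s3 : √3 * √3 = 3 := Real.mul_self_sqrt (by norm_num)
    have s3' : √3 ≠ 0 := by positivity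
    have e8 : √(8 * |δ|) = 2 * √2 * √|δ| := by
      rw [show 8 * |δ| = (2 * √2) ^ 2 * |δ| by rw [mul_pow, pow_two (√2), s2]; norm_num,
        Real.sqrt_mul (by positivity), Real.sqrt_sq (by positivity)]
    have e12 : √(12 * κ) = 2 * √3 * √κ := by
      rw [show 12 * κ = (2 * √3) ^ 2 * κ by rw [mul_pow, pow_two (√3), s3]; norm_num,
        Real.sqrt_mul (by positivity), Real.sqrt_sq (by positivity)]
    rw [e8, e12]
    field_simp
    linear_combination 2 * √3 * √|δ| * s2 + 2 * √2 * √κ * s3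
  have smooth : ∀ ε : ℝ, 0 < ε →
      |∫ x, h (uStat D w x) ∂(Measure.pi μ) - ∫ z, h z ∂(gaussianReal 0 1)|
      ≤ (√(2 / Real.pi) + 4 / 3) * √|δ| + √κ * (√(2 / Real.pi) + 2 * √2 / √3) + ε := by
    intro ε hε
    obtain ⟨g, g', g'', C, hg, hg', hgc, hg1, hg2, hgh⟩ :=
      exists_smooth_approx hh (ε := ε / 4) (by positivity)
    have main := abs_integral_smooth_sub_le hw hd hD h1 hg hg' hgc hg1 hg2
    have hgc' : Continuous g := continuous_iff_continuousAt.2 fun x ↦ (hg x).continuousAt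
    have d1 := abs_integral_comp_sub_le ((memLp_uStat (D := D) hw).integrable (by norm_num)) hh hgc' hgh
    have d2 := abs_integral_comp_sub_le integrable_id_gaussianReal hh hgc' hgh
    have p2 := mul_le_mul_of_nonneg_left c1 (Real.sqrt_nonneg (2 / Real.pi))
    rw [abs_le] at d1 d2 main ⊢
    constructor <;> linarith [d1.1, d1.2, d2.1, d2.2, main.1, main.2]
  exact le_of_forall_pos_le_add smooth

end SteinBound

/-! ### From random elements to the product space -/

section Transfer

set_option linter.unusedSectionVars false

variable {n d : ℕ} {Ω : Type*} [MeasurableSpace Ω] {P : Measure Ω} [IsProbabilityMeasure P]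
  {E : Fin n → Type*} [∀ i, MeasurableSpace (E i)] {X : ∀ i, Ω → E i} {W : Ω → ℝ}
  {WJ : Finset (Fin n) → Ω → ℝ}

lemma sigmaAlg_eq_comap (X : ∀ i, Ω → E i) (J : Finset (Fin n)) :
    sigmaAlg X J = MeasurableSpace.comap (fun ω (j : J) ↦ X j ω) MeasurableSpace.pi := by
  rw [sigmaAlg, MeasurableSpace.pi, MeasurableSpace.comap_iSup, iSup_subtype']
  simp_rw [MeasurableSpace.comap_comp]
  rfl

lemma sigmaAlg_eq_comap_coordAlg (X : ∀ i, Ω → E i) (J : Finset (Fin n)) :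
    sigmaAlg X J = MeasurableSpace.comap (fun ω i ↦ X i ω) (coordAlg E J) := by
  rw [sigmaAlg_eq_comap, MeasurableSpace.comap_comp]
  rfl

lemma sigmaAlg_le (hX : ∀ i, Measurable (X i)) (J : Finset (Fin n)) :
    sigmaAlg X J ≤ ‹MeasurableSpace Ω› :=
  iSup₂_le fun j _ ↦ (hX j).comap_le

lemma exists_eq_comp_of_measurable_sigmaAlg {J : Finset (Fin n)} {U : Ω → ℝ}
    (hU : Measurable[sigmaAlg X J] U) :
    ∃ v : (∀ i, E i) → ℝ, Measurable v ∧ DependsOn v (J : Set (Fin n)) ∧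
      ∀ ω, U ω = v fun i ↦ X i ω := by
  rw [sigmaAlg_eq_comap] at hU
  obtain ⟨v, hv, e⟩ := hU.exists_eq_measurable_comp
  refine ⟨fun x ↦ v (J.restrict x), hv.comp (by fun_prop), fun x y hxy ↦ ?_, fun ω ↦ ?_⟩
  · exact congrArg v (funext fun j ↦ hxy j.1 j.2)
  · rw [e]; rfl

/-- A vanishing conditional expectation given `σ(X_j : j ∈ K)` becomes a vanishing average over the
coordinates outside `K`. -/
lemma condAvg_ae_eq_zero_of_condExp (hX : ∀ i, Measurable (X i)) (hi : iIndepFun X P)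
    {K : Finset (Fin n)} {v : (∀ i, E i) → ℝ} (hv : Measurable v)
    (hvi : Integrable (fun ω ↦ v fun i ↦ X i ω) P)
    (h0 : P[fun ω ↦ v fun i ↦ X i ω | sigmaAlg X K] =ᵐ[P] 0) :
    condAvg (fun i ↦ P.map (X i)) K v =ᵐ[Measure.pi fun i ↦ P.map (X i)] 0 := by
  have : ∀ i, IsProbabilityMeasure (P.map (X i)) := fun i ↦
    Measure.isProbabilityMeasure_map (hX i).aemeasurable
  have hXm : Measurable fun ω i ↦ X i ω := measurable_pi_iff.2 hX
  have hlaw := (iIndepFun_iff_map_fun_eq_pi_map fun i ↦ (hX i).aemeasurable).1 hi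
  have hvi' : Integrable v (Measure.pi fun i ↦ P.map (X i)) := by
    rw [← hlaw]
    exact (integrable_map_measure hv.aestronglyMeasurable hXm.aemeasurable).2 hvi
  refine (condAvg_ae_eq_condExp K hv hvi').trans (EventuallyEq.symm ?_)
  refine ae_eq_condExp_of_forall_setIntegral_eq (coordAlg_le K) hvi'
    (fun s _ _ ↦ (integrable_zero _ _ _).integrableOn) (fun s hs _ ↦ ?_)
    aestronglyMeasurable_zero
  have hs' : MeasurableSet[sigmaAlg X K] ((fun ω i ↦ X i ω) ⁻¹' s) := by
    rw [sigmaAlg_eq_comap_coordAlg]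
    exact ⟨s, hs, rfl⟩
  rw [← hlaw, setIntegral_map (coordAlg_le K s hs) hv.aestronglyMeasurable hXm.aemeasurable,
    ← setIntegral_condExp (sigmaAlg_le hX K) hvi hs', integral_congr_ae (ae_restrict_of_ae h0)]
  simp

/-- Given `F_J`, a degenerate `U`-statistic has conditional expectation `W_J` if `|J|` is its order:
all its components other than `W_J` average out. -/
lemma IsDegenerateUStatistic.ae_eq_condExp (h : IsDegenerateUStatistic P d X W WJ)
    {J : Finset (Fin n)} (hJ : J.card = d) : WJ J =ᵐ[P] P[W | sigmaAlg X J] := by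
  have hsum : P[W | sigmaAlg X J] =ᵐ[P] ∑ K, P[WJ K | sigmaAlg X J] := by
    refine (condExp_congr_ae ?_).trans (condExp_finsetSum (fun K _ ↦ h.hoeffding.integrable K) _)
    refine h.hoeffding.sum_eq.trans (Eventually.of_forall fun ω ↦ ?_)
    simp
  have h0 : ∀ᵐ ω ∂P, ∀ K, K ≠ J → P[WJ K | sigmaAlg X J] ω = 0 := by
    refine ae_all_iff.2 fun K ↦ ?_
    by_cases hK : K = J
    · simp [hK]
    · by_cases hKJ : K ⊆ J
      · have hc : K.card ≠ d := fun hc ↦ hK (Finset.eq_of_subset_of_card_le hKJ (by omega))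
        filter_upwards [condExp_congr_ae (m := sigmaAlg X J) (h.eq_zero K hc)] with ω hω _
        rw [hω, condExp_zero]; rfl
      · filter_upwards [h.hoeffding.condExp_eq_zero K J hKJ] with ω hω _ using hω
  have hJJ : P[WJ J | sigmaAlg X J] = WJ J :=
    condExp_of_stronglyMeasurable (sigmaAlg_le h.measurable_data J)
      (h.hoeffding.measurable J).stronglyMeasurable (h.hoeffding.integrable J)
  filter_upwards [hsum, h0] with ω h1 h2
  rw [h1, Finset.sum_apply, Finset.sum_eq_single J (fun K _ hK ↦ h2 K hK) (by simp), hJJ]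

lemma IsDegenerateUStatistic.ae_eq_sum (h : IsDegenerateUStatistic P d X W WJ) :
    W =ᵐ[P] fun ω ↦ ∑ J ∈ Finset.powersetCard d Finset.univ, WJ J ω := by
  have h0 : ∀ᵐ ω ∂P, ∀ J : Finset (Fin n), J.card ≠ d → WJ J ω = 0 := by
    refine ae_all_iff.2 fun J ↦ ?_
    by_cases hJ : J.card = d
    · simp [hJ]
    · filter_upwards [h.eq_zero J hJ] with ω hω _ using hω
  filter_upwards [h.hoeffding.sum_eq, h0] with ω h1 h2
  rw [h1]
  refine (Finset.sum_subset (Finset.subset_univ _) fun J _ hJ ↦ h2 J fun hc ↦ hJ ?_).symm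
  simp [hc]

/-- The Hoeffding components of a degenerate `U`-statistic in `L⁴` are represented by a canonical
family on the product of the laws of the data. -/
lemma IsDegenerateUStatistic.exists_canonicalFamily (h : IsDegenerateUStatistic P d X W WJ)
    (hW : MemLp W 4 P) :
    ∃ w, IsCanonicalFamily (fun i ↦ P.map (X i)) w ∧
      ∀ J, WJ J =ᵐ[P] fun ω ↦ w J fun i ↦ X i ω := by
  have hXm : Measurable fun ω i ↦ X i ω := measurable_pi_iff.2 h.measurable_data
  have hlaw := (iIndepFun_iff_map_fun_eq_pi_map
    fun i ↦ (h.measurable_data i).aemeasurable).1 h.indep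
  have each : ∀ J : Finset (Fin n), ∃ v : (∀ i, E i) → ℝ, Measurable v ∧
      DependsOn v (J : Set (Fin n)) ∧ MemLp v 4 (Measure.pi fun i ↦ P.map (X i)) ∧
      (∀ i ∈ J, condAvg (fun i ↦ P.map (X i)) (Finset.univ.erase i) v
        =ᵐ[Measure.pi fun i ↦ P.map (X i)] 0) ∧
      WJ J =ᵐ[P] fun ω ↦ v fun i ↦ X i ω := by
    intro J
    by_cases hJ : J.card = d
    · obtain ⟨v, hv, hvd, hvX⟩ := exists_eq_comp_of_measurable_sigmaAlg (h.hoeffding.measurable J)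
      have e : WJ J = fun ω ↦ v fun i ↦ X i ω := funext hvX
      have h4 : MemLp (WJ J) 4 P := (memLp_congr_ae (h.ae_eq_condExp hJ)).2
        (hW.condExp (by norm_num))
      refine ⟨v, hv, hvd, ?_, fun i hi ↦ ?_, Eventually.of_forall hvX⟩
      · rw [← hlaw, memLp_map_measure_iff hv.aestronglyMeasurable hXm.aemeasurable]
        rw [e] at h4
        exact h4
      · refine condAvg_ae_eq_zero_of_condExp h.measurable_data h.indep hv
          (e ▸ h.hoeffding.integrable J) ?_
        rw [← e]
        exact h.hoeffding.condExp_eq_zero _ _ fun hs ↦ by simpa using hs hi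
    · refine ⟨0, measurable_zero, fun _ _ _ ↦ rfl, MemLp.zero, fun i _ ↦ ?_, h.eq_zero J hJ⟩
      refine Eventually.of_forall fun x ↦ ?_
      simp [condAvg]
  choose w hw using each
  exact ⟨w, ⟨fun J ↦ (hw J).1, fun J ↦ (hw J).2.1, fun J ↦ (hw J).2.2.1,
    fun J ↦ (hw J).2.2.2.1⟩, fun J ↦ (hw J).2.2.2.2⟩

lemma IsDegenerateUStatistic.variance_eq (h : IsDegenerateUStatistic P d X W WJ)
    {J : Finset (Fin n)} (hJ : J.card = d) : Var[WJ J; P] = ∫ ω, WJ J ω ^ 2 ∂P := by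
  refine variance_of_integral_eq_zero (h.hoeffding.integrable J).aestronglyMeasurable.aemeasurable ?_
  have hne : ¬ J ⊆ ∅ := fun hs ↦ by
    have := h.one_le
    rw [Finset.subset_empty.1 hs] at hJ
    simp at hJ
    omega
  rw [← integral_condExp (sigmaAlg_le h.measurable_data ∅),
    integral_congr_ae (h.hoeffding.condExp_eq_zero J ∅ hne)]
  simp

lemma IsDegenerateUStatistic.variance_eq_sqNorm (h : IsDegenerateUStatistic P d X W WJ)
    {w : Finset (Fin n) → (∀ i, E i) → ℝ} (hw : IsCanonicalFamily (fun i ↦ P.map (X i)) w)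
    (hwX : ∀ J, WJ J =ᵐ[P] fun ω ↦ w J fun i ↦ X i ω) {J : Finset (Fin n)} (hJ : J.card = d) :
    Var[WJ J; P] = sqNorm (fun i ↦ P.map (X i)) w J := by
  rw [h.variance_eq hJ, sqNorm, ← (iIndepFun_iff_map_fun_eq_pi_map
    fun i ↦ (h.measurable_data i).aemeasurable).1 h.indep,
    integral_map (measurable_pi_iff.2 h.measurable_data).aemeasurable
      ((hw.measurable J).pow_const 2).aestronglyMeasurable]
  refine integral_congr_ae ?_
  filter_upwards [hwX J] with ω hω
  rw [hω]

/-- The components of a normalized degenerate `U`-statistic are orthogonal, so their variances add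
up to `1`. -/
lemma IsDegenerateUStatistic.sum_variance_eq_one (h : IsDegenerateUStatistic P d X W WJ)
    (hW : IsNormalizedL4 P W) : ∑ J ∈ Finset.powersetCard d Finset.univ, Var[WJ J; P] = 1 := by
  have : ∀ i, IsProbabilityMeasure (P.map (X i)) := fun i ↦
    Measure.isProbabilityMeasure_map (h.measurable_data i).aemeasurable
  obtain ⟨w, hw, hwX⟩ := h.exists_canonicalFamily hW.memLp
  rw [Finset.sum_congr rfl fun J hJ ↦
    h.variance_eq_sqNorm hw hwX (Finset.mem_powersetCard.1 hJ).2, ← integral_uStat_sq hw,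
    ← hW.second_moment_eq_one, ← (iIndepFun_iff_map_fun_eq_pi_map
    fun i ↦ (h.measurable_data i).aemeasurable).1 h.indep,
    integral_map (measurable_pi_iff.2 h.measurable_data).aemeasurable
      ((measurable_uStat hw).pow_const 2).aestronglyMeasurable]
  refine integral_congr_ae ?_
  filter_upwards [h.ae_eq_sum, ae_all_iff.2 hwX] with ω h1 h2
  rw [h1, uStat]
  congr 1
  exact Finset.sum_congr rfl fun J _ ↦ (h2 J).symm

/-- The Wasserstein estimate for degenerate `U`-statistics of independent data, where `ρ` bounds the
total variance of the components involving any given index. -/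
theorem IsDegenerateUStatistic.abs_integral_lipschitz_sub_le
    (h : IsDegenerateUStatistic P d X W WJ) (hW : IsNormalizedL4 P W) {ρ : ℝ} (hρ0 : 0 ≤ ρ)
    (hρ : ∀ i : Fin n, ∑ K : Finset (Fin n) with K.card = d ∧ i ∈ K, Var[WJ K; P] ≤ ρ)
    {f : ℝ → ℝ} (hf : LipschitzWith 1 f) :
    |∫ ω, f (W ω) ∂P - ∫ z, f z ∂(gaussianReal 0 1)|
      ≤ (√(2 / Real.pi) + 4 / 3) * √|∫ ω, W ω ^ 4 ∂P - 3|
        + √((4 ^ d + 1) * d * ρ) * (√(2 / Real.pi) + 2 * √2 / √3) := by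
  have : ∀ i, IsProbabilityMeasure (P.map (X i)) := fun i ↦
    Measure.isProbabilityMeasure_map (h.measurable_data i).aemeasurable
  have hXm : Measurable fun ω i ↦ X i ω := measurable_pi_iff.2 h.measurable_data
  have hlaw := (iIndepFun_iff_map_fun_eq_pi_map
    fun i ↦ (h.measurable_data i).aemeasurable).1 h.indep
  obtain ⟨w, hw, hwX⟩ := h.exists_canonicalFamily hW.memLp
  set D : Finset (Finset (Fin n)) := Finset.powersetCard d Finset.univ with hDdef
  have hD : ∀ J ∈ D, J.card = d := fun J hJ ↦ (Finset.mem_powersetCard.1 hJ).2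
  have hWu : W =ᵐ[P] fun ω ↦ uStat D w fun i ↦ X i ω := by
    filter_upwards [h.ae_eq_sum, ae_all_iff.2 hwX] with ω h1 h2
    rw [h1, uStat]
    exact Finset.sum_congr rfl fun J _ ↦ h2 J
  have trans : ∀ {φ : ℝ → ℝ}, Measurable φ → ∫ ω, φ (W ω) ∂P
      = ∫ x, φ (uStat D w x) ∂(Measure.pi fun i ↦ P.map (X i)) := fun {φ} hφ ↦ by
    rw [← hlaw, integral_map hXm.aemeasurable
      (f := fun x ↦ φ (uStat D w x)) (hφ.comp (measurable_uStat hw)).aestronglyMeasurable]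
    refine integral_congr_ae ?_
    filter_upwards [hWu] with ω hω
    rw [hω]
  have hvar : ∀ J ∈ D, Var[WJ J; P] = sqNorm (fun i ↦ P.map (X i)) w J := fun J hJ ↦
    h.variance_eq_sqNorm hw hwX (hD J hJ)
  have h1 : ∑ J ∈ D, sqNorm (fun i ↦ P.map (X i)) w J = 1 := by
    rw [← h.sum_variance_eq_one hW]
    exact Finset.sum_congr rfl fun J hJ ↦ (hvar J hJ).symm
  rw [trans hf.continuous.measurable, trans (φ := fun x ↦ x ^ 4) (by fun_prop)]
  refine DegenerateUStat.abs_integral_lipschitz_sub_le hw h.one_le hD h1 hρ0 (fun i ↦ ?_) hf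
  refine le_of_eq_of_le ?_ (hρ i)
  have e : D.filter (i ∈ ·) = Finset.univ.filter fun K : Finset (Fin n) ↦ K.card = d ∧ i ∈ K := by
    ext K; simp [hDdef]
  rw [← e]
  exact Finset.sum_congr rfl fun K hK ↦ (hvar K (Finset.mem_filter.1 hK).1).symm

end Transfer

/-! ### Symmetric `U`-statistics -/

lemma card_filter_card_eq_and_mem {n d : ℕ} (hd : 1 ≤ d) (i : Fin n) :
    n * (Finset.univ.filter fun K : Finset (Fin n) ↦ K.card = d ∧ i ∈ K).card
      = d * n.choose d := by
  obtain ⟨d, rfl⟩ := Nat.exists_eq_add_of_le' hd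
  obtain ⟨n, rfl⟩ : ∃ m, n = m + 1 := Nat.exists_eq_add_of_le' (by have := i.2; omega)
  have e : (Finset.univ.filter fun K : Finset (Fin (n + 1)) ↦ K.card = d + 1 ∧ i ∈ K)
      = (Finset.powersetCard d (Finset.univ.erase i)).image (insert i) := by
    ext K
    simp only [Finset.mem_filter, Finset.mem_univ, true_and, Finset.mem_image,
      Finset.mem_powersetCard]
    constructor
    · rintro ⟨h1, h2⟩
      exact ⟨K.erase i, ⟨Finset.erase_subset_erase i (Finset.subset_univ K),
        by rw [Finset.card_erase_of_mem h2, h1]; rfl⟩, Finset.insert_erase h2⟩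
    · rintro ⟨L, ⟨h1, h2⟩, rfl⟩
      have hi : i ∉ L := fun hi ↦ by simpa using h1 hi
      exact ⟨by rw [Finset.card_insert_of_notMem hi, h2], Finset.mem_insert_self _ _⟩
  rw [e, Finset.card_image_of_injOn, Finset.card_powersetCard,
    Finset.card_erase_of_mem (Finset.mem_univ i), Finset.card_univ, Fintype.card_fin,
    Nat.add_sub_cancel, Nat.add_one_mul_choose_eq, mul_comm]
  intro L hL L' hL' hLL'
  have key : ∀ {L : Finset (Fin (n + 1))}, L ∈ Finset.powersetCard d (Finset.univ.erase i) →
      (insert i L).erase i = L := fun {L} hL ↦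
    Finset.erase_insert fun hi ↦ by simpa using (Finset.mem_powersetCard.1 hL).1 hi
  rw [← key hL, ← key hL']
  exact congrArg (Finset.erase · i) hLL'

section Symmetric

variable {n d : ℕ} {Ω : Type*} [MeasurableSpace Ω] {P : Measure Ω} [IsProbabilityMeasure P]
  {E : Type*} [MeasurableSpace E] {X : Fin n → Ω → E} {W : Ω → ℝ}
  {WJ : Finset (Fin n) → Ω → ℝ}

/-- All components of a normalized symmetric `U`-statistic have the same variance, which is the
reciprocal of their number. -/
lemma IsSymmetricDegenerateUStatistic.variance_eq_inv_choose
    (h : IsSymmetricDegenerateUStatistic P d X W WJ) (hW : IsNormalizedL4 P W)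
    {J : Finset (Fin n)} (hJ : J.card = d) : Var[WJ J; P] = ((n.choose d : ℕ) : ℝ)⁻¹ := by
  have : ∀ i, IsProbabilityMeasure (P.map (X i)) := fun i ↦
    Measure.isProbabilityMeasure_map (h.measurable_data i).aemeasurable
  have hn : 0 < n := h.one_le.trans h.le
  obtain ⟨g, hg, hgJ⟩ := h.exists_common_kernel
  have hconst : ∀ K : Finset (Fin n), K.card = d → ∫ ω, WJ K ω ^ 2 ∂P
      = ∫ x, g x ^ 2 ∂(Measure.pi fun _ : Fin d ↦ P.map (X ⟨0, hn⟩)) := fun K hK ↦ by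
    have hi : iIndepFun (fun k ω ↦ X (K.orderEmbOfFin hK k) ω) P :=
      h.indep.precomp (K.orderEmbOfFin hK).injective
    have hm : ∀ k, Measurable fun ω ↦ X (K.orderEmbOfFin hK k) ω :=
      fun k ↦ h.measurable_data _
    have hl := (iIndepFun_iff_map_fun_eq_pi_map fun k ↦ (hm k).aemeasurable).1 hi
    have hid : (fun _ : Fin d ↦ P.map (X ⟨0, hn⟩))
        = fun k ↦ P.map fun ω ↦ X (K.orderEmbOfFin hK k) ω :=
      funext fun k ↦ (h.identDistrib _ _).map_eq
    rw [hid, ← hl, integral_map (measurable_pi_iff.2 hm).aemeasurable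
      (hg.pow_const 2).aestronglyMeasurable]
    refine integral_congr_ae ?_
    filter_upwards [hgJ K hK] with ω hω
    rw [hω]
  have hd : IsDegenerateUStatistic P d X W WJ := h.toIsDegenerateUStatistic
  have hone := hd.sum_variance_eq_one hW
  rw [Finset.sum_congr rfl fun K hK ↦ (hd.variance_eq (Finset.mem_powersetCard.1 hK).2).trans
    (hconst K (Finset.mem_powersetCard.1 hK).2), Finset.sum_const, Finset.card_powersetCard,
    Finset.card_univ, Fintype.card_fin, nsmul_eq_mul] at hone
  rw [hd.variance_eq hJ, hconst J hJ]
  exact eq_inv_of_mul_eq_one_right hone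

lemma IsSymmetricDegenerateUStatistic.sum_variance_eq
    (h : IsSymmetricDegenerateUStatistic P d X W WJ) (hW : IsNormalizedL4 P W) (i : Fin n) :
    ∑ K : Finset (Fin n) with K.card = d ∧ i ∈ K, Var[WJ K; P] = (d : ℝ) / n := by
  have hn : (n : ℝ) ≠ 0 := by have := h.one_le.trans h.le; positivity
  have hc : ((n.choose d : ℕ) : ℝ) ≠ 0 := by
    have := Nat.choose_pos h.le
    positivity
  rw [Finset.sum_congr rfl fun K hK ↦ h.variance_eq_inv_choose hW (Finset.mem_filter.1 hK).2.1,
    Finset.sum_const, nsmul_eq_mul, ← div_eq_mul_inv, div_eq_div_iff hc hn]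
  have := card_filter_card_eq_and_mem h.one_le i
  rw [mul_comm]
  exact_mod_cast this

lemma IsSymmetricDegenerateUStatistic.rhoSq_eq
    (h : IsSymmetricDegenerateUStatistic P d X W WJ) (hW : IsNormalizedL4 P W) :
    rhoSq P d WJ = (d : ℝ) / n := by
  have : Nonempty (Fin n) := ⟨⟨0, h.one_le.trans h.le⟩⟩
  simp_rw [rhoSq, h.sum_variance_eq hW]
  exact ciSup_const

/-- The constant `κ_d = d (4 ^ d + 1)`. -/
noncomputable def rateConst (d : ℕ) : ℝ≥0 := (4 ^ d + 1) * d

theorem IsSymmetricDegenerateUStatistic.abs_integral_lipschitz_sub_le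
    (h : IsSymmetricDegenerateUStatistic P d X W WJ) (hW : IsNormalizedL4 P W) {f : ℝ → ℝ}
    (hf : LipschitzWith 1 f) :
    |∫ ω, f (W ω) ∂P - ∫ z, f z ∂(gaussianReal 0 1)|
      ≤ (√(2 / Real.pi) + 4 / 3) * √|∫ ω, W ω ^ 4 ∂P - 3|
        + √((d : ℝ) * rateConst d) / √(n : ℝ) * (√(2 / Real.pi) + 2 * √2 / √3) := by
  have e : √((d : ℝ) * rateConst d) / √(n : ℝ) = √((4 ^ d + 1) * d * (d / n)) := by
    rw [← Real.sqrt_div (by positivity)]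
    congr 1
    simp only [rateConst]
    push_cast
    ring
  rw [e]
  exact h.toIsDegenerateUStatistic.abs_integral_lipschitz_sub_le hW (by positivity)
    (fun i ↦ (h.sum_variance_eq hW i).le) hf

end Symmetric

/-! ### Convergence in distribution -/

/-- Convergence of the expectations of `1`-Lipschitz functions implies convergence in
distribution. -/
lemma tendstoInDistribution_of_forall_lipschitz {Ω : ℕ → Type*} [∀ m, MeasurableSpace (Ω m)]
    {P : ∀ m, Measure (Ω m)} [∀ m, IsProbabilityMeasure (P m)] {W : ∀ m, Ω m → ℝ}
    {Ω' : Type*} [MeasurableSpace Ω'] {P' : Measure Ω'} [IsProbabilityMeasure P'] {Z : Ω' → ℝ}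
    (hW : ∀ m, AEMeasurable (W m) (P m)) (hZ : AEMeasurable Z P')
    (h : ∀ f : ℝ → ℝ, LipschitzWith 1 f →
      Tendsto (fun m ↦ ∫ ω, f (W m ω) ∂(P m)) atTop (nhds (∫ ω, f (Z ω) ∂P'))) :
    TendstoInDistribution W atTop Z P P' where
  forall_aemeasurable := hW
  aemeasurable_limit := hZ
  tendsto := by
    refine tendsto_iff_forall_lipschitz_integral_tendsto.2 fun f _ ⟨L, hL⟩ ↦ ?_
    have hL0 : (0 : ℝ) < L + 1 := by positivity
    -- dividing by `L + 1` rather than by `L` also covers constant functions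
    have hg : LipschitzWith 1 fun x ↦ ((L : ℝ) + 1)⁻¹ * f x := by
      refine LipschitzWith.of_dist_le_mul fun x y ↦ ?_
      have hxy := hL.dist_le_mul x y
      rw [Real.dist_eq] at hxy ⊢
      rw [← mul_sub, abs_mul, abs_of_pos (by positivity), inv_mul_le_iff₀ hL0]
      simp only [NNReal.coe_one, one_mul]
      exact hxy.trans (mul_le_mul_of_nonneg_right (by linarith) dist_nonneg)
    have key := (h _ hg).const_mul ((L : ℝ) + 1)
    simp_rw [integral_const_mul, mul_inv_cancel_left₀ hL0.ne'] at key
    have e : ∀ m, ∫ x, f x ∂((P m).map (W m)) = ∫ ω, f (W m ω) ∂(P m) := fun m ↦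
      integral_map (hW m) hL.continuous.aestronglyMeasurable
    have e' : ∫ x, f x ∂(P'.map Z) = ∫ ω, f (Z ω) ∂P' :=
      integral_map hZ hL.continuous.aestronglyMeasurable
    simpa only [ProbabilityMeasure.coe_mk, e, e'] using key

end DegenerateUStat

theorem corollary1p3 :
    (∃ κ : ℕ → ℝ≥0, ∀ (d n : ℕ)
      {Ω : Type*} [MeasurableSpace Ω] (P : Measure Ω) [IsProbabilityMeasure P]
      {E : Type*} [MeasurableSpace E]
      (X : Fin n → Ω → E) (W : Ω → ℝ) (WJ : Finset (Fin n) → Ω → ℝ)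
      {Ω' : Type*} [MeasurableSpace Ω'] (P' : Measure Ω') [IsProbabilityMeasure P'] (Z : Ω' → ℝ),
      DegenerateUStat.IsSymmetricDegenerateUStatistic P d X W WJ →
      DegenerateUStat.IsNormalizedL4 P W →
      HasLaw Z (gaussianReal 0 1) P' →
        DegenerateUStat.rhoSq P d WJ = (d : ℝ) / n ∧
        DegenerateUStat.dWass P P' W Z ≤ ENNReal.ofReal
          ((√(2 / Real.pi) + 4 / 3) * √|(∫ ω, W ω ^ 4 ∂P) - 3|
            + √((d : ℝ) * κ d) / √(n : ℝ) * (√(2 / Real.pi) + 2 * √2 / √3))) ∧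
    (∀ (d : ℕ) (n : ℕ → ℕ)
      {Ω : ℕ → Type*} [∀ m, MeasurableSpace (Ω m)] (P : ∀ m, Measure (Ω m))
      [∀ m, IsProbabilityMeasure (P m)]
      {E : ℕ → Type*} [∀ m, MeasurableSpace (E m)]
      (X : ∀ m, Fin (n m) → Ω m → E m) (W : ∀ m, Ω m → ℝ)
      (WJ : ∀ m, Finset (Fin (n m)) → Ω m → ℝ)
      {Ω' : Type*} [MeasurableSpace Ω'] (P' : Measure Ω') [IsProbabilityMeasure P'] (Z : Ω' → ℝ),
      Tendsto n atTop atTop →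
      (∀ m, DegenerateUStat.IsSymmetricDegenerateUStatistic (P m) d (X m) (W m) (WJ m)) →
      (∀ m, DegenerateUStat.IsNormalizedL4 (P m) (W m)) →
      HasLaw Z (gaussianReal 0 1) P' →
      Tendsto (fun m ↦ ∫ ω, W m ω ^ 4 ∂(P m)) atTop (nhds 3) →
        TendstoInDistribution W atTop Z P P') := by
  refine ⟨⟨DegenerateUStat.rateConst, ?_⟩, ?_⟩
  · intro d n Ω _ P _ E _ X W WJ Ω' _ P' _ Z h hW hZ
    refine ⟨h.rhoSq_eq hW, iSup₂_le fun f hf ↦ ENNReal.ofReal_le_ofReal ?_⟩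
    have e : ∫ ω, f (Z ω) ∂P' = ∫ z, f z ∂(gaussianReal 0 1) :=
      hZ.integral_comp hf.continuous.aestronglyMeasurable
    rw [e]
    exact h.abs_integral_lipschitz_sub_le hW hf
  · intro d n Ω _ P _ E _ X W WJ Ω' _ P' _ Z hn h hW hZ h4
    refine DegenerateUStat.tendstoInDistribution_of_forall_lipschitz
      (fun m ↦ (hW m).memLp.aestronglyMeasurable.aemeasurable) hZ.aemeasurable fun f hf ↦ ?_
    have e : ∫ ω, f (Z ω) ∂P' = ∫ z, f z ∂(gaussianReal 0 1) :=
      hZ.integral_comp hf.continuous.aestronglyMeasurable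
    rw [e, tendsto_iff_dist_tendsto_zero]
    refine squeeze_zero (fun _ ↦ dist_nonneg)
      (fun m ↦ (h m).abs_integral_lipschitz_sub_le (hW m) hf) ?_
    have t1 : Tendsto (fun m ↦ √|∫ ω, W m ω ^ 4 ∂(P m) - 3|) atTop (nhds 0) := by
      have := (h4.sub_const 3).abs.sqrt
      simpa using this
    have t2 : Tendsto (fun m ↦ √((d : ℝ) * DegenerateUStat.rateConst d) / √(n m : ℝ)) atTop
        (nhds 0) :=
      tendsto_const_nhds.div_atTop
        (Real.tendsto_sqrt_atTop.comp (tendsto_natCast_atTop_atTop.comp hn))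
    simpa using (t1.const_mul (√(2 / Real.pi) + 4 / 3)).add
      (t2.mul_const (√(2 / Real.pi) + 2 * √2 / √3))
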